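/- **Setting.** Let $d\ge 1$ and let $\Lambda$ be a stationary random Borel measure on $\mathbb{R}^d$ (a random element of the space of Borel measures with the evaluation $\sigma$-algebra, whose law is invariant under the shifts $\vartheta_x\mu(A)=\mu(A+x)$) with $\mathbb{E}[\Lambda([0,1]^d)]=1$. Let $\lambda>0$ and let $X^\lambda$ be a Cox point process with intensity measure $\lambda\Lambda$: conditioned on $\Lambda$, $X^\lambda$ is a Poisson point process with intensity measure $\lambda\Lambda$. Put $Q_a=[-a/2,a/2]^d$, let $B_r(o)$ be the Euclidean ball of radius $r$ around the origin $o$, and let $|\cdot|$ be Lebesgue measure. The distributions of the Palm versions $\Lambda^*$ and $X^{\lambda,*}$ are defined by $$\mathbb{E}[f(\Lambda^*)]=\mathbb{E}\Big[\int_{Q_1}f(\vartheta_x\Lambda)\,\Lambda(\mathrm{d}x)\Big],\qquad \mathbb{E}[f(X^{\lambda,*})]=\frac1\lambda\,\mathbb{E}\Big[\sum_{X_i\in X^\lambda\cap Q_1}f(X^\lambda-X_i)\Big]$$ for measurable $f\ge 0$. For $r>0$, the Gilbert graph $g_r(X^{\lambda,*})$ has vertex set $X^{\lambda,*}$ and an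 edge between any two distinct points at distance less than $r$, and $$\theta(\lambda,r)=\mathbb{P}\big(o\text{ lies in an infinite connected component of }g_r(X^{\lambda,*})\big).$$ **Theorem.** (i) One has $$\liminf_{r\to\infty}r^{-d}\log(1-\theta(\lambda,r))\;\ge\;\liminf_{r\to\infty}r^{-d}\log\mathbb{E}[\exp(-\lambda\Lambda^*(B_r(o)))].$$ (ii) Suppose in addition that $d\ge 2$, that $\Lambda$ is $b$-dependent for some $b\ge 0$ (the restrictions of $\Lambda$ to Borel sets $A$ and $B$ are independent whenever $\inf\{|x-y|: x\in A,\,y\in B\}>b$), and that $\Lambda(Q_1)$ has all exponential moments ($\mathbb{E}[e^{\alpha\Lambda(Q_1)}]<\infty$ for all $\alpha>0$). Then the limit $$I^*=-\lim_{r\to\infty}r^{-d}\log\mathbb{E}[\exp(-\lambda\Lambda(Q_r))]$$ exists in $\mathbb{R}$, and $$\lim_{r\to\infty}r^{-d}\log(1-\theta(\lambda,r))=-|B_1(o)|\,I^*.$$ -/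

import Mathlib

open MeasureTheory ProbabilityTheory Filter Topology
open scoped ENNReal NNReal

noncomputable section

namespace CoxPercolation

/-- The Euclidean space `ℝ^d`. -/
abbrev E (d : ℕ) : Type := EuclideanSpace ℝ (Fin d)

/-- The closed cube `Q_a = [-a/2, a/2]^d`. -/
def cube (d : ℕ) (a : ℝ) : Set (E d) := {x | ∀ i, -(a / 2) ≤ x i ∧ x i ≤ a / 2}

/-- The cube `[0,1]^d`. -/
def unitCube (d : ℕ) : Set (E d) := {x | ∀ i, 0 ≤ x i ∧ x i ≤ 1}

/-- The shift `ϑ_x μ`, given by `(ϑ_x μ)(A) = μ(A + x)`; for `μ = ∑ δ_{x_i}` this is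
`∑ δ_{x_i - x}`. -/
def shift {d : ℕ} (x : E d) (μ : Measure (E d)) : Measure (E d) := μ.map (fun y => y - x)

section RandomMeasures

variable {Ω : Type*} [MeasurableSpace Ω] {d : ℕ}

/-- A stationary random measure: its law on the space of Borel measures, with the σ-algebra
generated by the evaluations, is invariant under all shifts. -/
structure IsStationaryRandomMeasure (P : Measure Ω) (Λ : Ω → Measure (E d)) : Prop where
  measurable : Measurable Λ
  map_shift : ∀ x : E d, P.map (fun ω => shift x (Λ ω)) = P.map Λ

/-- The distance `inf {|x - y| : x ∈ A, y ∈ B}` of two sets (`∞` if one of them is empty). -/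
def setDist (A B : Set (E d)) : ℝ≥0∞ := ⨅ x ∈ A, ⨅ y ∈ B, edist x y

/-- `b`-dependence: the restrictions of `Λ` to `A` and to `B` are independent whenever
`dist(A, B) > b`. -/
def IsDependent (P : Measure Ω) (Λ : Ω → Measure (E d)) (b : ℝ≥0) : Prop :=
  ∀ A B : Set (E d), MeasurableSet A → MeasurableSet B → (b : ℝ≥0∞) < setDist A B →
    IndepFun (fun ω => (Λ ω).restrict A) (fun ω => (Λ ω).restrict B) P

/-- All exponential moments of a `[0,∞]`-valued random variable are finite. -/
def HasAllExpMoments (P : Measure Ω) (Y : Ω → ℝ≥0∞) : Prop :=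
  ∀ α : ℝ, 0 < α → ∫⁻ ω, EReal.exp ((ENNReal.ofReal α * Y ω : ℝ≥0∞) : EReal) ∂P < ∞

/-- `Q` is the law of a Poisson point process with intensity measure `m`; point configurations
are counting measures. -/
structure IsPoissonLaw (m : Measure (E d)) (Q : Measure (Measure (E d))) : Prop where
  isProbabilityMeasure : IsProbabilityMeasure Q
  map_count : ∀ B : Set (E d), MeasurableSet B → m B ≠ ∞ →
    Q.map (fun ν => ν B) = (poissonMeasure (m B).toNNReal).map (fun n : ℕ => (n : ℝ≥0∞))
  indep_count : ∀ (k : ℕ) (B : Fin k → Set (E d)), (∀ i, MeasurableSet (B i)) →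
    Pairwise (fun i j => Disjoint (B i) (B j)) →
    iIndepFun (fun (i : Fin k) (ν : Measure (E d)) => ν (B i)) Q

/-- `X` is a Cox process with random intensity measure `M`: conditioned on `M`, the point process
`X` is a Poisson point process with intensity measure `M`. The kernel `κ` is a regular version of
the conditional law of `X` given `M`. -/
structure IsCoxProcess (P : Measure Ω) (M X : Ω → Measure (E d)) : Prop where
  measurable : Measurable X
  exists_kernel : ∃ κ : Kernel (Measure (E d)) (Measure (E d)), IsMarkovKernel κ ∧
    P.map (fun ω => (M ω, X ω)) = (P.map M).compProd κ ∧
    ∀ᵐ m ∂(P.map M), IsPoissonLaw m (κ m)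

/-- The expectation `E[f(ξ^*)]` under the Palm version `ξ^*` of a stationary random measure (or
point process) `ξ` of intensity `c`:
`E[f(ξ^*)] = c⁻¹ E[∫_{Q_1} f(ϑ_x ξ) ξ(dx)]`.
For a point process the inner integral is the sum of `f(ξ - X_i)` over the points `X_i` in
`Q_1`. -/
def palmExpectation (P : Measure Ω) (ξ : Ω → Measure (E d)) (c : ℝ≥0∞)
    (f : Measure (E d) → ℝ≥0∞) : ℝ≥0∞ :=
  c⁻¹ * ∫⁻ ω, ∫⁻ x in cube d 1, f (shift x (ξ ω)) ∂(ξ ω) ∂P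

end RandomMeasures

/-- The points of a counting measure. -/
def points {d : ℕ} (ν : Measure (E d)) : Set (E d) := {x | ν {x} ≠ 0}

/-- The Gilbert graph: distinct points are joined if their distance is less than `r`. -/
def gilbertGraph {d : ℕ} (r : ℝ) (V : Set (E d)) : SimpleGraph V where
  Adj x y := x ≠ y ∧ dist (x : E d) (y : E d) < r
  symm := ⟨fun _ _ h => ⟨h.1.symm, by rw [dist_comm]; exact h.2⟩⟩
  loopless := ⟨fun _ h => h.1 rfl⟩

/-- The event that the origin is a point of `ν` and lies in an infinite connected component of
the Gilbert graph on the points of `ν`. -/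
def originPercolates {d : ℕ} (r : ℝ) : Set (Measure (E d)) :=
  {ν | ∃ h : (0 : E d) ∈ points ν,
    ((gilbertGraph r (points ν)).connectedComponentMk ⟨0, h⟩).supp.Infinite}

/-- The percolation probability `θ(λ, r)` of the Palm version of a Cox process `X` of
intensity `λ`. -/
def percolationProbability {Ω : Type*} [MeasurableSpace Ω] {d : ℕ} (P : Measure Ω)
    (X : Ω → Measure (E d)) (lam r : ℝ) : ℝ≥0∞ :=
  palmExpectation P X (ENNReal.ofReal lam) ((originPercolates r).indicator 1)

/-- The functional `μ ↦ exp(-λ μ(B))` (with value `0` if `μ(B) = ∞`). -/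
def expNeg {d : ℕ} (lam : ℝ) (B : Set (E d)) (μ : Measure (E d)) : ℝ≥0∞ :=
  EReal.exp (-((ENNReal.ofReal lam * μ B : ℝ≥0∞) : EReal))

/-- `r^{-d} log p`, with `log 0 = -∞`. -/
def logRate (d : ℕ) (r : ℝ) (p : ℝ≥0∞) : EReal := (((r ^ d)⁻¹ : ℝ) : EReal) * ENNReal.log p

end CoxPercolation

end

/-! The Cox process does not percolate from a typical point if no other point lies in the ball of
radius `r` around it, which gives the first claim and turns lower bounds for void probabilities of
balls into lower bounds for `1 - θ`. For a `b`-dependent measure the void cost of cubes is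
superadditive up to corridors of constant width, hence asymptotic to `I* a^d`. A ball filled by
lattice cells costs essentially no more than the cores of its cells, since the exponential moments
make the mass of the thin corridors negligible on the scale `r^d`.

For the upper bound let the mesh `s` of the cells be a small multiple of `r`. If the cluster of a
point close to the origin is finite, then the cells near the cluster that do not meet it are vacant.
For a cluster near the origin there are at least `n - 1` such cells, where `n` is the number of
cells in a discrete ball of radius about `r` (a sumset `S + D` in `ℤ^d` has at least
`|S| + |D| - 1` elements). For a large cluster there is a long star-connected path of vacant cells
along its outer boundary; this boundary is star-connected because `1`-cocycles modulo two on the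
star-lattice have potentials. The cores of the cells are independent, so a union bound over these
families of cells leaves `exp(-(n - 1) I* s^d)`, and `n s^d` is about `|B_1| r^d`. -/

noncomputable section

namespace CoxPercolation

/-! ### Boxes and lattice cells -/

section Boxes

variable {d : ℕ} {s β : ℝ}

/-- The closed box with lower corner `c` and side length `a`. -/
def box (c : Fin d → ℝ) (a : ℝ) : Set (E d) := {x | ∀ i, c i ≤ x i ∧ x i ≤ c i + a}

/-- The half-open lattice cell `s z + [0, s)^d`; for fixed `s > 0` these partition the space. -/
def cell (s : ℝ) (z : Fin d → ℤ) : Set (E d) := {x | ∀ i, s * z i ≤ x i ∧ x i < s * z i + s}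

/-- The closed core of a lattice cell, at distance `β` from its faces: cores of distinct cells are
separated by corridors of width `2 β`. -/
def core (s β : ℝ) (z : Fin d → ℤ) : Set (E d) := box (fun i => s * z i + β) (s - 2 * β)

/-- The index of the lattice cell containing a point. -/
def cellIndex (s : ℝ) (x : E d) : Fin d → ℤ := fun i => ⌊x i / s⌋

lemma box_eq_preimage_ofLp (c : Fin d → ℝ) (a : ℝ) :
    (box c a : Set (E d)) = WithLp.ofLp ⁻¹' Set.univ.pi fun i => Set.Icc (c i) (c i + a) := by
  ext x; simp [box, -Set.pi_univ_Icc]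

lemma cell_eq_preimage_ofLp (s : ℝ) (z : Fin d → ℤ) :
    (cell s z : Set (E d))
      = WithLp.ofLp ⁻¹' Set.univ.pi fun i => Set.Ico (s * z i) (s * z i + s) := by
  ext x; simp [cell]

lemma cube_eq_box (a : ℝ) : cube d a = box (fun _ => -(a / 2)) a := by
  ext x
  refine forall_congr' fun i => ?_
  rw [show -(a / 2) + a = a / 2 by ring]

lemma unitCube_eq_box : unitCube d = box (fun _ => 0) 1 := by
  ext x; simp [unitCube, box]

lemma measurableSet_box (c : Fin d → ℝ) (a : ℝ) : MeasurableSet (box c a : Set (E d)) := by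
  rw [box_eq_preimage_ofLp]
  exact (MeasurableSet.univ_pi fun _ => measurableSet_Icc).preimage
    (PiLp.volume_preserving_ofLp (Fin d)).measurable

lemma measurableSet_cell (s : ℝ) (z : Fin d → ℤ) : MeasurableSet (cell s z : Set (E d)) := by
  rw [cell_eq_preimage_ofLp]
  exact (MeasurableSet.univ_pi fun _ => measurableSet_Ico).preimage
    (PiLp.volume_preserving_ofLp (Fin d)).measurable

lemma measurableSet_cube (a : ℝ) : MeasurableSet (cube d a) := by
  rw [cube_eq_box]; exact measurableSet_box _ _

lemma measurableSet_core (s β : ℝ) (z : Fin d → ℤ) : MeasurableSet (core s β z : Set (E d)) :=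
  measurableSet_box _ _

lemma volume_box (c : Fin d → ℝ) (a : ℝ) :
    volume (box c a : Set (E d)) = ENNReal.ofReal a ^ d := by
  rw [box_eq_preimage_ofLp, (PiLp.volume_preserving_ofLp (Fin d)).measure_preimage
    (MeasurableSet.univ_pi fun _ => measurableSet_Icc).nullMeasurableSet, volume_pi, Measure.pi_pi]
  simp

lemma volume_cell (s : ℝ) (z : Fin d → ℤ) :
    volume (cell s z : Set (E d)) = ENNReal.ofReal s ^ d := by
  rw [cell_eq_preimage_ofLp, (PiLp.volume_preserving_ofLp (Fin d)).measure_preimage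
    (MeasurableSet.univ_pi fun _ => measurableSet_Ico).nullMeasurableSet, Real.volume_pi_Ico]
  simp

lemma abs_apply_sub_le_dist (x y : E d) (i : Fin d) : |x i - y i| ≤ dist x y := by
  rw [dist_eq_norm, ← Real.norm_eq_abs]
  exact PiLp.norm_apply_le (x - y) i

lemma ofReal_le_edist_of_le_abs {x y : E d} {a : ℝ} (i : Fin d) (h : a ≤ |x i - y i|) :
    ENNReal.ofReal a ≤ edist x y := by
  rw [edist_dist]
  exact ENNReal.ofReal_le_ofReal (h.trans (abs_apply_sub_le_dist x y i))

lemma dist_le_of_forall_abs_le {x y : E d} {a : ℝ} (ha : 0 ≤ a) (h : ∀ i, |x i - y i| ≤ a) :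
    dist x y ≤ a * √d := by
  rw [EuclideanSpace.dist_eq]
  refine Real.sqrt_le_iff.2 ⟨by positivity, ?_⟩
  rw [mul_pow, Real.sq_sqrt (by positivity)]
  calc ∑ i, dist (x i) (y i) ^ 2 ≤ ∑ _i : Fin d, a ^ 2 :=
        Finset.sum_le_sum fun i _ => pow_le_pow_left₀ dist_nonneg (h i) 2
    _ = a ^ 2 * d := by simp [mul_comm]

lemma isBounded_box (c : Fin d → ℝ) (a : ℝ) : Bornology.IsBounded (box c a : Set (E d)) := by
  refine (Metric.isBounded_closedBall (x := WithLp.toLp 2 c) (r := |a| * √d)).subset fun x hx =>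
    dist_le_of_forall_abs_le (abs_nonneg a) fun i => ?_
  have hxi := hx i
  rw [abs_of_nonneg (by simpa using hxi.1)]
  exact (sub_le_iff_le_add'.2 hxi.2).trans (le_abs_self a)

lemma isBounded_cube (a : ℝ) : Bornology.IsBounded (cube d a) := by
  rw [cube_eq_box]; exact isBounded_box _ _

lemma dist_le_of_mem_cube_one {x : E d} (hx : x ∈ cube d 1) : dist x 0 ≤ √d := by
  refine (dist_le_of_forall_abs_le zero_le_one fun i => ?_).trans_eq (one_mul _)
  have := hx i
  rw [abs_le]
  constructor <;> simp <;> linarith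

lemma mem_cell_iff (hs : 0 < s) {z : Fin d → ℤ} {x : E d} :
    x ∈ cell s z ↔ cellIndex s x = z := by
  simp only [cell, cellIndex, Set.mem_ofPred_eq, funext_iff, Int.floor_eq_iff, le_div_iff₀ hs,
    div_lt_iff₀ hs]
  refine forall_congr' fun i => ?_
  rw [mul_comm s, add_mul, one_mul]

lemma mem_cell_cellIndex (hs : 0 < s) (x : E d) : x ∈ cell s (cellIndex s x) :=
  (mem_cell_iff hs).2 rfl

lemma dist_le_of_mem_cell (hs : 0 ≤ s) {z : Fin d → ℤ} {x y : E d} (hx : x ∈ cell s z)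
    (hy : y ∈ cell s z) : dist x y ≤ s * √d := by
  refine dist_le_of_forall_abs_le hs fun i => ?_
  have hxi := hx i
  have hyi := hy i
  rw [abs_le]
  constructor <;> linarith

lemma cell_half_subset (hs : 0 < s) (x : E d) :
    cell (s / 2) (cellIndex (s / 2) x) ⊆ cell s (cellIndex s x) := by
  intro y hy
  rw [mem_cell_iff (half_pos hs)] at hy
  rw [mem_cell_iff hs]
  funext i
  have hfloor : ∀ t : ℝ, ⌊t / s⌋ = ⌊t / (s / 2)⌋ / (2 : ℕ) := fun t => by
    rw [← Int.floor_div_natCast, div_div, Nat.cast_ofNat, div_mul_cancel₀ s two_ne_zero]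
  simpa only [cellIndex, hfloor] using congrArg (· / ((2 : ℕ) : ℤ)) (congrFun hy i)

lemma isBounded_cell (hs : 0 ≤ s) (z : Fin d → ℤ) : Bornology.IsBounded (cell s z : Set (E d)) :=
  Metric.isBounded_iff.2 ⟨s * √d, fun _ hx _ hy => dist_le_of_mem_cell hs hx hy⟩

lemma pairwiseDisjoint_cell (hs : 0 < s) (F : Set (Fin d → ℤ)) :
    F.PairwiseDisjoint (cell s : (Fin d → ℤ) → Set (E d)) := fun _ _ _ _ hne =>
  Set.disjoint_left.2 fun _ hz hw =>
    hne (((mem_cell_iff hs).1 hz).symm.trans ((mem_cell_iff hs).1 hw))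

lemma card_mul_pow_le_volume (hs : 0 < s) (F : Finset (Fin d → ℤ)) {A : Set (E d)}
    (h : ∀ z ∈ F, cell s z ⊆ A) : (F.card : ℝ≥0∞) * ENNReal.ofReal s ^ d ≤ volume A :=
  calc (F.card : ℝ≥0∞) * ENNReal.ofReal s ^ d = ∑ z ∈ F, volume (cell s z : Set (E d)) := by
        simp [volume_cell]
    _ = volume (⋃ z ∈ F, cell s z : Set (E d)) :=
        (measure_biUnion_finset (pairwiseDisjoint_cell hs _)
          fun z _ => measurableSet_cell s z).symm
    _ ≤ volume A := measure_mono (Set.iUnion₂_subset h)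

lemma volume_le_card_mul_pow (F : Finset (Fin d → ℤ)) {A : Set (E d)}
    (h : A ⊆ ⋃ z ∈ F, cell s z) : volume A ≤ (F.card : ℝ≥0∞) * ENNReal.ofReal s ^ d :=
  calc volume A ≤ volume (⋃ z ∈ F, cell s z) := measure_mono h
    _ ≤ ∑ z ∈ F, volume (cell s z : Set (E d)) := measure_biUnion_finset_le _ _
    _ = (F.card : ℝ≥0∞) * ENNReal.ofReal s ^ d := by simp [volume_cell]

/-- The indices of the cells that meet a set. -/
def cellsMeeting (s : ℝ) (A : Set (E d)) : Set (Fin d → ℤ) := {z | (cell s z ∩ A).Nonempty}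

lemma finite_cellsMeeting (hs : 0 < s) {A : Set (E d)} (hA : Bornology.IsBounded A) :
    (cellsMeeting s A).Finite := by
  obtain ⟨R, hR⟩ := hA.subset_closedBall 0
  refine (Set.finite_Icc (fun _ : Fin d => ⌊-R / s⌋) (fun _ => ⌊R / s⌋)).subset ?_
  rintro z ⟨x, hxz, hxA⟩
  have hx : ∀ i, -R ≤ x i ∧ x i ≤ R := fun i =>
    abs_le.1 (by simpa using (abs_apply_sub_le_dist x 0 i).trans (hR hxA))
  obtain rfl := (mem_cell_iff hs).1 hxz
  exact ⟨fun i => Int.floor_le_floor (div_le_div_of_nonneg_right (hx i).1 hs.le),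
    fun i => Int.floor_le_floor (div_le_div_of_nonneg_right (hx i).2 hs.le)⟩

lemma exists_finset_cell_inter_nonempty (hs : 0 < s) {A : Set (E d)}
    (hA : Bornology.IsBounded A) :
    ∃ F : Finset (Fin d → ℤ), (∀ z, z ∈ F ↔ (cell s z ∩ A).Nonempty) ∧
      A ⊆ ⋃ z ∈ F, cell s z := by
  refine ⟨(finite_cellsMeeting hs hA).toFinset, fun z => by simp [cellsMeeting], fun x hx => ?_⟩
  simp only [Set.Finite.mem_toFinset, Set.mem_iUnion]
  exact ⟨cellIndex s x, ⟨x, mem_cell_cellIndex hs x, hx⟩, mem_cell_cellIndex hs x⟩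

lemma core_subset_cell (hβ : 0 < β) (z : Fin d → ℤ) : (core s β z : Set (E d)) ⊆ cell s z := by
  intro x hx i
  have := hx i
  constructor <;> linarith

lemma pairwiseDisjoint_core (hs : 0 < s) (hβ : 0 < β) (F : Set (Fin d → ℤ)) :
    F.PairwiseDisjoint (core s β : (Fin d → ℤ) → Set (E d)) :=
  (pairwiseDisjoint_cell hs F).mono fun z => core_subset_cell hβ z

lemma exists_add_one_le_of_ne {z w : Fin d → ℤ} (h : z ≠ w) :
    ∃ i, z i + 1 ≤ w i ∨ w i + 1 ≤ z i := by
  obtain ⟨i, hi⟩ := Function.ne_iff.1 h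
  exact ⟨i, by lia⟩

lemma le_edist_of_mem_core (hs : 0 ≤ s) {z w : Fin d → ℤ} (h : z ≠ w) {x y : E d}
    (hx : x ∈ core s β z) (hy : y ∈ core s β w) : ENNReal.ofReal (2 * β) ≤ edist x y := by
  obtain ⟨i, hi⟩ := exists_add_one_le_of_ne h
  refine ofReal_le_edist_of_le_abs i ?_
  have hxi := hx i
  have hyi := hy i
  rw [le_abs]
  rcases hi with hi | hi
  · have : (z i : ℝ) + 1 ≤ w i := by exact_mod_cast hi
    right; nlinarith
  · have : (w i : ℝ) + 1 ≤ z i := by exact_mod_cast hi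
    left; nlinarith

lemma le_edist_of_mem_cube_of_mem_core [NeZero d] (hs : 0 ≤ s) {a : ℝ} {z : Fin d → ℤ} {x y : E d}
    (hx : x ∈ cube d a) (hy : y ∈ core s β z) : ENNReal.ofReal (β - a / 2) ≤ edist x y := by
  refine ofReal_le_edist_of_le_abs 0 ?_
  have hx0 := hx 0
  have hy0 := hy 0
  rw [le_abs]
  rcases le_or_gt 0 (z 0) with hz | hz
  · have : (0 : ℝ) ≤ z 0 := by exact_mod_cast hz
    right; nlinarith
  · have : (z 0 : ℝ) + 1 ≤ 0 := by exact_mod_cast hz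
    left; nlinarith

lemma disjoint_cube_core [NeZero d] (hs : 0 ≤ s) {a : ℝ} (ha : a / 2 < β) (z : Fin d → ℤ) :
    Disjoint (cube d a) (core s β z) := by
  refine Set.disjoint_left.2 fun x hx hx' => ?_
  have hle := le_edist_of_mem_cube_of_mem_core hs hx hx'
  rw [edist_self, nonpos_iff_eq_zero, ENNReal.ofReal_eq_zero] at hle
  linarith

end Boxes

/-! ### Stationary and `b`-dependent random measures -/

section RandomMeasures

variable {Ω : Type*} [MeasurableSpace Ω] {d : ℕ} {P : Measure Ω} {Λ : Ω → Measure (E d)}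

lemma shift_apply (x : E d) (μ : Measure (E d)) {A : Set (E d)} (hA : MeasurableSet A) :
    shift x μ A = μ ((fun y => y - x) ⁻¹' A) :=
  Measure.map_apply (by fun_prop) hA

lemma shift_singleton (x y : E d) (μ : Measure (E d)) : shift x μ {y} = μ {y + x} := by
  rw [shift_apply _ _ (measurableSet_singleton _)]
  congr 1
  ext z
  simp [sub_eq_iff_eq_add]

lemma measurable_shift (x : E d) : Measurable (shift x : Measure (E d) → Measure (E d)) :=
  Measure.measurable_map _ (by fun_prop)

lemma measurable_restrict {A : Set (E d)} (hA : MeasurableSet A) :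
    Measurable fun μ : Measure (E d) => μ.restrict A := by
  refine Measure.measurable_of_measurable_coe _ fun B hB => ?_
  simp only [Measure.restrict_apply hB]
  exact Measure.measurable_coe (hB.inter hA)

lemma measurable_smul_randomMeasure (c : ℝ≥0∞) (hΛ : Measurable Λ) :
    Measurable fun ω => c • Λ ω := by
  refine Measure.measurable_of_measurable_coe _ fun A hA => ?_
  simp only [Measure.smul_apply, smul_eq_mul]
  exact ((Measure.measurable_coe hA).comp hΛ).const_mul c

namespace IsStationaryRandomMeasure

lemma lintegral_shift (hΛ : IsStationaryRandomMeasure P Λ) (x : E d)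
    {f : Measure (E d) → ℝ≥0∞} (hf : Measurable f) :
    ∫⁻ ω, f (shift x (Λ ω)) ∂P = ∫⁻ ω, f (Λ ω) ∂P := by
  rw [← lintegral_map hf hΛ.measurable, ← hΛ.map_shift x]
  exact (lintegral_map hf ((measurable_shift x).comp hΛ.measurable)).symm

lemma lintegral_box (hΛ : IsStationaryRandomMeasure P Λ)
    {g : ℝ≥0∞ → ℝ≥0∞} (hg : Measurable g) (c c' : Fin d → ℝ) (a : ℝ) :
    ∫⁻ ω, g (Λ ω (box c a)) ∂P = ∫⁻ ω, g (Λ ω (box c' a)) ∂P := by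
  rw [← hΛ.lintegral_shift (WithLp.toLp 2 (c - c')) (f := fun μ => g (μ (box c' a)))
    (hg.comp (Measure.measurable_coe (measurableSet_box _ _)))]
  refine lintegral_congr fun ω => ?_
  rw [shift_apply _ _ (measurableSet_box _ _)]
  congr 2
  ext x
  refine forall_congr' fun i => ?_
  simp only [PiLp.sub_apply, Pi.sub_apply]
  constructor <;> rintro ⟨_, _⟩ <;> constructor <;> linarith

lemma isAddLeftInvariant_bind (hΛ : IsStationaryRandomMeasure P Λ) :
    (P.bind Λ).IsAddLeftInvariant := by
  refine ⟨fun x => Measure.ext fun A hA => ?_⟩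
  rw [Measure.map_apply (measurable_const_add x) hA,
    Measure.bind_apply (measurable_const_add x hA) hΛ.measurable.aemeasurable,
    Measure.bind_apply hA hΛ.measurable.aemeasurable,
    ← hΛ.lintegral_shift (-x) (Measure.measurable_coe hA)]
  refine lintegral_congr fun ω => ?_
  rw [shift_apply _ _ hA]
  congr 1
  ext y
  simp [add_comm]

lemma isLocallyFiniteMeasure_bind (hΛ : IsStationaryRandomMeasure P Λ)
    (hfin : ∫⁻ ω, Λ ω (unitCube d) ∂P ≠ ∞) : IsLocallyFiniteMeasure (P.bind Λ) := by
  refine ⟨fun x => ⟨box (fun i => x i - 1 / 2) 1, ?_, ?_⟩⟩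
  · refine mem_of_superset (Metric.ball_mem_nhds x (ε := 1 / 2) (by norm_num)) fun y hy i => ?_
    have := abs_lt.1 ((abs_apply_sub_le_dist y x i).trans_lt hy)
    constructor <;> linarith
  · rw [Measure.bind_apply (measurableSet_box _ _) hΛ.measurable.aemeasurable]
    rw [unitCube_eq_box] at hfin
    exact (hΛ.lintegral_box measurable_id _ _ 1).trans_lt hfin.lt_top

lemma bind_eq_smul_volume (hΛ : IsStationaryRandomMeasure P Λ)
    (hfin : ∫⁻ ω, Λ ω (unitCube d) ∂P ≠ ∞) :
    P.bind Λ = (∫⁻ ω, Λ ω (unitCube d) ∂P) • volume := by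
  have := hΛ.isAddLeftInvariant_bind
  have := hΛ.isLocallyFiniteMeasure_bind hfin
  obtain ⟨c, hc⟩ : ∃ c : ℝ≥0, P.bind Λ = c • volume := ⟨_, Measure.isAddLeftInvariant_eq_smul _ _⟩
  have hunit : ∫⁻ ω, Λ ω (unitCube d) ∂P = c := by
    rw [unitCube_eq_box,
      ← Measure.bind_apply (measurableSet_box _ _) hΛ.measurable.aemeasurable, hc,
      Measure.smul_apply, volume_box, ENNReal.ofReal_one, one_pow, ENNReal.smul_def, smul_eq_mul,
      mul_one]
  rw [hc, hunit, ENNReal.smul_def]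

lemma lintegral_apply_eq_volume (hΛ : IsStationaryRandomMeasure P Λ)
    (hmean : ∫⁻ ω, Λ ω (unitCube d) ∂P = 1) {A : Set (E d)} (hA : MeasurableSet A) :
    ∫⁻ ω, Λ ω A ∂P = volume A := by
  rw [← Measure.bind_apply hA hΛ.measurable.aemeasurable,
    hΛ.bind_eq_smul_volume (hmean ▸ ENNReal.one_ne_top), hmean, one_smul]

lemma lintegral_cube_one (hΛ : IsStationaryRandomMeasure P Λ)
    (hmean : ∫⁻ ω, Λ ω (unitCube d) ∂P = 1) : ∫⁻ ω, Λ ω (cube d 1) ∂P = 1 := by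
  rw [hΛ.lintegral_apply_eq_volume hmean (measurableSet_cube 1), cube_eq_box, volume_box]
  simp

lemma ae_apply_lt_top (hΛ : IsStationaryRandomMeasure P Λ)
    (hfin : ∫⁻ ω, Λ ω (unitCube d) ∂P ≠ ∞) {A : Set (E d)} (hA : MeasurableSet A)
    (hb : Bornology.IsBounded A) : ∀ᵐ ω ∂P, Λ ω A < ∞ := by
  refine ae_lt_top ((Measure.measurable_coe hA).comp hΛ.measurable) ?_
  rw [← Measure.bind_apply hA hΛ.measurable.aemeasurable, hΛ.bind_eq_smul_volume hfin]
  exact ENNReal.mul_ne_top hfin hb.measure_lt_top.ne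

lemma ae_smul_apply_lt_top (hΛ : IsStationaryRandomMeasure P Λ)
    (hfin : ∫⁻ ω, Λ ω (unitCube d) ∂P ≠ ∞) {c : ℝ≥0∞} (hc : c ≠ ∞) {A : Set (E d)}
    (hA : MeasurableSet A) (hb : Bornology.IsBounded A) : ∀ᵐ ω ∂P, (c • Λ ω) A < ∞ := by
  filter_upwards [hΛ.ae_apply_lt_top hfin hA hb] with ω hω using ENNReal.mul_lt_top hc.lt_top hω

end IsStationaryRandomMeasure

lemma lt_setDist {b : ℝ≥0} {b' : ℝ≥0∞} (hb : b < b') {A B : Set (E d)}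
    (h : ∀ x ∈ A, ∀ y ∈ B, b' ≤ edist x y) : (b : ℝ≥0∞) < setDist A B :=
  hb.trans_le (le_iInf₂ fun x hx => le_iInf₂ fun y hy => h x hx y hy)

namespace IsDependent

variable {ι : Type*} {b : ℝ≥0} {b' : ℝ≥0∞}

lemma lintegral_mul (hdep : IsDependent P Λ b) (hΛ : Measurable Λ)
    {A B : Set (E d)} (hA : MeasurableSet A) (hB : MeasurableSet B) (hAB : b < setDist A B)
    {f g : Measure (E d) → ℝ≥0∞} (hf : Measurable f) (hg : Measurable g) :
    ∫⁻ ω, f ((Λ ω).restrict A) * g ((Λ ω).restrict B) ∂P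
      = (∫⁻ ω, f ((Λ ω).restrict A) ∂P) * ∫⁻ ω, g ((Λ ω).restrict B) ∂P :=
  lintegral_mul_eq_lintegral_mul_lintegral_of_indepFun
    (hf.comp ((measurable_restrict hA).comp hΛ)) (hg.comp ((measurable_restrict hB).comp hΛ))
    ((hdep A B hA hB hAB).comp hf hg)

lemma lintegral_mul_prod (hdep : IsDependent P Λ b) (hΛ : Measurable Λ) (hb : b < b')
    {B : Set (E d)} (hB : MeasurableSet B) {K : ι → Set (E d)} (hK : ∀ z, MeasurableSet (K z))
    {h g : ℝ≥0∞ → ℝ≥0∞} (hh : Measurable h) (hg : Measurable g) (F : Finset ι)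
    (hsep : ∀ z ∈ F, ∀ x ∈ B, ∀ y ∈ K z, b' ≤ edist x y) :
    ∫⁻ ω, h (Λ ω B) * ∏ z ∈ F, g (Λ ω (K z)) ∂P
      = (∫⁻ ω, h (Λ ω B) ∂P) * ∫⁻ ω, ∏ z ∈ F, g (Λ ω (K z)) ∂P := by
  have hsepUnion : ∀ x ∈ B, ∀ y ∈ ⋃ z ∈ F, K z, b' ≤ edist x y := fun x hx y hy => by
    obtain ⟨z, hz, hy⟩ := Set.mem_iUnion₂.1 hy
    exact hsep z hz x hx y hy
  have hrestrict : ∀ ω, ∀ z ∈ F, (Λ ω).restrict (⋃ z ∈ F, K z) (K z) = Λ ω (K z) :=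
    fun ω z hz => Measure.restrict_eq_self _ (Set.subset_biUnion_of_mem (u := K) hz)
  have hindep := hdep.lintegral_mul hΛ hB (F.measurableSet_biUnion fun z _ => hK z)
    (lt_setDist hb hsepUnion) (f := fun μ => h (μ B)) (g := fun μ => ∏ z ∈ F, g (μ (K z)))
    (hh.comp (Measure.measurable_coe hB))
    (Finset.measurable_prod _ fun z _ => hg.comp (Measure.measurable_coe (hK z)))
  have hprod : ∀ ω, ∏ z ∈ F, g ((Λ ω).restrict (⋃ z ∈ F, K z) (K z)) = ∏ z ∈ F, g (Λ ω (K z)) :=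
    fun ω => Finset.prod_congr rfl fun z hz => by rw [hrestrict ω z hz]
  simpa only [Measure.restrict_eq_self _ (subset_refl B), hprod] using hindep

lemma lintegral_prod [IsProbabilityMeasure P]
    (hdep : IsDependent P Λ b) (hΛ : Measurable Λ) (hb : b < b') {K : ι → Set (E d)}
    (hK : ∀ z, MeasurableSet (K z)) {g : ℝ≥0∞ → ℝ≥0∞} (hg : Measurable g) (F : Finset ι)
    (hsep : ∀ z ∈ F, ∀ w ∈ F, z ≠ w → ∀ x ∈ K z, ∀ y ∈ K w, b' ≤ edist x y) :
    ∫⁻ ω, ∏ z ∈ F, g (Λ ω (K z)) ∂P = ∏ z ∈ F, ∫⁻ ω, g (Λ ω (K z)) ∂P := by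
  classical
  induction F using Finset.induction_on with
  | empty => simp
  | insert z F hz ih =>
    have hsepF : ∀ w ∈ F, ∀ x ∈ K z, ∀ y ∈ K w, b' ≤ edist x y := fun w hw =>
      hsep z (Finset.mem_insert_self _ _) w (Finset.mem_insert_of_mem hw)
        (ne_of_mem_of_not_mem hw hz).symm
    simp only [Finset.prod_insert hz]
    rw [hdep.lintegral_mul_prod hΛ hb (hK z) hK hg hg F hsepF,
      ih fun z hz w hw => hsep z (Finset.mem_insert_of_mem hz) w (Finset.mem_insert_of_mem hw)]

end IsDependent

end RandomMeasures

/-! ### Poisson and Cox processes -/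

/-- The function `t ↦ exp(-t)` on `[0, ∞]`. -/
def expMinus (t : ℝ≥0∞) : ℝ≥0∞ := EReal.exp (-(t : EReal))

lemma expMinus_zero : expMinus 0 = 1 := by simp [expMinus]

lemma expMinus_of_ne_top {t : ℝ≥0∞} (ht : t ≠ ∞) :
    expMinus t = ENNReal.ofReal (Real.exp (-t.toReal)) := by
  lift t to ℝ≥0 using ht
  rfl

lemma expMinus_ofReal {t : ℝ} (ht : 0 ≤ t) :
    expMinus (ENNReal.ofReal t) = ENNReal.ofReal (Real.exp (-t)) := by
  rw [expMinus_of_ne_top ENNReal.ofReal_ne_top, ENNReal.toReal_ofReal ht]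

lemma expMinus_antitone : Antitone expMinus := fun s t h => by
  unfold expMinus
  rw [EReal.exp_le_exp_iff, EReal.neg_le_neg_iff]
  exact_mod_cast h

lemma expMinus_le_one (t : ℝ≥0∞) : expMinus t ≤ 1 :=
  (expMinus_antitone zero_le).trans_eq expMinus_zero

lemma measurable_expMinus : Measurable expMinus := expMinus_antitone.measurable

lemma expMinus_add (s t : ℝ≥0∞) : expMinus (s + t) = expMinus s * expMinus t := by
  unfold expMinus
  rw [← EReal.exp_add, EReal.coe_ennreal_add, EReal.neg_add, sub_eq_add_neg]
  · left; simp
  · right; simp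

lemma expMinus_sum {ι : Type*} (F : Finset ι) (f : ι → ℝ≥0∞) :
    expMinus (∑ i ∈ F, f i) = ∏ i ∈ F, expMinus (f i) := by
  classical
  induction F using Finset.induction_on with
  | empty => simp [expMinus_zero]
  | insert i F hi ih => rw [Finset.sum_insert hi, Finset.prod_insert hi, expMinus_add, ih]

lemma expNeg_eq {d : ℕ} (lam : ℝ) (B : Set (E d)) (μ : Measure (E d)) :
    expNeg lam B μ = expMinus (ENNReal.ofReal lam * μ B) := rfl

lemma measurable_expNeg {d : ℕ} (lam : ℝ) {B : Set (E d)} (hB : MeasurableSet B) :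
    Measurable (expNeg lam B) :=
  measurable_expMinus.comp ((Measure.measurable_coe hB).const_mul _)

section Poisson

variable {d : ℕ} {m : Measure (E d)} {Q : Measure (Measure (E d))}

lemma succ_mul_poissonMeasure_singleton (r : ℝ≥0) (n : ℕ) :
    ((n + 1 : ℕ) : ℝ≥0∞) * poissonMeasure r {n + 1} = r * poissonMeasure r {n} := by
  rw [poissonMeasure_singleton, poissonMeasure_singleton, ← ENNReal.ofReal_natCast,
    ← ENNReal.ofReal_coe_nnreal, ← ENNReal.ofReal_mul (by positivity),
    ← ENNReal.ofReal_mul (by positivity)]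
  congr 1
  rw [Nat.factorial_succ]
  push_cast
  field_simp
  ring

lemma lintegral_natCast_poissonMeasure (r : ℝ≥0) :
    ∫⁻ n : ℕ, (n : ℝ≥0∞) ∂poissonMeasure r = r := by
  rw [lintegral_countable', tsum_eq_zero_add' ENNReal.summable]
  simp only [succ_mul_poissonMeasure_singleton, Nat.cast_zero, zero_mul, zero_add]
  have h := lintegral_countable' (μ := poissonMeasure r) (fun _ => 1)
  simp only [lintegral_const, measure_univ, one_mul] at h
  rw [ENNReal.tsum_mul_left, ← h, mul_one]

lemma lintegral_indicator_natCast_poissonMeasure (r : ℝ≥0) (k : ℕ) :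
    ∫⁻ n : ℕ, ({(k : ℝ≥0∞)} : Set ℝ≥0∞).indicator 1 (n : ℝ≥0∞) ∂poissonMeasure r
      = poissonMeasure r {k} := by
  rw [← lintegral_indicator_one (measurableSet_singleton k)]
  exact lintegral_congr fun n => by simp [Set.indicator_apply]

lemma poissonMeasure_singleton_zero {t : ℝ≥0∞} (ht : t ≠ ∞) :
    poissonMeasure t.toNNReal {0} = expMinus t := by
  rw [poissonMeasure_singleton, expMinus_of_ne_top ht]
  simp [ENNReal.toReal]

lemma poissonMeasure_singleton_one {t : ℝ≥0∞} (ht : t ≠ ∞) :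
    poissonMeasure t.toNNReal {1} = t * expMinus t := by
  have h := succ_mul_poissonMeasure_singleton t.toNNReal 0
  rw [poissonMeasure_singleton_zero ht, ENNReal.coe_toNNReal ht] at h
  simpa using h

lemma IsPoissonLaw.lintegral_comp (h : IsPoissonLaw m Q) {B : Set (E d)} (hB : MeasurableSet B)
    (hm : m B ≠ ∞) {f : ℝ≥0∞ → ℝ≥0∞} (hf : Measurable f) :
    ∫⁻ ν, f (ν B) ∂Q = ∫⁻ n : ℕ, f n ∂poissonMeasure (m B).toNNReal := by
  rw [← lintegral_map hf (Measure.measurable_coe hB), h.map_count B hB hm,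
    lintegral_map hf (measurable_of_countable _)]

lemma IsPoissonLaw.lintegral_mul (h : IsPoissonLaw m Q) {A B : Set (E d)} (hA : MeasurableSet A)
    (hB : MeasurableSet B) (hAB : Disjoint A B) {f g : ℝ≥0∞ → ℝ≥0∞} (hf : Measurable f)
    (hg : Measurable g) :
    ∫⁻ ν, f (ν A) * g (ν B) ∂Q = (∫⁻ ν, f (ν A) ∂Q) * ∫⁻ ν, g (ν B) ∂Q := by
  have hi := (h.indep_count 2 ![A, B] (by simp [Fin.forall_fin_two, hA, hB]) (by
    intro i j hij
    fin_cases i <;> fin_cases j <;> simp_all [hAB.symm])).indepFun (i := 0) (j := 1) (by simp)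
  exact lintegral_mul_eq_lintegral_mul_lintegral_of_indepFun
    (hf.comp (Measure.measurable_coe hA)) (hg.comp (Measure.measurable_coe hB)) (hi.comp hf hg)

end Poisson

section Cox

variable {Ω : Type*} [MeasurableSpace Ω] {d : ℕ} {P : Measure Ω} {Λ M X : Ω → Measure (E d)}
  {A B : Set (E d)} {lam : ℝ}

lemma measurable_indicator_apply (hX : Measurable X) (hA : MeasurableSet A) {S : Set ℝ≥0∞}
    (hS : MeasurableSet S) : Measurable fun ω => S.indicator (1 : ℝ≥0∞ → ℝ≥0∞) (X ω A) :=
  (measurable_one.indicator hS).comp ((Measure.measurable_coe hA).comp hX)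

namespace IsCoxProcess

lemma lintegral_mul [IsFiniteMeasure P] (hX : IsCoxProcess P M X) (hM : Measurable M)
    (hA : MeasurableSet A) (hB : MeasurableSet B) (hAB : Disjoint A B)
    (hMA : ∀ᵐ ω ∂P, M ω A < ∞) (hMB : ∀ᵐ ω ∂P, M ω B < ∞) {f g : ℝ≥0∞ → ℝ≥0∞}
    (hf : Measurable f) (hg : Measurable g) :
    ∫⁻ ω, f (X ω A) * g (X ω B) ∂P
      = ∫⁻ ω, (∫⁻ n : ℕ, f n ∂poissonMeasure (M ω A).toNNReal)
        * ∫⁻ n : ℕ, g n ∂poissonMeasure (M ω B).toNNReal ∂P := by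
  obtain ⟨κ, hκ, hlaw, hpoisson⟩ := hX.exists_kernel
  have hF : Measurable fun ν : Measure (E d) => f (ν A) * g (ν B) :=
    (hf.comp (Measure.measurable_coe hA)).mul (hg.comp (Measure.measurable_coe hB))
  have hF' : Measurable fun q : Measure (E d) × Measure (E d) => f (q.2 A) * g (q.2 B) :=
    hF.comp measurable_snd
  calc ∫⁻ ω, f (X ω A) * g (X ω B) ∂P
      = ∫⁻ q, f (q.2 A) * g (q.2 B) ∂P.map fun ω => (M ω, X ω) :=
        (lintegral_map hF' (hM.prodMk hX.measurable)).symm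
    _ = ∫⁻ ω, ∫⁻ ν, f (ν A) * g (ν B) ∂κ (M ω) ∂P := by
        rw [hlaw, Measure.lintegral_compProd hF', lintegral_map hF.lintegral_kernel hM]
    _ = _ := lintegral_congr_ae ?_
  filter_upwards [ae_of_ae_map hM.aemeasurable hpoisson, hMA, hMB] with ω hω hωA hωB
  rw [hω.lintegral_mul hA hB hAB hf hg, hω.lintegral_comp hA hωA.ne hf,
    hω.lintegral_comp hB hωB.ne hg]

lemma ae_eq_natCast [IsFiniteMeasure P] (hX : IsCoxProcess P M X) (hM : Measurable M)
    (hB : MeasurableSet B) (hMB : ∀ᵐ ω ∂P, M ω B < ∞) :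
    ∀ᵐ ω ∂P, X ω B ∈ Set.range ((↑) : ℕ → ℝ≥0∞) := by
  set S : Set ℝ≥0∞ := (Set.range ((↑) : ℕ → ℝ≥0∞))ᶜ with hS
  have hSm : MeasurableSet S := (Set.countable_range _).measurableSet.compl
  have hzero : ∫⁻ ω, S.indicator 1 (X ω B) ∂P = 0 := by
    have h := hX.lintegral_mul hM hB MeasurableSet.empty disjoint_bot_right hMB (by simp)
      (measurable_one.indicator hSm) (measurable_const (a := 1))
    simpa [hS] using h
  rw [lintegral_eq_zero_iff (measurable_indicator_apply hX.measurable hB hSm)] at hzero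
  filter_upwards [hzero] with ω hω
  by_contra hc
  simp [Set.indicator_of_mem (show X ω B ∈ S from hc)] at hω

lemma lintegral_mul_indicator_zero [IsFiniteMeasure P] (hX : IsCoxProcess P M X)
    (hM : Measurable M) (hA : MeasurableSet A) (hB : MeasurableSet B) (hAB : Disjoint A B)
    (hMA : ∀ᵐ ω ∂P, M ω A < ∞) (hMB : ∀ᵐ ω ∂P, M ω B < ∞) :
    ∫⁻ ω, X ω A * ({0} : Set ℝ≥0∞).indicator 1 (X ω B) ∂P
      = ∫⁻ ω, M ω A * expMinus (M ω B) ∂P := by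
  refine (hX.lintegral_mul hM hA hB hAB hMA hMB (f := id) measurable_id
    (measurable_one.indicator (measurableSet_singleton 0))).trans (lintegral_congr_ae ?_)
  filter_upwards [hMA, hMB] with ω hωA hωB
  have hvoid := lintegral_indicator_natCast_poissonMeasure (M ω B).toNNReal 0
  rw [Nat.cast_zero] at hvoid
  simp only [id_eq]
  rw [lintegral_natCast_poissonMeasure, hvoid, poissonMeasure_singleton_zero hωB.ne,
    ENNReal.coe_toNNReal hωA.ne]

lemma lintegral_indicator_one_mul_indicator_zero [IsFiniteMeasure P] (hX : IsCoxProcess P M X)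
    (hM : Measurable M) (hA : MeasurableSet A) (hB : MeasurableSet B) (hAB : Disjoint A B)
    (hMA : ∀ᵐ ω ∂P, M ω A < ∞) (hMB : ∀ᵐ ω ∂P, M ω B < ∞) :
    ∫⁻ ω, ({1} : Set ℝ≥0∞).indicator 1 (X ω A) * ({0} : Set ℝ≥0∞).indicator 1 (X ω B) ∂P
      = ∫⁻ ω, M ω A * expMinus (M ω A + M ω B) ∂P := by
  refine (hX.lintegral_mul hM hA hB hAB hMA hMB
    (measurable_one.indicator (measurableSet_singleton 1))
    (measurable_one.indicator (measurableSet_singleton 0))).trans (lintegral_congr_ae ?_)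
  filter_upwards [hMA, hMB] with ω hωA hωB
  have hvoid := lintegral_indicator_natCast_poissonMeasure (M ω B).toNNReal 0
  have hsingle := lintegral_indicator_natCast_poissonMeasure (M ω A).toNNReal 1
  rw [Nat.cast_zero] at hvoid
  rw [Nat.cast_one] at hsingle
  rw [hvoid, hsingle, poissonMeasure_singleton_zero hωB.ne, poissonMeasure_singleton_one hωA.ne,
    expMinus_add, mul_assoc]

lemma lintegral_apply [IsFiniteMeasure P] (hX : IsCoxProcess P M X) (hM : Measurable M)
    (hA : MeasurableSet A) (hMA : ∀ᵐ ω ∂P, M ω A < ∞) :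
    ∫⁻ ω, X ω A ∂P = ∫⁻ ω, M ω A ∂P := by
  have h := hX.lintegral_mul_indicator_zero hM hA MeasurableSet.empty disjoint_bot_right hMA
    (by simp)
  simpa [expMinus_zero] using h

lemma lintegral_mul_vacant [IsFiniteMeasure P]
    (hX : IsCoxProcess P (fun ω => ENNReal.ofReal lam • Λ ω) X) (hΛ : Measurable Λ)
    (hA : MeasurableSet A) (hB : MeasurableSet B) (hAB : Disjoint A B)
    (hΛA : ∀ᵐ ω ∂P, (ENNReal.ofReal lam • Λ ω) A < ∞)
    (hΛB : ∀ᵐ ω ∂P, (ENNReal.ofReal lam • Λ ω) B < ∞) :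
    ∫⁻ ω, X ω A * ({0} : Set ℝ≥0∞).indicator 1 (X ω B) ∂P
      = ENNReal.ofReal lam * ∫⁻ ω, Λ ω A * expNeg lam B (Λ ω) ∂P := by
  rw [hX.lintegral_mul_indicator_zero (measurable_smul_randomMeasure _ hΛ) hA hB hAB hΛA hΛB,
    ← lintegral_const_mul' _ _ ENNReal.ofReal_ne_top]
  simp only [Measure.smul_apply, smul_eq_mul, mul_assoc, expNeg_eq]

lemma lintegral_single_mul_vacant [IsFiniteMeasure P]
    (hX : IsCoxProcess P (fun ω => ENNReal.ofReal lam • Λ ω) X) (hΛ : Measurable Λ)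
    (hA : MeasurableSet A) (hB : MeasurableSet B) (hAB : A ⊆ B)
    (hΛA : ∀ᵐ ω ∂P, (ENNReal.ofReal lam • Λ ω) A < ∞)
    (hΛB : ∀ᵐ ω ∂P, (ENNReal.ofReal lam • Λ ω) B < ∞) :
    ∫⁻ ω, ({1} : Set ℝ≥0∞).indicator 1 (X ω A) * ({0} : Set ℝ≥0∞).indicator 1 (X ω (B \ A)) ∂P
      = ENNReal.ofReal lam * ∫⁻ ω, Λ ω A * expNeg lam B (Λ ω) ∂P := by
  have hΛBA : ∀ᵐ ω ∂P, (ENNReal.ofReal lam • Λ ω) (B \ A) < ∞ :=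
    hΛB.mono fun ω hω => (measure_mono Set.sdiff_subset).trans_lt hω
  rw [hX.lintegral_indicator_one_mul_indicator_zero (measurable_smul_randomMeasure _ hΛ) hA
    (hB.diff hA) Set.disjoint_sdiff_right hΛA hΛBA,
    ← lintegral_const_mul' _ _ ENNReal.ofReal_ne_top]
  refine lintegral_congr fun ω => ?_
  rw [← measure_union Set.disjoint_sdiff_right (hB.diff hA), Set.union_sdiff_cancel hAB]
  simp only [Measure.smul_apply, smul_eq_mul, mul_assoc, expNeg_eq]

end IsCoxProcess

end Cox

/-! ### Percolation probabilities -/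

section Counting

variable {d : ℕ} {ν : Measure (E d)}

/-- Integer mass on all half-open dyadic cells. Almost every realization of a Cox process has this
property, and it is all that is used of a point configuration. -/
def IsCounting (ν : Measure (E d)) : Prop :=
  ∀ (n : ℕ) (z : Fin d → ℤ), ν (cell ((1 / 2) ^ n) z) ∈ Set.range ((↑) : ℕ → ℝ≥0∞)

namespace IsCounting

lemma exists_singleton_eq (hν : IsCounting ν) (x : E d) :
    ∃ n : ℕ, ν {x} = ν (cell ((1 / 2) ^ n) (cellIndex ((1 / 2) ^ n) x)) := by
  set c : ℕ → Set (E d) := fun n => cell ((1 / 2) ^ n) (cellIndex ((1 / 2) ^ n) x) with hc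
  have hx : ∀ n, x ∈ c n := fun n => mem_cell_cellIndex (by positivity) x
  have hanti : Antitone c := antitone_nat_of_succ_le fun n => by
    simp only [hc, pow_succ (1 / 2 : ℝ) n, mul_one_div]
    exact cell_half_subset (by positivity) x
  have hinter : ⋂ n, c n = {x} := by
    refine Set.Subset.antisymm (fun y hy => ?_) (by simpa using hx)
    have hle : ∀ n : ℕ, dist y x ≤ (1 / 2) ^ n * √d := fun n =>
      dist_le_of_mem_cell (by positivity) (Set.mem_iInter.1 hy n) (hx n)
    have hlim : Tendsto (fun n : ℕ => (1 / 2 : ℝ) ^ n * √d) atTop (𝓝 (0 * √d)) :=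
      (tendsto_pow_atTop_nhds_zero_of_lt_one (by norm_num) (by norm_num)).mul_const _
    rw [zero_mul] at hlim
    exact dist_le_zero.1 (ge_of_tendsto' hlim hle)
  choose k hk using fun n => hν n (cellIndex ((1 / 2) ^ n) x)
  obtain ⟨n, hn⟩ : ∃ n, ∀ m, k n ≤ k m :=
    ⟨Function.argmin k, fun m => Function.argmin_le k m⟩
  refine ⟨n, ?_⟩
  rw [← hinter, hanti.measure_iInter (fun n => (measurableSet_cell _ _).nullMeasurableSet)
    ⟨0, by simp only [hc, ← hk]; simp⟩]
  refine le_antisymm (iInf_le _ n) (le_iInf fun m => ?_)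
  simp only [hc, ← hk]
  exact_mod_cast hn m

lemma one_le_singleton (hν : IsCounting ν) {x : E d} (hx : ν {x} ≠ 0) :
    1 ≤ ν {x} := by
  obtain ⟨n, hn⟩ := hν.exists_singleton_eq x
  obtain ⟨k, hk⟩ := hν n (cellIndex ((1 / 2) ^ n) x)
  rw [hn, ← hk] at hx ⊢
  exact_mod_cast Nat.one_le_iff_ne_zero.2 (by exact_mod_cast hx)

lemma compl_points (hν : IsCounting ν) : ν (points ν)ᶜ = 0 := by
  refine measure_mono_null (t := ⋃ q : {q : ℕ × (Fin d → ℤ) // ν (cell ((1 / 2) ^ q.1) q.2) = 0},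
    cell ((1 / 2) ^ q.1.1) q.1.2) (fun x hx => ?_) (measure_iUnion_null fun q => q.2)
  have h0 : ν {x} = 0 := by simpa [points] using hx
  obtain ⟨n, hn⟩ := hν.exists_singleton_eq x
  exact Set.mem_iUnion.2 ⟨⟨(n, cellIndex ((1 / 2) ^ n) x), hn.symm.trans h0⟩,
    mem_cell_cellIndex (by positivity : (0 : ℝ) < (1 / 2) ^ n) x⟩

lemma apply_eq_zero (hν : IsCounting ν) {A : Set (E d)}
    (hA : ∀ x ∈ A, ν {x} = 0) : ν A = 0 :=
  measure_mono_null (fun x hx => by simpa [points] using hA x hx) hν.compl_points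

end IsCounting

end Counting

section Clusters

variable {d : ℕ} {V : Set (E d)} {ν : Measure (E d)} {r : ℝ} {x y : E d}

/-- The vertex set of the connected component of `x` in the Gilbert graph on `V`, as a set of
points of `ℝ^d`; it is empty if `x ∉ V`. -/
def cluster (r : ℝ) (V : Set (E d)) (x : E d) : Set (E d) :=
  {y | ∃ (hx : x ∈ V) (hy : y ∈ V), (gilbertGraph r V).Reachable ⟨x, hx⟩ ⟨y, hy⟩}

lemma cluster_subset : cluster r V x ⊆ V := fun _ hy => hy.2.1

lemma mem_of_mem_cluster (hy : y ∈ cluster r V x) : x ∈ V := hy.1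

lemma self_mem_cluster (hx : x ∈ V) : x ∈ cluster r V x :=
  ⟨hx, hx, SimpleGraph.Reachable.refl _⟩

lemma mem_cluster_of_dist_lt {c : E d} (hc : c ∈ cluster r V x) (hy : y ∈ V)
    (hcy : dist c y < r) : y ∈ cluster r V x := by
  obtain ⟨hx, hcV, hreach⟩ := hc
  rcases eq_or_ne c y with rfl | hne
  · exact ⟨hx, hcV, hreach⟩
  · refine ⟨hx, hy, hreach.trans (SimpleGraph.Adj.reachable ⟨?_, hcy⟩)⟩
    simpa [Subtype.ext_iff] using hne

lemma cluster_induction {p : E d → Prop} (hx : p x)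
    (hstep : ∀ c ∈ cluster r V x, ∀ y ∈ cluster r V x, dist c y < r → p c → p y)
    (hy : y ∈ cluster r V x) : p y := by
  obtain ⟨hxV, hyV, hreach⟩ := hy
  rw [SimpleGraph.reachable_iff_reflTransGen] at hreach
  suffices ∀ u : V, Relation.ReflTransGen (gilbertGraph r V).Adj ⟨x, hxV⟩ u → p u from
    this _ hreach
  intro u hu
  induction hu with
  | refl => exact hx
  | tail hv hvw ih =>
    have hv' := (SimpleGraph.reachable_iff_reflTransGen _ _).2 hv
    exact hstep _ ⟨hxV, Subtype.prop _, hv'⟩ _ ⟨hxV, Subtype.prop _, hv'.trans hvw.reachable⟩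
      hvw.2 ih

lemma cluster_subset_singleton (h : ∀ y ∈ V, dist x y < r → y = x) : cluster r V x ⊆ {x} :=
  fun _ hy => cluster_induction (p := (· = x)) rfl
    (fun _ _ y hyC hcy hc => h y (cluster_subset hyC) (hc ▸ hcy)) hy

lemma cluster_eq_image_supp (hx : x ∈ V) :
    cluster r V x = (↑) '' ((gilbertGraph r V).connectedComponentMk ⟨x, hx⟩).supp := by
  ext y
  simp only [cluster, hx, exists_true_left, Set.mem_ofPred_eq, Set.mem_image, Subtype.exists,
    SimpleGraph.ConnectedComponent.mem_supp_iff, SimpleGraph.ConnectedComponent.eq,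
    exists_and_right, exists_eq_right]
  exact exists_congr fun _ => SimpleGraph.reachable_comm

lemma mem_originPercolates_iff :
    ν ∈ originPercolates r ↔ (cluster r (points ν) 0).Infinite := by
  constructor
  · rintro ⟨h, hinf⟩
    rw [cluster_eq_image_supp h]
    exact hinf.image Subtype.val_injective.injOn
  · intro hinf
    have h : (0 : E d) ∈ points ν := mem_of_mem_cluster hinf.nonempty.some_mem
    rw [cluster_eq_image_supp h] at hinf
    exact ⟨h, hinf.of_image _⟩

/-- An isometry of `ℝ^d` as an isomorphism of Gilbert graphs. -/
def gilbertGraphIso (r : ℝ) (e : E d ≃ᵢ E d) (V : Set (E d)) :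
    gilbertGraph r (e ⁻¹' V) ≃g gilbertGraph r V where
  toEquiv := e.toEquiv.subtypeEquiv fun _ => Iff.rfl
  map_rel_iff' := by simp [gilbertGraph, Subtype.ext_iff, e.dist_eq]

lemma cluster_preimage (e : E d ≃ᵢ E d) :
    cluster r (e ⁻¹' V) x = e ⁻¹' cluster r V (e x) := by
  ext y
  exact exists_congr fun _ => exists_congr fun _ => (gilbertGraphIso r e V).reachable_iff.symm

lemma points_shift (x : E d) (ν : Measure (E d)) :
    points (shift x ν) = IsometryEquiv.addRight x ⁻¹' points ν := by
  ext y
  simp [points, shift_singleton]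

lemma shift_mem_originPercolates_iff :
    shift x ν ∈ originPercolates r ↔ (cluster r (points ν) x).Infinite := by
  rw [mem_originPercolates_iff, points_shift, cluster_preimage, ← IsometryEquiv.image_symm,
    Set.infinite_image_iff (IsometryEquiv.injective _).injOn]
  simp

lemma shift_notMem_originPercolates (hν : IsCounting ν) (hQ : ν (cube d 1) = 1)
    (hN : ν (Metric.ball 0 (r + √d) \ cube d 1) = 0) (hx : x ∈ cube d 1) :
    shift x ν ∉ originPercolates r := by
  rw [shift_mem_originPercolates_iff, Set.not_infinite]
  by_cases hxν : x ∈ points ν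
  swap
  · exact (Set.eq_empty_of_forall_notMem fun y hy => hxν (mem_of_mem_cluster hy)) ▸ Set.finite_empty
  refine (Set.finite_singleton x).subset (cluster_subset_singleton fun y hy hxy => ?_)
  by_contra hyx
  by_cases hyQ : y ∈ cube d 1
  · have htwo : 1 + 1 ≤ ν (cube d 1) := calc
      1 + 1 ≤ ν {x} + ν {y} := add_le_add (hν.one_le_singleton hxν) (hν.one_le_singleton hy)
      _ = ν ({x} ∪ {y}) :=
        (measure_union (by simpa using Ne.symm hyx) (measurableSet_singleton y)).symm
      _ ≤ ν (cube d 1) :=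
        measure_mono (Set.union_subset (by simpa using hx) (by simpa using hyQ))
    norm_num [hQ] at htwo
  · have hyN : y ∈ Metric.ball 0 (r + √d) := by
      rw [Metric.mem_ball]
      linarith [dist_triangle_left y 0 x, dist_le_of_mem_cube_one hx]
    exact hy (measure_mono_null (Set.singleton_subset_iff.2 (Set.mem_sdiff_of_mem hyN hyQ)) hN)

lemma lintegral_percolates_add_le (hν : IsCounting ν) (r : ℝ) :
    ∫⁻ x in cube d 1, (originPercolates r).indicator 1 (shift x ν) ∂ν
      + ({1} : Set ℝ≥0∞).indicator 1 (ν (cube d 1))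
        * ({0} : Set ℝ≥0∞).indicator 1 (ν (Metric.ball 0 (r + √d) \ cube d 1))
      ≤ ν (cube d 1) := by
  by_cases h : ν (cube d 1) = 1 ∧ ν (Metric.ball 0 (r + √d) \ cube d 1) = 0
  · have hzero : ∫⁻ x in cube d 1, (originPercolates r).indicator 1 (shift x ν) ∂ν = 0 := by
      rw [setLIntegral_congr_fun (g := 0) (measurableSet_cube 1) fun x hx =>
        Set.indicator_of_notMem (shift_notMem_originPercolates hν h.1 h.2 hx) _]
      simp
    simp [hzero, h.1, h.2]
  · have hzero : ({1} : Set ℝ≥0∞).indicator (1 : ℝ≥0∞ → ℝ≥0∞) (ν (cube d 1))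
        * ({0} : Set ℝ≥0∞).indicator 1 (ν (Metric.ball 0 (r + √d) \ cube d 1)) = 0 := by
      simpa [Set.indicator_apply, ← not_and, and_comm] using h
    rw [hzero, add_zero]
    refine (setLIntegral_mono (g := fun _ => 1) measurable_const fun x _ => ?_).trans (by simp)
    exact Set.indicator_apply_le' (fun _ => le_rfl) (fun _ => zero_le)

lemma apply_le_lintegral_percolates (hν : IsCounting ν)
    (h : ∀ x ∈ cube d 1, ν {x} ≠ 0 → shift x ν ∈ originPercolates r) :
    ν (cube d 1) ≤ ∫⁻ x in cube d 1, (originPercolates r).indicator 1 (shift x ν) ∂ν := by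
  rw [← setLIntegral_one]
  refine lintegral_mono_ae ((ae_restrict_iff' (measurableSet_cube 1)).2 ?_)
  have hpoints : ∀ᵐ x ∂ν, x ∈ points ν := hν.compl_points
  filter_upwards [hpoints] with x hx hxQ
  rw [Set.indicator_of_mem (h x hxQ hx), Pi.one_apply]

end Clusters

section PercolationProbability

variable {Ω : Type*} [MeasurableSpace Ω] {d : ℕ} {P : Measure Ω} {Λ X : Ω → Measure (E d)}
  {lam r : ℝ}

lemma ofReal_mul_percolationProbability (hlam : 0 < lam) :
    ENNReal.ofReal lam * percolationProbability P X lam r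
      = ∫⁻ ω, ∫⁻ x in cube d 1, (originPercolates r).indicator 1 (shift x (X ω)) ∂(X ω) ∂P := by
  rw [percolationProbability, palmExpectation, ← mul_assoc,
    ENNReal.mul_inv_cancel (by simpa using hlam) ENNReal.ofReal_ne_top, one_mul]

lemma IsCoxProcess.ae_isCounting [IsFiniteMeasure P] {M : Ω → Measure (E d)}
    (hX : IsCoxProcess P M X) (hM : Measurable M)
    (hfin : ∀ A, MeasurableSet A → Bornology.IsBounded A → ∀ᵐ ω ∂P, M ω A < ∞) :
    ∀ᵐ ω ∂P, IsCounting (X ω) := by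
  unfold IsCounting
  simp only [ae_all_iff]
  exact fun n z => hX.ae_eq_natCast hM (measurableSet_cell _ _)
    (hfin _ (measurableSet_cell _ _) (isBounded_cell (by positivity) z))

lemma palmExpectation_expNeg_le (lam r : ℝ) :
    palmExpectation P Λ 1 (expNeg lam (Metric.ball 0 (r + √d)))
      ≤ ∫⁻ ω, Λ ω (cube d 1) * expNeg lam (Metric.ball 0 r) (Λ ω) ∂P := by
  rw [palmExpectation, inv_one, one_mul]
  refine lintegral_mono fun ω => ?_
  refine (setLIntegral_mono (g := fun _ => expNeg lam (Metric.ball 0 r) (Λ ω)) measurable_const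
    fun x hx => ?_).trans (by simp [mul_comm])
  rw [expNeg_eq, expNeg_eq, shift_apply _ _ Metric.isOpen_ball.measurableSet]
  refine expMinus_antitone (mul_le_mul_right (measure_mono fun y hy => ?_) _)
  rw [Metric.mem_ball] at hy
  rw [Set.mem_preimage, Metric.mem_ball, dist_zero_right, ← dist_eq_norm]
  linarith [dist_triangle_right y x 0, dist_le_of_mem_cube_one hx]

variable [IsFiniteMeasure P]

lemma IsCoxProcess.lintegral_cube_one (hΛ : IsStationaryRandomMeasure P Λ)
    (hmean : ∫⁻ ω, Λ ω (unitCube d) ∂P = 1)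
    (hX : IsCoxProcess P (fun ω => ENNReal.ofReal lam • Λ ω) X) :
    ∫⁻ ω, X ω (cube d 1) ∂P = ENNReal.ofReal lam := by
  have hQ := measurableSet_cube (d := d) 1
  rw [hX.lintegral_apply (measurable_smul_randomMeasure _ hΛ.measurable) hQ
    (hΛ.ae_smul_apply_lt_top (by simp [hmean]) ENNReal.ofReal_ne_top hQ (isBounded_cube 1))]
  simp only [Measure.smul_apply, smul_eq_mul]
  rw [lintegral_const_mul' _ _ ENNReal.ofReal_ne_top, hΛ.lintegral_cube_one hmean, mul_one]

lemma lintegral_le_one_sub_percolationProbability (hlam : 0 < lam)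
    (hΛ : IsStationaryRandomMeasure P Λ) (hmean : ∫⁻ ω, Λ ω (unitCube d) ∂P = 1)
    (hX : IsCoxProcess P (fun ω => ENNReal.ofReal lam • Λ ω) X) (hr : 0 < r) :
    ∫⁻ ω, Λ ω (cube d 1) * expNeg lam (Metric.ball 0 (r + √d)) (Λ ω) ∂P
      ≤ 1 - percolationProbability P X lam r := by
  set N : Set (E d) := Metric.ball 0 (r + √d)
  have hQ := measurableSet_cube (d := d) 1
  have hN : MeasurableSet N := Metric.isOpen_ball.measurableSet
  have hQN : cube d 1 ⊆ N := fun x hx =>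
    Metric.mem_ball.2 (by linarith [dist_le_of_mem_cube_one hx])
  have hfin : ∀ A : Set (E d), MeasurableSet A → Bornology.IsBounded A →
      ∀ᵐ ω ∂P, (ENNReal.ofReal lam • Λ ω) A < ∞ := fun _ =>
    hΛ.ae_smul_apply_lt_top (by simp [hmean]) ENNReal.ofReal_ne_top
  have hisolated := hX.lintegral_single_mul_vacant hΛ.measurable hQ hN hQN
    (hfin _ hQ (isBounded_cube 1)) (hfin _ hN Metric.isBounded_ball)
  have hcount : ∫⁻ ω, (∫⁻ x in cube d 1, (originPercolates r).indicator 1 (shift x (X ω)) ∂(X ω))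
      + ({1} : Set ℝ≥0∞).indicator 1 (X ω (cube d 1))
        * ({0} : Set ℝ≥0∞).indicator 1 (X ω (N \ cube d 1)) ∂P ≤ ∫⁻ ω, X ω (cube d 1) ∂P :=
    lintegral_mono_ae <|
      (hX.ae_isCounting (measurable_smul_randomMeasure _ hΛ.measurable) hfin).mono
        fun ω hω => lintegral_percolates_add_le hω r
  have hmeas : Measurable fun ω => ({1} : Set ℝ≥0∞).indicator (1 : ℝ≥0∞ → ℝ≥0∞) (X ω (cube d 1))
      * ({0} : Set ℝ≥0∞).indicator (1 : ℝ≥0∞ → ℝ≥0∞) (X ω (N \ cube d 1)) :=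
    (measurable_indicator_apply hX.measurable hQ (measurableSet_singleton 1)).mul
      (measurable_indicator_apply hX.measurable (hN.diff hQ) (measurableSet_singleton 0))
  rw [lintegral_add_right _ hmeas, hisolated, hX.lintegral_cube_one hΛ hmean,
    ← ofReal_mul_percolationProbability hlam, ← mul_add] at hcount
  have hsum : percolationProbability P X lam r
      + ∫⁻ ω, Λ ω (cube d 1) * expNeg lam N (Λ ω) ∂P ≤ 1 := by
    rwa [← ENNReal.mul_le_mul_iff_right (a := ENNReal.ofReal lam) (by simpa using hlam)
      ENNReal.ofReal_ne_top, mul_one]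
  exact ENNReal.le_sub_of_add_le_left
    ((le_self_add.trans hsum).trans_lt ENNReal.one_lt_top).ne hsum

lemma one_sub_percolationProbability_le_tsum (hlam : 0 < lam)
    (hΛ : IsStationaryRandomMeasure P Λ) (hmean : ∫⁻ ω, Λ ω (unitCube d) ∂P = 1)
    (hX : IsCoxProcess P (fun ω => ENNReal.ofReal lam • Λ ω) X) {ι : Type*} [Countable ι]
    (A : ι → Set (E d)) (hA : ∀ i, MeasurableSet (A i)) (hb : ∀ i, Bornology.IsBounded (A i))
    (hdisj : ∀ i, Disjoint (cube d 1) (A i))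
    (hperc : ∀ ν : Measure (E d), IsCounting ν → (∀ i, ν (A i) ≠ 0) →
      ∀ x ∈ cube d 1, ν {x} ≠ 0 → shift x ν ∈ originPercolates r) :
    1 - percolationProbability P X lam r
      ≤ ∑' i, ∫⁻ ω, Λ ω (cube d 1) * expNeg lam (A i) (Λ ω) ∂P := by
  have hQ := measurableSet_cube (d := d) 1
  have hfin : ∀ A : Set (E d), MeasurableSet A → Bornology.IsBounded A →
      ∀ᵐ ω ∂P, (ENNReal.ofReal lam • Λ ω) A < ∞ := fun _ =>
    hΛ.ae_smul_apply_lt_top (by simp [hmean]) ENNReal.ofReal_ne_top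
  have hmeas : ∀ i, Measurable fun ω =>
      X ω (cube d 1) * ({0} : Set ℝ≥0∞).indicator (1 : ℝ≥0∞ → ℝ≥0∞) (X ω (A i)) := fun i =>
    ((Measure.measurable_coe hQ).comp hX.measurable).mul
      (measurable_indicator_apply hX.measurable (hA i) (measurableSet_singleton 0))
  have hvacant : ∀ i, ∫⁻ ω, X ω (cube d 1) * ({0} : Set ℝ≥0∞).indicator 1 (X ω (A i)) ∂P
      = ENNReal.ofReal lam * ∫⁻ ω, Λ ω (cube d 1) * expNeg lam (A i) (Λ ω) ∂P := fun i =>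
    hX.lintegral_mul_vacant hΛ.measurable hQ (hA i) (hdisj i) (hfin _ hQ (isBounded_cube 1))
      (hfin _ (hA i) (hb i))
  have hcount : ∫⁻ ω, X ω (cube d 1) ∂P
      ≤ ∫⁻ ω, (∫⁻ x in cube d 1, (originPercolates r).indicator 1 (shift x (X ω)) ∂(X ω))
        + ∑' i, X ω (cube d 1) * ({0} : Set ℝ≥0∞).indicator 1 (X ω (A i)) ∂P := by
    refine lintegral_mono_ae ?_
    filter_upwards [hX.ae_isCounting (measurable_smul_randomMeasure _ hΛ.measurable) hfin]
      with ω hω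
    by_cases hoccupied : ∀ i, X ω (A i) ≠ 0
    · exact (apply_le_lintegral_percolates hω (hperc _ hω hoccupied)).trans le_self_add
    · push Not at hoccupied
      obtain ⟨i, hi⟩ := hoccupied
      exact le_trans (by simp [hi]) ((ENNReal.le_tsum i).trans le_add_self)
  rw [lintegral_add_right _ (Measurable.tsum hmeas),
    lintegral_tsum fun i => (hmeas i).aemeasurable, hX.lintegral_cube_one hΛ hmean,
    ← ofReal_mul_percolationProbability hlam, tsum_congr hvacant, ENNReal.tsum_mul_left,
    ← mul_add] at hcount
  rw [tsub_le_iff_left, ← ENNReal.mul_le_mul_iff_right (a := ENNReal.ofReal lam)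
    (by simpa using hlam) ENNReal.ofReal_ne_top, mul_one]
  exact hcount

end PercolationProbability

/-! ### Exponential rates -/

section LogRate

variable {d : ℕ}

lemma logRate_mono {r : ℝ} (hr : 0 ≤ r) {p q : ℝ≥0∞} (h : p ≤ q) :
    logRate d r p ≤ logRate d r q :=
  mul_le_mul_of_nonneg_left (ENNReal.log_monotone h)
    (by exact_mod_cast inv_nonneg.2 (pow_nonneg hr d))

lemma logRate_ofReal_exp (r x : ℝ) :
    logRate d r (ENNReal.ofReal (Real.exp x)) = ((x / r ^ d : ℝ) : EReal) := by
  rw [logRate, ENNReal.log_ofReal_of_pos (Real.exp_pos x), Real.log_exp, ← EReal.coe_mul,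
    div_eq_inv_mul]

lemma ofReal_exp_le_of_lt_logRate {r a : ℝ} (hr : 0 < r) {p : ℝ≥0∞}
    (h : (a : EReal) < logRate d r p) : ENNReal.ofReal (Real.exp (a * r ^ d)) ≤ p := by
  by_contra hc
  have h2 := logRate_mono (d := d) hr.le (not_le.1 hc).le
  rw [logRate_ofReal_exp, mul_div_cancel_right₀ _ (pow_pos hr d).ne'] at h2
  exact absurd (h.trans_le h2) (lt_irrefl _)

lemma tendsto_add_pow_div_pow (d : ℕ) (k : ℝ) :
    Tendsto (fun r : ℝ => (r + k) ^ d / r ^ d) atTop (𝓝 1) := by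
  have h : Tendsto (fun r : ℝ => (1 + k / r) ^ d) atTop (𝓝 ((1 + 0) ^ d)) :=
    (tendsto_const_nhds.add (tendsto_const_nhds.div_atTop tendsto_id)).pow d
  rw [add_zero, one_pow] at h
  refine h.congr' ?_
  filter_upwards [eventually_gt_atTop 0] with r hr
  rw [← div_pow, add_div, div_self hr.ne']

lemma le_liminf_logRate {q : ℝ → ℝ≥0∞} {u : ℝ → ℝ} {a : ℝ}
    (h : ∀ᶠ r in atTop, ENNReal.ofReal (Real.exp (u r)) ≤ q r)
    (hu : Tendsto (fun r => u r / r ^ d) atTop (𝓝 a)) :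
    (a : EReal) ≤ liminf (fun r => logRate d r (q r)) atTop := by
  have hu' : Tendsto (fun r => ((u r / r ^ d : ℝ) : EReal)) atTop (𝓝 (a : EReal)) :=
    (continuous_coe_real_ereal.tendsto a).comp hu
  rw [← hu'.liminf_eq]
  refine liminf_le_liminf ?_
  filter_upwards [h, eventually_ge_atTop 0] with r hr h0
  rw [← logRate_ofReal_exp]
  exact logRate_mono h0 hr

lemma liminf_logRate_le_of_shift {p q : ℝ → ℝ≥0∞} {k : ℝ}
    (h : ∀ᶠ r in atTop, p (r + k) ≤ q r) :
    liminf (fun r => logRate d r (p r)) atTop ≤ liminf (fun r => logRate d r (q r)) atTop := by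
  refine le_of_forall_lt fun c hc => ?_
  obtain ⟨a, hca, ha⟩ := EReal.lt_iff_exists_real_btwn.1 hc
  refine hca.trans_le ?_
  have hev : ∀ᶠ r in atTop, (a : EReal) < logRate d r (p r) := eventually_lt_of_lt_liminf ha
  have hev' : ∀ᶠ r in atTop, ENNReal.ofReal (Real.exp (a * (r + k) ^ d)) ≤ q r := by
    filter_upwards [h, (tendsto_atTop_add_const_right atTop k tendsto_id).eventually hev,
      eventually_gt_atTop (-k)] with r h1 h2 h3
    simp only [id_eq] at h2
    exact (ofReal_exp_le_of_lt_logRate (by linarith) h2).trans h1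
  refine le_liminf_logRate hev' ?_
  have := (tendsto_add_pow_div_pow d k).const_mul a
  rw [mul_one] at this
  exact this.congr fun r => by ring

lemma lt_logRate_of_lt {r l c : ℝ} (hr : 0 < r) {p : ℝ≥0∞} (hlc : l < c)
    (h : ENNReal.ofReal (Real.exp (c * r ^ d)) ≤ p) : (l : EReal) < logRate d r p := by
  refine lt_of_lt_of_le (EReal.coe_lt_coe_iff.2 hlc) ((le_of_eq ?_).trans (logRate_mono hr.le h))
  rw [logRate_ofReal_exp, mul_div_cancel_right₀ _ (pow_pos hr d).ne']

lemma logRate_lt_of_lt {r l c : ℝ} (hr : 0 < r) {p : ℝ≥0∞} (hcl : c < l)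
    (h : p ≤ ENNReal.ofReal (Real.exp (c * r ^ d))) : logRate d r p < (l : EReal) := by
  refine lt_of_le_of_lt ((logRate_mono hr.le h).trans_eq ?_) (EReal.coe_lt_coe_iff.2 hcl)
  rw [logRate_ofReal_exp, mul_div_cancel_right₀ _ (pow_pos hr d).ne']

lemma tendsto_logRate {q : ℝ → ℝ≥0∞} {a : ℝ}
    (hlower : ∀ ε > 0, ∀ᶠ r : ℝ in atTop, ENNReal.ofReal (Real.exp (-(a + ε) * r ^ d)) ≤ q r)
    (hupper : ∀ ε > 0, ∀ᶠ r : ℝ in atTop, q r ≤ ENNReal.ofReal (Real.exp (-(a - ε) * r ^ d))) :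
    Tendsto (fun r => logRate d r (q r)) atTop (𝓝 ((-a : ℝ) : EReal)) := by
  refine tendsto_order.2 ⟨fun l hl => ?_, fun l hl => ?_⟩
  · obtain ⟨c, hlc, hc⟩ := EReal.lt_iff_exists_real_btwn.1 hl
    have hε : 0 < (-a - c) / 2 := by linarith [EReal.coe_lt_coe_iff.1 hc]
    filter_upwards [hlower _ hε, eventually_gt_atTop 0] with r hr hr0
    exact hlc.trans (lt_logRate_of_lt hr0 (by linarith) hr)
  · obtain ⟨c, hc, hcl⟩ := EReal.lt_iff_exists_real_btwn.1 hl
    have hε : 0 < (c + a) / 2 := by linarith [EReal.coe_lt_coe_iff.1 hc]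
    filter_upwards [hupper _ hε, eventually_gt_atTop 0] with r hr hr0
    exact (logRate_lt_of_lt hr0 (by linarith) hr).trans hcl

end LogRate

section IsolationBound

variable {Ω : Type*} [MeasurableSpace Ω] {d : ℕ} {P : Measure Ω} [IsFiniteMeasure P]
  {Λ X : Ω → Measure (E d)} {lam : ℝ}

lemma liminf_logRate_palm_le (hlam : 0 < lam) (hΛ : IsStationaryRandomMeasure P Λ)
    (hmean : ∫⁻ ω, Λ ω (unitCube d) ∂P = 1)
    (hX : IsCoxProcess P (fun ω => ENNReal.ofReal lam • Λ ω) X) :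
    liminf (fun r : ℝ =>
        logRate d r (palmExpectation P Λ 1 (expNeg lam (Metric.ball 0 r)))) atTop
      ≤ liminf (fun r : ℝ => logRate d r (1 - percolationProbability P X lam r)) atTop := by
  refine liminf_logRate_le_of_shift (k := √d + √d) ?_
  filter_upwards [eventually_gt_atTop 0] with r hr
  rw [← add_assoc]
  exact (palmExpectation_expNeg_le lam (r + √d)).trans
    (lintegral_le_one_sub_percolationProbability hlam hΛ hmean hX hr)

end IsolationBound

/-! ### Void probabilities of cubes -/

section VoidProbability

variable {Ω : Type*} [MeasurableSpace Ω] {d : ℕ} {P : Measure Ω}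
  {Λ : Ω → Measure (E d)} {lam : ℝ} {b : ℝ≥0} {s β : ℝ}

/-- The probability `E[exp(-λ Λ(Q_a))]` that a Cox process with intensity measure `λ Λ` has no
points in the cube `Q_a`. -/
def voidProb (P : Measure Ω) (Λ : Ω → Measure (E d)) (lam a : ℝ) : ℝ≥0∞ :=
  ∫⁻ ω, expNeg lam (cube d a) (Λ ω) ∂P

/-- The negative logarithm of the void probability of the cube `Q_a`. -/
def voidCost (P : Measure Ω) (Λ : Ω → Measure (E d)) (lam a : ℝ) : ℝ :=
  -Real.log (voidProb P Λ lam a).toReal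

/-- The tangent line of the convex function `t ↦ exp(-t)` at `c`, without subtraction. -/
lemma ofReal_le_expMinus_add (c : ℝ) (t : ℝ≥0∞) :
    ENNReal.ofReal (Real.exp (-c) * (1 + c))
      ≤ expMinus t + ENNReal.ofReal (Real.exp (-c)) * t := by
  rcases eq_or_ne t ∞ with rfl | ht
  · rw [ENNReal.mul_top (by simpa using Real.exp_pos _)]
    simp
  · lift t to ℝ≥0 using ht
    rw [expMinus_of_ne_top ENNReal.coe_ne_top, ENNReal.coe_toReal, ← ENNReal.ofReal_coe_nnreal,
      ← ENNReal.ofReal_mul (Real.exp_pos _).le, ← ENNReal.ofReal_add (Real.exp_pos _).le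
        (by positivity)]
    refine ENNReal.ofReal_le_ofReal ?_
    have hfactor : Real.exp (-(t : ℝ)) = Real.exp (-c) * Real.exp (c - t) := by
      rw [← Real.exp_add]
      ring_nf
    rw [hfactor]
    nlinarith [Real.exp_pos (-c), Real.add_one_le_exp (c - t)]

lemma expNeg_biUnion {ι : Type*} (lam : ℝ) (μ : Measure (E d)) (K : ι → Set (E d)) (F : Finset ι)
    (hK : ∀ z, MeasurableSet (K z)) (hdisj : (F : Set ι).PairwiseDisjoint K) :
    expNeg lam (⋃ z ∈ F, K z) μ = ∏ z ∈ F, expNeg lam (K z) μ := by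
  simp only [expNeg_eq]
  rw [measure_biUnion_finset hdisj fun z _ => hK z, Finset.mul_sum, expMinus_sum]

lemma lintegral_expNeg_core (hΛ : IsStationaryRandomMeasure P Λ) (lam s β : ℝ) (z : Fin d → ℤ) :
    ∫⁻ ω, expNeg lam (core s β z) (Λ ω) ∂P = voidProb P Λ lam (s - 2 * β) := by
  rw [voidProb, cube_eq_box]
  exact hΛ.lintegral_box (g := fun t => expMinus (ENNReal.ofReal lam * t))
    (measurable_expMinus.comp (measurable_const_mul _)) _ _ _

variable [IsProbabilityMeasure P]

lemma voidProb_le_one (lam a : ℝ) : voidProb P Λ lam a ≤ 1 :=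
  (lintegral_mono fun _ => expMinus_le_one _).trans (by simp)

lemma ofReal_exp_le_voidProb (hlam : 0 ≤ lam) (hΛ : IsStationaryRandomMeasure P Λ)
    (hmean : ∫⁻ ω, Λ ω (unitCube d) ∂P = 1) {a : ℝ} (ha : 0 ≤ a) :
    ENNReal.ofReal (Real.exp (-(lam * a ^ d))) ≤ voidProb P Λ lam a := by
  set c := lam * a ^ d
  have : 0 ≤ c := by positivity
  have hQ := measurableSet_cube (d := d) a
  have hmean' : ∫⁻ ω, ENNReal.ofReal (Real.exp (-c)) * (ENNReal.ofReal lam * Λ ω (cube d a)) ∂P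
      = ENNReal.ofReal (Real.exp (-c) * c) := by
    rw [lintegral_const_mul' _ _ ENNReal.ofReal_ne_top,
      lintegral_const_mul' _ _ ENNReal.ofReal_ne_top,
      hΛ.lintegral_apply_eq_volume hmean hQ, cube_eq_box, volume_box,
      ← ENNReal.ofReal_pow ha, ← ENNReal.ofReal_mul hlam, ← ENNReal.ofReal_mul
        (Real.exp_pos _).le]
  have h : ENNReal.ofReal (Real.exp (-c) * (1 + c))
      ≤ voidProb P Λ lam a + ENNReal.ofReal (Real.exp (-c) * c) := by
    have hmeas : Measurable fun ω => Λ ω (cube d a) :=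
      (Measure.measurable_coe hQ).comp hΛ.measurable
    rw [← hmean', voidProb, ← lintegral_add_right _ ((hmeas.const_mul _).const_mul _)]
    calc ENNReal.ofReal (Real.exp (-c) * (1 + c))
        = ∫⁻ _ω, ENNReal.ofReal (Real.exp (-c) * (1 + c)) ∂P := by simp
      _ ≤ _ := lintegral_mono fun ω => ofReal_le_expMinus_add c _
  rw [mul_add, mul_one, ENNReal.ofReal_add (Real.exp_pos _).le (by positivity)] at h
  exact (ENNReal.add_le_add_iff_right ENNReal.ofReal_ne_top).1 h

lemma voidProb_eq_ofReal_exp (hlam : 0 ≤ lam) (hΛ : IsStationaryRandomMeasure P Λ)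
    (hmean : ∫⁻ ω, Λ ω (unitCube d) ∂P = 1) {a : ℝ} (ha : 0 ≤ a) :
    voidProb P Λ lam a = ENNReal.ofReal (Real.exp (-voidCost P Λ lam a)) := by
  have h1 : voidProb P Λ lam a ≠ ∞ := ((voidProb_le_one lam a).trans_lt ENNReal.one_lt_top).ne
  have h0 : voidProb P Λ lam a ≠ 0 :=
    ((ENNReal.ofReal_pos.2 (Real.exp_pos _)).trans_le
      (ofReal_exp_le_voidProb hlam hΛ hmean ha)).ne'
  rw [voidCost, neg_neg, Real.exp_log (ENNReal.toReal_pos h0 h1), ENNReal.ofReal_toReal h1]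

lemma voidCost_nonneg (lam a : ℝ) : 0 ≤ voidCost P Λ lam a := by
  rw [voidCost, neg_nonneg]
  exact Real.log_nonpos ENNReal.toReal_nonneg
    (ENNReal.toReal_le_of_le_ofReal zero_le_one (by simpa using voidProb_le_one lam a))

lemma voidCost_le (hlam : 0 ≤ lam) (hΛ : IsStationaryRandomMeasure P Λ)
    (hmean : ∫⁻ ω, Λ ω (unitCube d) ∂P = 1) {a : ℝ} (ha : 0 ≤ a) :
    voidCost P Λ lam a ≤ lam * a ^ d := by
  have h := ofReal_exp_le_voidProb hlam hΛ hmean ha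
  rw [voidProb_eq_ofReal_exp hlam hΛ hmean ha, ENNReal.ofReal_le_ofReal_iff (Real.exp_pos _).le,
    Real.exp_le_exp] at h
  linarith

lemma lintegral_expNeg_biUnion_core (hΛ : IsStationaryRandomMeasure P Λ)
    (hdep : IsDependent P Λ b) (hs : 0 < s) (hβ : (b : ℝ) < β) (F : Finset (Fin d → ℤ)) :
    ∫⁻ ω, expNeg lam (⋃ z ∈ F, core s β z) (Λ ω) ∂P = voidProb P Λ lam (s - 2 * β) ^ F.card := by
  have hβ0 : 0 < β := b.2.trans_lt hβ
  have hcorridor : (b : ℝ≥0∞) < ENNReal.ofReal (2 * β) := by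
    rw [← ENNReal.ofReal_coe_nnreal]
    exact (ENNReal.ofReal_lt_ofReal_iff (by linarith)).2 (by linarith)
  calc ∫⁻ ω, expNeg lam (⋃ z ∈ F, core s β z) (Λ ω) ∂P
      = ∫⁻ ω, ∏ z ∈ F, expNeg lam (core s β z) (Λ ω) ∂P := lintegral_congr fun ω =>
        expNeg_biUnion lam _ _ F (measurableSet_core s β) (pairwiseDisjoint_core hs hβ0 _)
    _ = ∏ z ∈ F, ∫⁻ ω, expNeg lam (core s β z) (Λ ω) ∂P :=
        hdep.lintegral_prod (g := fun t => expMinus (ENNReal.ofReal lam * t)) hΛ.measurable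
          hcorridor (measurableSet_core s β) (measurable_expMinus.comp (measurable_const_mul _)) F
          fun z _ w _ h x hx y hy => le_edist_of_mem_core hs.le h hx hy
    _ = voidProb P Λ lam (s - 2 * β) ^ F.card :=
        (Finset.prod_congr rfl fun z _ => lintegral_expNeg_core hΛ lam s β z).trans
          (Finset.prod_const _)

lemma lintegral_mul_expNeg_biUnion_core [NeZero d] (hΛ : IsStationaryRandomMeasure P Λ)
    (hmean : ∫⁻ ω, Λ ω (unitCube d) ∂P = 1) (hdep : IsDependent P Λ b)
    (hs : 0 < s) (hβ : (b : ℝ) + 1 / 2 < β) (F : Finset (Fin d → ℤ)) :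
    ∫⁻ ω, Λ ω (cube d 1) * expNeg lam (⋃ z ∈ F, core s β z) (Λ ω) ∂P
      = voidProb P Λ lam (s - 2 * β) ^ F.card := by
  have hβ0 : 0 < β := by linarith [b.2]
  have hcorridor : (b : ℝ≥0∞) < ENNReal.ofReal (β - 1 / 2) := by
    rw [← ENNReal.ofReal_coe_nnreal]
    exact (ENNReal.ofReal_lt_ofReal_iff (by linarith)).2 (by linarith)
  have hprod : ∀ ω, expNeg lam (⋃ z ∈ F, core s β z) (Λ ω)
      = ∏ z ∈ F, expNeg lam (core s β z) (Λ ω) := fun ω =>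
    expNeg_biUnion lam _ _ F (measurableSet_core s β) (pairwiseDisjoint_core hs hβ0 _)
  calc ∫⁻ ω, Λ ω (cube d 1) * expNeg lam (⋃ z ∈ F, core s β z) (Λ ω) ∂P
      = ∫⁻ ω, Λ ω (cube d 1) * ∏ z ∈ F, expNeg lam (core s β z) (Λ ω) ∂P := by simp only [hprod]
    _ = (∫⁻ ω, Λ ω (cube d 1) ∂P) * ∫⁻ ω, ∏ z ∈ F, expNeg lam (core s β z) (Λ ω) ∂P :=
        hdep.lintegral_mul_prod (g := fun t => expMinus (ENNReal.ofReal lam * t)) (h := id)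
          hΛ.measurable hcorridor (measurableSet_cube 1) (measurableSet_core s β) measurable_id
          (measurable_expMinus.comp (measurable_const_mul _)) F
          fun z _ x hx y hy => le_edist_of_mem_cube_of_mem_core hs.le hx hy
    _ = voidProb P Λ lam (s - 2 * β) ^ F.card := by
        simp only [hΛ.lintegral_cube_one hmean, one_mul, ← hprod]
        exact lintegral_expNeg_biUnion_core hΛ hdep hs (by linarith) F

lemma exists_finset_cell_subset_cube (hs : 0 < s) {R : ℝ} (hR : 2 * s ≤ R) :
    ∃ F : Finset (Fin d → ℤ), (∀ z ∈ F, cell s z ⊆ cube d R) ∧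
      (R - 2 * s) ^ d ≤ F.card * s ^ d := by
  obtain ⟨F, hF, hcover⟩ :=
    exists_finset_cell_inter_nonempty hs (isBounded_cube (d := d) (R - 2 * s))
  refine ⟨F, fun z hz x hx i => ?_, ?_⟩
  · obtain ⟨y, hyz, hy⟩ := (hF z).1 hz
    constructor <;> linarith [hx i, hyz i, hy i]
  · have h := volume_le_card_mul_pow F hcover
    rwa [cube_eq_box, volume_box, ← ENNReal.ofReal_pow (by linarith), ← ENNReal.ofReal_pow hs.le,
      ← ENNReal.ofReal_natCast, ← ENNReal.ofReal_mul (by positivity),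
      ENNReal.ofReal_le_ofReal_iff (by positivity)] at h

lemma voidProb_le_pow_card (hΛ : IsStationaryRandomMeasure P Λ) (hdep : IsDependent P Λ b)
    (hs : 0 < s) (hβ : (b : ℝ) < β) {F : Finset (Fin d → ℤ)} {R : ℝ}
    (hF : ∀ z ∈ F, cell s z ⊆ cube d R) :
    voidProb P Λ lam R ≤ voidProb P Λ lam (s - 2 * β) ^ F.card := by
  rw [← lintegral_expNeg_biUnion_core hΛ hdep hs hβ F]
  refine lintegral_mono fun ω => expMinus_antitone (mul_le_mul_right (measure_mono ?_) _)
  exact Set.iUnion₂_subset fun z hz => (core_subset_cell (b.2.trans_lt hβ) z).trans (hF z hz)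

lemma pow_mul_voidCost_le (hlam : 0 ≤ lam) (hΛ : IsStationaryRandomMeasure P Λ)
    (hmean : ∫⁻ ω, Λ ω (unitCube d) ∂P = 1) (hdep : IsDependent P Λ b) (hβ : (b : ℝ) < β)
    {a R : ℝ} (ha : 0 < a) (hR : 2 * (a + 2 * β) ≤ R) :
    (R - 2 * (a + 2 * β)) ^ d * voidCost P Λ lam a ≤ (a + 2 * β) ^ d * voidCost P Λ lam R := by
  have hβ0 : 0 < β := b.2.trans_lt hβ
  set s := a + 2 * β with hs
  have hs0 : 0 < s := by positivity
  obtain ⟨F, hF, hcard⟩ := exists_finset_cell_subset_cube (d := d) hs0 hR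
  have hcost : F.card * voidCost P Λ lam a ≤ voidCost P Λ lam R := by
    have h := voidProb_le_pow_card (lam := lam) hΛ hdep hs0 hβ hF
    rw [hs, add_sub_cancel_right, voidProb_eq_ofReal_exp hlam hΛ hmean ha.le,
      voidProb_eq_ofReal_exp hlam hΛ hmean (by linarith), ← ENNReal.ofReal_pow (Real.exp_pos _).le,
      ← Real.exp_nat_mul, ENNReal.ofReal_le_ofReal_iff (Real.exp_pos _).le, Real.exp_le_exp] at h
    linarith
  calc (R - 2 * s) ^ d * voidCost P Λ lam a ≤ F.card * s ^ d * voidCost P Λ lam a :=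
        mul_le_mul_of_nonneg_right hcard (voidCost_nonneg _ _)
    _ = s ^ d * (F.card * voidCost P Λ lam a) := by ring
    _ ≤ s ^ d * voidCost P Λ lam R := mul_le_mul_of_nonneg_left hcost (by positivity)

lemma eventually_lt_div_pow {ψ : ℝ → ℝ} {l c : ℝ} (hs : 0 < s)
    (hψ : ∀ R, 2 * s ≤ R → (R - 2 * s) ^ d * c ≤ s ^ d * ψ R) (hl : l < c / s ^ d) :
    ∀ᶠ R : ℝ in atTop, l < ψ R / R ^ d := by
  have hlim := (tendsto_add_pow_div_pow d (-(2 * s))).mul_const (c / s ^ d)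
  rw [one_mul] at hlim
  filter_upwards [hlim.eventually (lt_mem_nhds hl), eventually_ge_atTop (2 * s),
    eventually_gt_atTop 0] with R hlR hR hR0
  refine hlR.trans_le ?_
  rw [← sub_eq_add_neg, div_mul_div_comm, div_le_div_iff₀ (by positivity) (by positivity)]
  calc (R - 2 * s) ^ d * c * R ^ d ≤ s ^ d * ψ R * R ^ d :=
        mul_le_mul_of_nonneg_right (hψ R hR) (by positivity)
    _ = ψ R * (R ^ d * s ^ d) := by ring

lemma eventually_div_pow_lt {ψ : ℝ → ℝ} {I k l : ℝ} (hk : 0 ≤ k)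
    (hI : ∀ a, 0 < a → ψ a / (a + k) ^ d ≤ I) (hl : I < l) :
    ∀ᶠ R : ℝ in atTop, ψ R / R ^ d < l := by
  have hlim := (tendsto_add_pow_div_pow d k).mul_const I
  rw [one_mul] at hlim
  filter_upwards [hlim.eventually (gt_mem_nhds hl), eventually_gt_atTop 0] with R hlR hR
  refine lt_of_le_of_lt ?_ hlR
  have h := hI R hR
  rw [div_le_iff₀ (by positivity)] at h
  rw [div_mul_eq_mul_div]
  exact div_le_div_of_nonneg_right (by linarith) (by positivity)

/-- A version of Fekete's lemma for volumes, in which the superadditivity may lose corridors of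
width `2 β`. -/
lemma exists_tendsto_div_pow {ψ : ℝ → ℝ} {C : ℝ} (hβ : 0 < β) (hψ0 : ∀ a, 0 ≤ ψ a)
    (hψC : ∀ a, 0 ≤ a → ψ a ≤ C * a ^ d)
    (hψ : ∀ a R, 0 < a → 2 * (a + 2 * β) ≤ R →
      (R - 2 * (a + 2 * β)) ^ d * ψ a ≤ (a + 2 * β) ^ d * ψ R) :
    ∃ I : ℝ, 0 ≤ I ∧ Tendsto (fun R : ℝ => ψ R / R ^ d) atTop (𝓝 I) := by
  have hC0 : 0 ≤ C := by simpa using (hψ0 1).trans (hψC 1 zero_le_one)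
  set f : Set.Ioi (0 : ℝ) → ℝ := fun a => ψ a / (a + 2 * β) ^ d with hf
  have hbdd : BddAbove (Set.range f) := by
    refine ⟨C, ?_⟩
    rintro _ ⟨⟨a, ha : 0 < a⟩, rfl⟩
    rw [hf, div_le_iff₀ (by positivity)]
    refine (hψC a ha.le).trans (mul_le_mul_of_nonneg_left ?_ hC0)
    exact pow_le_pow_left₀ ha.le (by linarith) d
  have hle : ∀ a : ℝ, 0 < a → ψ a / (a + 2 * β) ^ d ≤ ⨆ a, f a := fun a ha =>
    le_ciSup hbdd ⟨a, ha⟩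
  refine ⟨⨆ a, f a, (div_nonneg (hψ0 1) (by positivity)).trans (hle 1 one_pos),
    tendsto_order.2 ⟨fun l hl => ?_, fun l hl => eventually_div_pow_lt (by positivity) hle hl⟩⟩
  have : Nonempty (Set.Ioi (0 : ℝ)) := ⟨⟨1, Set.mem_Ioi.2 one_pos⟩⟩
  obtain ⟨⟨a, ha : 0 < a⟩, hla⟩ := exists_lt_of_lt_ciSup hl
  exact eventually_lt_div_pow (by positivity) (fun R hR => hψ a R ha hR) hla

lemma exists_tendsto_voidCost (hlam : 0 ≤ lam) (hΛ : IsStationaryRandomMeasure P Λ)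
    (hmean : ∫⁻ ω, Λ ω (unitCube d) ∂P = 1) (hdep : IsDependent P Λ b) :
    ∃ I : ℝ, 0 ≤ I ∧ Tendsto (fun R : ℝ => voidCost P Λ lam R / R ^ d) atTop (𝓝 I) :=
  exists_tendsto_div_pow (β := b + 1) (C := lam) (by positivity) (voidCost_nonneg lam)
    (fun _ ha => voidCost_le hlam hΛ hmean ha)
    (fun _ _ ha hR => pow_mul_voidCost_le hlam hΛ hmean hdep (lt_add_one _) ha hR)

lemma tendsto_logRate_voidProb (hlam : 0 ≤ lam) (hΛ : IsStationaryRandomMeasure P Λ)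
    (hmean : ∫⁻ ω, Λ ω (unitCube d) ∂P = 1) {I : ℝ}
    (hI : Tendsto (fun R : ℝ => voidCost P Λ lam R / R ^ d) atTop (𝓝 I)) :
    Tendsto (fun r : ℝ => logRate d r (voidProb P Λ lam r)) atTop (𝓝 ((-I : ℝ) : EReal)) := by
  have h := (continuous_coe_real_ereal.tendsto _).comp hI.neg
  refine h.congr' ?_
  filter_upwards [eventually_ge_atTop 0] with r hr
  rw [voidProb_eq_ofReal_exp hlam hΛ hmean hr, logRate_ofReal_exp, Function.comp_apply, neg_div]

end VoidProbability

/-! ### Exponential moments -/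

/-- The extended exponential `exp t`, with value `∞` at `t = ∞`. -/
def expPlus (t : ℝ≥0∞) : ℝ≥0∞ := EReal.exp (t : EReal)

lemma expPlus_mono : Monotone expPlus := fun s t h => by
  unfold expPlus
  rw [EReal.exp_le_exp_iff]
  exact_mod_cast h

lemma measurable_expPlus : Measurable expPlus := expPlus_mono.measurable

lemma expPlus_zero : expPlus 0 = 1 := by simp [expPlus]

lemma one_le_expPlus (t : ℝ≥0∞) : 1 ≤ expPlus t := expPlus_zero.symm.le.trans (expPlus_mono zero_le)

lemma expPlus_add (s t : ℝ≥0∞) : expPlus (s + t) = expPlus s * expPlus t := by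
  unfold expPlus
  rw [← EReal.exp_add, EReal.coe_ennreal_add]

lemma expPlus_sum {ι : Type*} (F : Finset ι) (f : ι → ℝ≥0∞) :
    expPlus (∑ i ∈ F, f i) = ∏ i ∈ F, expPlus (f i) := by
  classical
  induction F using Finset.induction_on with
  | empty => simp [expPlus_zero]
  | insert i F hi ih => rw [Finset.sum_insert hi, Finset.prod_insert hi, expPlus_add, ih]

lemma expPlus_coe (t : ℝ≥0) : expPlus t = ENNReal.ofReal (Real.exp t) := rfl

lemma expPlus_ofReal {t : ℝ} (ht : 0 ≤ t) :
    expPlus (ENNReal.ofReal t) = ENNReal.ofReal (Real.exp t) := by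
  rw [ENNReal.ofReal, expPlus_coe, Real.coe_toNNReal _ ht]

lemma le_expPlus (t : ℝ≥0∞) : t ≤ expPlus t := by
  rcases eq_or_ne t ∞ with rfl | ht
  · simp [expPlus]
  · lift t to ℝ≥0 using ht
    rw [expPlus_coe, ← ENNReal.ofReal_coe_nnreal]
    exact ENNReal.ofReal_le_ofReal (by linarith [Real.add_one_le_exp (t : ℝ)])

/-- The class with the largest sum carries at least the fraction `1 / card κ` of the total. -/
lemma expPlus_sum_le_sum_prod {ι κ : Type*} [Fintype κ] [Nonempty κ] [DecidableEq κ] (ρ : ι → κ)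
    (F : Finset ι) (f : ι → ℝ≥0∞) :
    expPlus (∑ i ∈ F, f i) ≤ ∑ c, ∏ i ∈ F with ρ i = c, expPlus (Fintype.card κ * f i) := by
  obtain ⟨c, -, hc⟩ := Finset.exists_max_image Finset.univ
    (fun c => ∑ i ∈ F with ρ i = c, f i) Finset.univ_nonempty
  have hsum : ∑ i ∈ F, f i ≤ ∑ i ∈ F with ρ i = c, Fintype.card κ * f i := by
    rw [← Finset.sum_fiberwise F ρ, ← Finset.mul_sum, ← nsmul_eq_mul, ← Finset.card_univ]
    exact Finset.sum_le_card_nsmul _ _ _ hc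
  calc expPlus (∑ i ∈ F, f i) ≤ expPlus (∑ i ∈ F with ρ i = c, Fintype.card κ * f i) :=
        expPlus_mono hsum
    _ = ∏ i ∈ F with ρ i = c, expPlus (Fintype.card κ * f i) := expPlus_sum _ _
    _ ≤ ∑ c, ∏ i ∈ F with ρ i = c, expPlus (Fintype.card κ * f i) := Finset.single_le_sum
        (f := fun c => ∏ i ∈ F with ρ i = c, expPlus (Fintype.card κ * f i))
        (fun _ _ => zero_le) (Finset.mem_univ c)

section ExponentialMoments

variable {Ω : Type*} [MeasurableSpace Ω] {d : ℕ} {P : Measure Ω}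
  {Λ : Ω → Measure (E d)} {b : ℝ≥0}

/-- The closed lattice box `u + [0,1]^d`. -/
def unitBox (u : Fin d → ℤ) : Set (E d) := box (fun i => (u i : ℝ)) 1

lemma measurableSet_unitBox (u : Fin d → ℤ) : MeasurableSet (unitBox u) := measurableSet_box _ _

lemma mem_unitBox_floor (x : E d) : x ∈ unitBox fun i => ⌊x i⌋ := fun _ =>
  ⟨Int.floor_le _, (Int.lt_floor_add_one _).le⟩

lemma exists_finset_subset_biUnion_unitBox {A : Set (E d)} (hA : Bornology.IsBounded A) :
    ∃ U : Finset (Fin d → ℤ), A ⊆ ⋃ u ∈ U, unitBox u := by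
  obtain ⟨U, -, hU⟩ := exists_finset_cell_inter_nonempty one_pos hA
  refine ⟨U, hU.trans (Set.iUnion₂_mono fun u _ x hx i => ?_)⟩
  have := hx i
  constructor <;> linarith

lemma le_edist_of_mem_unitBox {m : ℕ} {u v : Fin d → ℤ} (h : u ≠ v)
    (hc : (fun i => (u i : ZMod m)) = fun i => (v i : ZMod m)) {x y : E d} (hx : x ∈ unitBox u)
    (hy : y ∈ unitBox v) : ENNReal.ofReal (m - 1) ≤ edist x y := by
  obtain ⟨i, hi⟩ := Function.ne_iff.1 h
  have hdvd : (m : ℤ) ∣ v i - u i := (ZMod.intCast_eq_intCast_iff_dvd_sub _ _ _).1 (congrFun hc i)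
  have hle : (m : ℤ) ≤ |v i - u i| :=
    Int.le_of_dvd (abs_pos.2 (sub_ne_zero.2 fun h => hi h.symm)) ((dvd_abs _ _).2 hdvd)
  refine ofReal_le_edist_of_le_abs i ?_
  have hxi := hx i
  have hyi := hy i
  rw [le_abs]
  rcases le_abs.1 hle with hle | hle
  · have : (m : ℝ) ≤ v i - u i := by exact_mod_cast hle
    right; linarith
  · have : (m : ℝ) ≤ -(v i - u i) := by exact_mod_cast hle
    left; linarith

lemma lintegral_expPlus_unitBox (hΛ : IsStationaryRandomMeasure P Λ) (γ : ℝ≥0∞) (u : Fin d → ℤ) :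
    ∫⁻ ω, expPlus (γ * Λ ω (unitBox u)) ∂P = ∫⁻ ω, expPlus (γ * Λ ω (cube d 1)) ∂P := by
  rw [cube_eq_box]
  exact hΛ.lintegral_box (g := fun t => expPlus (γ * t))
    (measurable_expPlus.comp (measurable_const_mul _)) _ _ _

lemma lintegral_prod_expPlus_unitBox [IsProbabilityMeasure P] (hΛ : IsStationaryRandomMeasure P Λ)
    (hdep : IsDependent P Λ b) {m : ℕ} (hm : (b : ℝ) + 1 < m) (γ : ℝ≥0∞) {G : Finset (Fin d → ℤ)}
    {c : Fin d → ZMod m} (hG : ∀ u ∈ G, (fun i => (u i : ZMod m)) = c) :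
    ∫⁻ ω, ∏ u ∈ G, expPlus (γ * Λ ω (unitBox u)) ∂P
      = (∫⁻ ω, expPlus (γ * Λ ω (cube d 1)) ∂P) ^ G.card := by
  have hb : (b : ℝ≥0∞) < ENNReal.ofReal (m - 1) := by
    rw [← ENNReal.ofReal_coe_nnreal]
    exact (ENNReal.ofReal_lt_ofReal_iff (by linarith [b.2])).2 (by linarith)
  rw [hdep.lintegral_prod (g := fun t => expPlus (γ * t)) hΛ.measurable hb measurableSet_unitBox
    (measurable_expPlus.comp (measurable_const_mul _)) G fun u hu v hv huv x hx y hy =>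
      le_edist_of_mem_unitBox huv ((hG u hu).trans (hG v hv).symm) hx hy]
  simp only [lintegral_expPlus_unitBox hΛ, Finset.prod_const]

/-- Boxes whose indices agree modulo `m > b + 1` carry independent masses. -/
lemma lintegral_expPlus_sum_unitBox_le [IsProbabilityMeasure P]
    (hΛ : IsStationaryRandomMeasure P Λ) (hdep : IsDependent P Λ b) {m : ℕ} [NeZero m]
    (hm : (b : ℝ) + 1 < m) (γ : ℝ≥0∞) (G : Finset (Fin d → ℤ)) :
    ∫⁻ ω, expPlus (γ * ∑ u ∈ G, Λ ω (unitBox u)) ∂P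
      ≤ (m ^ d : ℕ) * (∫⁻ ω, expPlus ((m ^ d : ℕ) * γ * Λ ω (cube d 1)) ∂P) ^ G.card := by
  classical
  have hcard : Fintype.card (Fin d → ZMod m) = m ^ d := by simp [ZMod.card]
  let ρ : (Fin d → ℤ) → (Fin d → ZMod m) := fun u i => (u i : ZMod m)
  have hone : 1 ≤ ∫⁻ ω, expPlus ((m ^ d : ℕ) * γ * Λ ω (cube d 1)) ∂P :=
    calc (1 : ℝ≥0∞) = ∫⁻ _ω, 1 ∂P := by simp
      _ ≤ _ := lintegral_mono fun ω => one_le_expPlus _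
  have hmeas : ∀ u : Fin d → ℤ, Measurable fun ω => expPlus ((m ^ d : ℕ) * γ * Λ ω (unitBox u)) :=
    fun u => measurable_expPlus.comp
      (((Measure.measurable_coe (measurableSet_unitBox u)).comp hΛ.measurable).const_mul _)
  calc ∫⁻ ω, expPlus (γ * ∑ u ∈ G, Λ ω (unitBox u)) ∂P
      ≤ ∫⁻ ω, ∑ c, ∏ u ∈ G with ρ u = c, expPlus ((m ^ d : ℕ) * γ * Λ ω (unitBox u)) ∂P :=
        lintegral_mono fun ω => by
          simpa only [Finset.mul_sum, hcard, mul_assoc] using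
            expPlus_sum_le_sum_prod ρ G fun u => γ * Λ ω (unitBox u)
    _ = ∑ c, ∫⁻ ω, ∏ u ∈ G with ρ u = c, expPlus ((m ^ d : ℕ) * γ * Λ ω (unitBox u)) ∂P :=
        lintegral_finsetSum _ fun c _ => Finset.measurable_prod _ fun u _ => hmeas u
    _ ≤ ∑ _c : Fin d → ZMod m,
          (∫⁻ ω, expPlus ((m ^ d : ℕ) * γ * Λ ω (cube d 1)) ∂P) ^ G.card :=
        Finset.sum_le_sum fun c _ => by
          rw [lintegral_prod_expPlus_unitBox hΛ hdep hm _ fun u hu => (Finset.mem_filter.1 hu).2]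
          exact pow_le_pow_right₀ hone (Finset.card_filter_le _ _)
    _ = (m ^ d : ℕ) * (∫⁻ ω, expPlus ((m ^ d : ℕ) * γ * Λ ω (cube d 1)) ∂P) ^ G.card := by
        rw [Finset.sum_const, Finset.card_univ, hcard, nsmul_eq_mul]

lemma exists_lintegral_expPlus_sum_unitBox_le [IsProbabilityMeasure P]
    (hΛ : IsStationaryRandomMeasure P Λ) (hdep : IsDependent P Λ b)
    (hexp : HasAllExpMoments P fun ω => Λ ω (cube d 1)) {γ : ℝ} (hγ : 0 < γ) :
    ∃ D c : ℝ, 0 ≤ D ∧ 0 ≤ c ∧ ∀ G : Finset (Fin d → ℤ),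
      ∫⁻ ω, expPlus (ENNReal.ofReal γ * ∑ u ∈ G, Λ ω (unitBox u)) ∂P
        ≤ ENNReal.ofReal (D * Real.exp (c * G.card)) := by
  obtain ⟨m, hm⟩ := exists_nat_gt ((b : ℝ) + 1)
  have hm0 : (0 : ℝ) < m := by linarith [b.2]
  have : NeZero m := ⟨by exact_mod_cast hm0.ne'⟩
  set C := ∫⁻ ω, expPlus ((m ^ d : ℕ) * ENNReal.ofReal γ * Λ ω (cube d 1)) ∂P with hC
  have hCtop : C ≠ ∞ := by
    have h := hexp ((m ^ d : ℕ) * γ) (by push_cast; positivity)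
    rw [ENNReal.ofReal_mul (by positivity), ENNReal.ofReal_natCast] at h
    exact h.ne
  refine ⟨(m ^ d : ℕ), C.toReal, by positivity, ENNReal.toReal_nonneg, fun G => ?_⟩
  rw [ENNReal.ofReal_mul (by positivity), ENNReal.ofReal_natCast, mul_comm C.toReal,
    Real.exp_nat_mul, ENNReal.ofReal_pow (Real.exp_pos _).le]
  refine (lintegral_expPlus_sum_unitBox_le hΛ hdep hm _ G).trans
    (mul_le_mul_right (pow_le_pow_left₀ zero_le ?_ _) _)
  rw [← hC, ← ENNReal.ofReal_toReal hCtop, ENNReal.toReal_ofReal ENNReal.toReal_nonneg]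
  exact ENNReal.ofReal_le_ofReal (by linarith [Real.add_one_le_exp C.toReal])

/-- The offsets of the unit boxes that cover a cell of side length `n` outside its core. -/
def corridor (d : ℕ) (n β : ℕ) : Finset (Fin d → ℤ) :=
  Fintype.piFinset (fun _ => Finset.Ico (0 : ℤ) n) \
    Fintype.piFinset (fun _ => Finset.Ico (β : ℤ) (n - β))

lemma card_corridor {n β : ℕ} (h : 2 * β ≤ n) :
    (corridor d n β).card = n ^ d - (n - 2 * β) ^ d := by
  rw [corridor, Finset.card_sdiff_of_subset]
  · simp only [Fintype.card_piFinset, Int.card_Ico, Finset.prod_const, Finset.card_univ,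
      Fintype.card_fin]
    congr 2; omega
  · exact Fintype.piFinset_subset _ _ fun _ => Finset.Ico_subset_Ico (by positivity) (by omega)

lemma floor_sub_mem_corridor {n β : ℕ} {z : Fin d → ℤ} {x : E d} (hx : x ∈ cell (n : ℝ) z)
    (hc : x ∉ core (n : ℝ) β z) : (fun i => ⌊x i⌋ - n * z i) ∈ corridor d n β := by
  simp only [corridor, Finset.mem_sdiff, Fintype.mem_piFinset, Finset.mem_Ico]
  refine ⟨fun i => ?_, fun hin => hc fun i => ?_⟩
  · have hlower : (n * z i : ℤ) ≤ ⌊x i⌋ := Int.le_floor.2 (by push_cast; exact (hx i).1)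
    have hupper : ⌊x i⌋ < (n * z i + n : ℤ) := Int.floor_lt.2 (by push_cast; exact (hx i).2)
    constructor <;> linarith
  · obtain ⟨hl, hu⟩ := hin i
    have hlower : ((n * z i + β : ℤ) : ℝ) ≤ x i := Int.le_floor.1 (by linarith)
    have hupper : ((⌊x i⌋ + 1 : ℤ) : ℝ) ≤ ((n * z i + n - β : ℤ) : ℝ) := by
      exact_mod_cast (by linarith : ⌊x i⌋ + 1 ≤ (n * z i + n - β : ℤ))
    have hfloor := Int.lt_floor_add_one (x i)
    push_cast at hlower hupper
    constructor <;> linarith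

lemma exists_biUnion_cell_subset {n β : ℕ} (h : 2 * β ≤ n) (F : Finset (Fin d → ℤ)) :
    ∃ G : Finset (Fin d → ℤ), G.card ≤ F.card * (n ^ d - (n - 2 * β) ^ d) ∧
      ⋃ z ∈ F, cell (n : ℝ) z ⊆ (⋃ z ∈ F, core n β z) ∪ ⋃ u ∈ G, unitBox u := by
  classical
  refine ⟨(F ×ˢ corridor d n β).image fun q => fun i => n * q.1 i + q.2 i, ?_, ?_⟩
  · refine Finset.card_image_le.trans ?_
    rw [Finset.card_product, card_corridor h]
  · refine Set.iUnion₂_subset fun z hz x hx => ?_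
    by_cases hc : x ∈ core (n : ℝ) β z
    · exact Or.inl (Set.mem_biUnion hz hc)
    · refine Or.inr (Set.mem_biUnion (x := fun i => ⌊x i⌋) ?_ (mem_unitBox_floor x))
      simp only [Finset.coe_image, Set.mem_image, Finset.mem_coe, Finset.mem_product, Prod.exists]
      exact ⟨z, _, ⟨hz, floor_sub_mem_corridor hx hc⟩, by funext i; ring⟩

end ExponentialMoments

section IsolationLowerBound

variable {Ω : Type*} [MeasurableSpace Ω] {d : ℕ} {P : Measure Ω} [IsProbabilityMeasure P]
  {Λ X : Ω → Measure (E d)} {lam : ℝ} {b : ℝ≥0}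

/-- The volume of the unit ball. -/
def ballVolume (d : ℕ) : ℝ := (volume (Metric.ball (0 : E d) 1)).toReal

lemma ballVolume_nonneg : 0 ≤ ballVolume d := ENNReal.toReal_nonneg

lemma volume_ball_eq [NeZero d] {R : ℝ} (hR : 0 ≤ R) :
    volume (Metric.ball (0 : E d) R) = ENNReal.ofReal (ballVolume d * R ^ d) := by
  rw [Measure.addHaar_ball _ _ hR, finrank_euclideanSpace_fin, mul_comm, ballVolume,
    ENNReal.ofReal_mul ENNReal.toReal_nonneg, ENNReal.ofReal_toReal measure_ball_lt_top.ne]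

lemma exists_ball_subset_biUnion_cell [NeZero d] {s R : ℝ} (hs : 0 < s) (hR : 0 ≤ R) :
    ∃ F : Finset (Fin d → ℤ), F.card * s ^ d ≤ ballVolume d * (R + s * √d) ^ d ∧
      Metric.ball (0 : E d) R ⊆ ⋃ z ∈ F, cell s z := by
  obtain ⟨F, hF, hcov⟩ :=
    exists_finset_cell_inter_nonempty hs (Metric.isBounded_ball (x := (0 : E d)) (r := R))
  refine ⟨F, ?_, hcov⟩
  have hsub : ∀ z ∈ F, cell s z ⊆ Metric.ball 0 (R + s * √d) := by
    intro z hz x hx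
    obtain ⟨y, hyz, hy⟩ := (hF z).1 hz
    rw [Metric.mem_ball] at hy ⊢
    linarith [dist_le_of_mem_cell hs.le hx hyz, dist_triangle x y 0]
  have h := card_mul_pow_le_volume hs F hsub
  rwa [volume_ball_eq (by positivity), ← ENNReal.ofReal_pow hs.le, ← ENNReal.ofReal_natCast,
    ← ENNReal.ofReal_mul (by positivity), ENNReal.ofReal_le_ofReal_iff
      (mul_nonneg ballVolume_nonneg (by positivity))] at h

/-- The first term is at least `1` when `t ≤ τ`, the second when `τ ≤ t`. -/
lemma one_le_exp_mul_add {α τ : ℝ} (hlam : 0 ≤ lam) (hα : 0 ≤ α) (hτ : 0 ≤ τ) (t : ℝ≥0∞) :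
    1 ≤ ENNReal.ofReal (Real.exp (lam * τ)) * expMinus (ENNReal.ofReal lam * t)
      + ENNReal.ofReal (Real.exp (-(α * τ))) * expPlus (ENNReal.ofReal α * t) := by
  rcases le_total t (ENNReal.ofReal τ) with h | h
  · refine le_trans ?_ le_self_add
    calc (1 : ℝ≥0∞) = ENNReal.ofReal (Real.exp (lam * τ))
          * expMinus (ENNReal.ofReal lam * ENNReal.ofReal τ) := by
          rw [← ENNReal.ofReal_mul hlam, expMinus_ofReal (by positivity),
            ← ENNReal.ofReal_mul (Real.exp_pos _).le, ← Real.exp_add]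
          simp
      _ ≤ _ := mul_le_mul_right (expMinus_antitone (mul_le_mul_right h _)) _
  · refine le_trans ?_ le_add_self
    calc (1 : ℝ≥0∞) = ENNReal.ofReal (Real.exp (-(α * τ)))
          * expPlus (ENNReal.ofReal α * ENNReal.ofReal τ) := by
          rw [← ENNReal.ofReal_mul hα, expPlus_ofReal (by positivity),
            ← ENNReal.ofReal_mul (Real.exp_pos _).le, ← Real.exp_add]
          simp
      _ ≤ _ := mul_le_mul_right (expPlus_mono (mul_le_mul_right h _)) _

lemma mul_expMinus_le_add {α τ : ℝ} (hlam : 0 ≤ lam) (hα : 1 ≤ α) (hτ : 0 ≤ τ)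
    {y k t m : ℝ≥0∞} (hm : m ≤ k + t) (hy : y ≤ t) :
    y * expMinus (ENNReal.ofReal lam * k)
      ≤ ENNReal.ofReal (Real.exp (lam * τ)) * (y * expMinus (ENNReal.ofReal lam * m))
        + ENNReal.ofReal (Real.exp (-(α * τ))) * expPlus (ENNReal.ofReal (2 * α) * t) := by
  have hvoid : expMinus (ENNReal.ofReal lam * k) * expMinus (ENNReal.ofReal lam * t)
      ≤ expMinus (ENNReal.ofReal lam * m) := by
    rw [← expMinus_add, ← mul_add]
    exact expMinus_antitone (mul_le_mul_right hm _)
  have hlarge : y * expPlus (ENNReal.ofReal α * t) ≤ expPlus (ENNReal.ofReal (2 * α) * t) := by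
    have hyα : y ≤ ENNReal.ofReal α * t :=
      hy.trans (le_mul_of_one_le_left' (by simpa using hα))
    rw [two_mul, ENNReal.ofReal_add (by linarith) (by linarith), add_mul, expPlus_add]
    exact mul_le_mul_left ((le_expPlus y).trans (expPlus_mono hyα)) _
  set κ := expMinus (ENNReal.ofReal lam * k)
  set A := ENNReal.ofReal (Real.exp (lam * τ))
  set B := ENNReal.ofReal (Real.exp (-(α * τ)))
  calc y * κ = y * κ * 1 := (mul_one _).symm
    _ ≤ y * κ * (A * expMinus (ENNReal.ofReal lam * t) + B * expPlus (ENNReal.ofReal α * t)) :=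
        mul_le_mul_right (one_le_exp_mul_add hlam (by linarith) hτ t) _
    _ = A * (y * (κ * expMinus (ENNReal.ofReal lam * t)))
          + B * (y * expPlus (ENNReal.ofReal α * t) * κ) := by ring
    _ ≤ A * (y * expMinus (ENNReal.ofReal lam * m))
          + B * (expPlus (ENNReal.ofReal (2 * α) * t) * 1) := by
        gcongr
        exact expMinus_le_one _
    _ = _ := by rw [mul_one]

lemma voidProb_pow_card_le [NeZero d] (hlam : 0 ≤ lam) (hΛ : IsStationaryRandomMeasure P Λ)
    (hmean : ∫⁻ ω, Λ ω (unitCube d) ∂P = 1) (hdep : IsDependent P Λ b) {s β : ℝ} (hs : 0 < s)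
    (hβ : (b : ℝ) + 1 / 2 < β) {α τ : ℝ} (hα : 1 ≤ α) (hτ : 0 ≤ τ) {B : Set (E d)}
    (hB : MeasurableSet B) {F G : Finset (Fin d → ℤ)} (hcube : cube d 1 ⊆ ⋃ u ∈ G, unitBox u)
    (hcov : B ⊆ (⋃ z ∈ F, core s β z) ∪ ⋃ u ∈ G, unitBox u) :
    voidProb P Λ lam (s - 2 * β) ^ F.card
      ≤ ENNReal.ofReal (Real.exp (lam * τ)) * ∫⁻ ω, Λ ω (cube d 1) * expNeg lam B (Λ ω) ∂P
        + ENNReal.ofReal (Real.exp (-(α * τ)))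
          * ∫⁻ ω, expPlus (ENNReal.ofReal (2 * α) * ∑ u ∈ G, Λ ω (unitBox u)) ∂P := by
  have hmeasVoid : Measurable fun ω => Λ ω (cube d 1) * expNeg lam B (Λ ω) :=
    ((Measure.measurable_coe (measurableSet_cube 1)).comp hΛ.measurable).mul
      ((measurable_expNeg lam hB).comp hΛ.measurable)
  rw [← lintegral_mul_expNeg_biUnion_core hΛ hmean hdep hs hβ F,
    ← lintegral_const_mul _ hmeasVoid, ← lintegral_const_mul' _ _ ENNReal.ofReal_ne_top,
    ← lintegral_add_left (hmeasVoid.const_mul _)]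
  refine lintegral_mono fun ω => mul_expMinus_le_add hlam hα hτ ?_ ?_
  · exact (measure_mono hcov).trans ((measure_union_le _ _).trans
      (add_le_add_right (measure_biUnion_finset_le _ _) _))
  · exact (measure_mono hcube).trans (measure_biUnion_finset_le _ _)

lemma tendsto_corridor_fraction (d β : ℕ) :
    Tendsto (fun n : ℕ => ((n ^ d - (n - 2 * β) ^ d : ℕ) : ℝ) / (n : ℝ) ^ d) atTop (𝓝 0) := by
  have h := ((tendsto_add_pow_div_pow d (-(2 * β : ℝ))).comp
    (tendsto_natCast_atTop_atTop (R := ℝ))).const_sub 1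
  rw [sub_self] at h
  refine h.congr' ?_
  filter_upwards [eventually_gt_atTop (2 * β)] with n hn
  have hn0 : (n : ℝ) ^ d ≠ 0 := pow_ne_zero _ (by exact_mod_cast (by omega : n ≠ 0))
  rw [Nat.cast_sub (Nat.pow_le_pow_left (Nat.sub_le _ _) d), Function.comp_apply, eq_div_iff hn0,
    sub_mul, div_mul_cancel₀ _ hn0, Nat.cast_pow, Nat.cast_pow, Nat.cast_sub hn.le]
  push_cast
  ring

/-- The mesh `n` is chosen so large that the cores are almost as cheap to empty as the cells, while
the corridors fill only a small fraction of the space. -/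
lemma exists_mesh {c : ℝ → ℝ} {I ε : ℝ} (hI0 : 0 ≤ I)
    (hI : Tendsto (fun R : ℝ => c R / R ^ d) atTop (𝓝 I)) (hε : 0 < ε) (β : ℕ) (κ : ℝ) :
    ∃ n : ℕ, 2 * β < n ∧ c (n - 2 * β) ≤ (I + ε) * n ^ d ∧
      ((n ^ d - (n - 2 * β) ^ d : ℕ) : ℝ) * κ ≤ (n : ℝ) ^ d := by
  have hcost : ∀ᶠ R : ℝ in atTop, c R / R ^ d < I + ε :=
    hI.eventually (gt_mem_nhds (by linarith))
  have hshift : Tendsto (fun n : ℕ => (n : ℝ) - 2 * β) atTop atTop :=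
    tendsto_atTop_add_const_right atTop _ tendsto_natCast_atTop_atTop
  have hfraction := (tendsto_corridor_fraction d β).mul_const κ
  rw [zero_mul] at hfraction
  obtain ⟨n, hn, hcostn, hfractionn⟩ := ((eventually_gt_atTop (2 * β)).and
    ((hshift.eventually hcost).and (hfraction.eventually (gt_mem_nhds one_pos)))).exists
  have hn' : (2 * β : ℝ) < n := by exact_mod_cast hn
  have hn0 : (0 : ℝ) < n := lt_of_le_of_lt (by positivity) hn'
  refine ⟨n, hn, ?_, ?_⟩
  · rw [div_lt_iff₀ (pow_pos (by linarith) d)] at hcostn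
    refine hcostn.le.trans (mul_le_mul_of_nonneg_left ?_ (by linarith))
    exact pow_le_pow_left₀ (by linarith) (by linarith [(Nat.cast_nonneg β : (0 : ℝ) ≤ β)]) d
  · rw [div_mul_eq_mul_div, div_lt_one (by positivity)] at hfractionn
    exact hfractionn.le

lemma eventually_exp_le_of_le_add [NeZero d] {W : ℝ → ℝ≥0∞} {A D ε : ℝ} (hε : 0 < ε)
    (hD : 0 ≤ D)
    (h : ∀ᶠ R : ℝ in atTop, ENNReal.ofReal (Real.exp (-A * R ^ d))
      ≤ ENNReal.ofReal (Real.exp (ε * R ^ d)) * W R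
        + ENNReal.ofReal (D * Real.exp (-(A + 1) * R ^ d))) :
    ∀ᶠ R : ℝ in atTop, ENNReal.ofReal (Real.exp (-(A + 2 * ε) * R ^ d)) ≤ W R := by
  have hpow : Tendsto (fun R : ℝ => R ^ d) atTop atTop := tendsto_pow_atTop (NeZero.ne d)
  have herror : ∀ᶠ R : ℝ in atTop, Real.exp (-(ε * R ^ d)) + D * Real.exp (-R ^ d) < 1 := by
    have hlim := (Real.tendsto_exp_neg_atTop_nhds_zero.comp (hpow.const_mul_atTop hε)).add
      ((Real.tendsto_exp_neg_atTop_nhds_zero.comp hpow).const_mul D)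
    rw [mul_zero, add_zero] at hlim
    exact hlim.eventually (gt_mem_nhds one_pos)
  filter_upwards [h, herror] with R hR hsmall
  have hexp : Real.exp (ε * R ^ d) * Real.exp (-(A + 2 * ε) * R ^ d)
      ≤ Real.exp (-A * R ^ d) - D * Real.exp (-(A + 1) * R ^ d) := by
    have hε' : Real.exp (ε * R ^ d) * Real.exp (-(A + 2 * ε) * R ^ d)
        = Real.exp (-(ε * R ^ d)) * Real.exp (-A * R ^ d) := by
      rw [← Real.exp_add, ← Real.exp_add]; congr 1; ring
    have hA : Real.exp (-(A + 1) * R ^ d) = Real.exp (-R ^ d) * Real.exp (-A * R ^ d) := by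
      rw [← Real.exp_add]; congr 1; ring
    rw [hε', hA]
    nlinarith [Real.exp_pos (-A * R ^ d)]
  refine (ENNReal.mul_le_mul_iff_right (a := ENNReal.ofReal (Real.exp (ε * R ^ d)))
    (ENNReal.ofReal_pos.2 (Real.exp_pos _)).ne' ENNReal.ofReal_ne_top).1 ?_
  rw [← ENNReal.ofReal_mul (Real.exp_pos _).le]
  refine (ENNReal.ofReal_le_ofReal hexp).trans ?_
  rw [ENNReal.ofReal_sub _ (by positivity)]
  exact tsub_le_iff_right.2 hR

lemma ofReal_exp_le_voidProb_pow (hlam : 0 ≤ lam) (hΛ : IsStationaryRandomMeasure P Λ)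
    (hmean : ∫⁻ ω, Λ ω (unitCube d) ∂P = 1) {a t : ℝ} (ha : 0 ≤ a) {N : ℕ}
    (h : N * voidCost P Λ lam a ≤ t) :
    ENNReal.ofReal (Real.exp (-t)) ≤ voidProb P Λ lam a ^ N := by
  rw [voidProb_eq_ofReal_exp hlam hΛ hmean ha, ← ENNReal.ofReal_pow (Real.exp_pos _).le,
    ← Real.exp_nat_mul]
  exact ENNReal.ofReal_le_ofReal (Real.exp_le_exp.2 (by linarith))

lemma exists_core_unitBox_cover (d : ℕ) [NeZero d] :
    ∃ K : ℕ, ∀ (n β : ℕ) (R : ℝ), 2 * β < n → 0 ≤ R → ∃ F G : Finset (Fin d → ℤ),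
      F.card * (n : ℝ) ^ d ≤ ballVolume d * (R + n * √d) ^ d ∧
      G.card ≤ K + F.card * (n ^ d - (n - 2 * β) ^ d) ∧
      cube d 1 ⊆ ⋃ u ∈ G, unitBox u ∧
      Metric.ball (0 : E d) R ⊆ (⋃ z ∈ F, core (n : ℝ) β z) ∪ ⋃ u ∈ G, unitBox u := by
  classical
  obtain ⟨U, hU⟩ := exists_finset_subset_biUnion_unitBox (isBounded_cube (d := d) 1)
  refine ⟨U.card, fun n β R hn hR => ?_⟩
  obtain ⟨F, hF, hball⟩ :=
    exists_ball_subset_biUnion_cell (d := d) (s := n) (by exact_mod_cast (by omega : 0 < n)) hR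
  obtain ⟨G, hG, hcells⟩ := exists_biUnion_cell_subset hn.le F
  refine ⟨F, U ∪ G, hF, (Finset.card_union_le _ _).trans (by gcongr), ?_, ?_⟩
  · exact hU.trans (Set.biUnion_subset_biUnion_left Finset.subset_union_left)
  · rw [Finset.set_biUnion_union]
    exact (hball.trans hcells).trans (Set.union_subset_union_right _ Set.subset_union_right)

lemma mul_card_le_of_corridor {N G K x κ w c t : ℝ} (hc : 0 ≤ c) (hx : 0 < x) (hκ : 0 ≤ κ)
    (ht : 0 ≤ t) (hG : G ≤ K + N * κ) (hN : N * x ≤ w * t) (hκx : κ * (w * c) ≤ x) :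
    c * G ≤ c * K + t := by
  have hcorridor : (N * κ * c) * x ≤ t * x :=
    calc (N * κ * c) * x = (N * x) * (κ * c) := by ring
      _ ≤ (w * t) * (κ * c) := by gcongr
      _ = t * (κ * (w * c)) := by ring
      _ ≤ t * x := by gcongr
  linarith [le_of_mul_le_mul_right hcorridor hx, mul_le_mul_of_nonneg_left hG hc]

lemma exists_eventually_exp_le_add [NeZero d] (hlam : 0 ≤ lam)
    (hΛ : IsStationaryRandomMeasure P Λ) (hmean : ∫⁻ ω, Λ ω (unitCube d) ∂P = 1)
    (hdep : IsDependent P Λ b) (hexp : HasAllExpMoments P (fun ω => Λ ω (cube d 1))) {I : ℝ}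
    (hI0 : 0 ≤ I) (hI : Tendsto (fun R : ℝ => voidCost P Λ lam R / R ^ d) atTop (𝓝 I))
    {ε δ A : ℝ} (hε : 0 < ε) (hδ : 0 < δ) (hA : A = (I + ε) * ((1 + ε) * ballVolume d)) :
    ∃ D : ℝ, 0 ≤ D ∧ ∀ᶠ R : ℝ in atTop, ENNReal.ofReal (Real.exp (-A * R ^ d))
      ≤ ENNReal.ofReal (Real.exp (lam * (δ * R ^ d)))
          * ∫⁻ ω, Λ ω (cube d 1) * expNeg lam (Metric.ball 0 R) (Λ ω) ∂P
        + ENNReal.ofReal (D * Real.exp (-(A + 1) * R ^ d)) := by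
  have hv := ballVolume_nonneg (d := d)
  set w := (1 + ε) * ballVolume d
  set α := max 1 ((A + 2) / δ)
  have hα : 1 ≤ α := le_max_left _ _
  have hαδ : A + 2 ≤ α * δ := by rw [← div_le_iff₀ hδ]; exact le_max_right _ _
  obtain ⟨β, hβ⟩ := exists_nat_gt ((b : ℝ) + 1 / 2)
  obtain ⟨K, hcover⟩ := exists_core_unitBox_cover d
  obtain ⟨D, c, hD, hc, hmoment⟩ :=
    exists_lintegral_expPlus_sum_unitBox_le hΛ hdep hexp (γ := 2 * α) (by linarith)
  obtain ⟨n, hn, hcost, hcorridor⟩ := exists_mesh hI0 hI hε β (w * c)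
  have hn0 : (0 : ℝ) < n := by exact_mod_cast (by omega : 0 < n)
  have hcore : 0 ≤ (n : ℝ) - 2 * β := by rw [sub_nonneg]; exact_mod_cast hn.le
  refine ⟨D * Real.exp (c * K), by positivity, ?_⟩
  filter_upwards [(tendsto_add_pow_div_pow d (n * √d)).eventually
    (gt_mem_nhds (by linarith : 1 < 1 + ε)), eventually_gt_atTop 0] with R hgrow hR
  rw [div_lt_iff₀ (by positivity)] at hgrow
  obtain ⟨F, G, hF, hG, hcube, hball⟩ := hcover n β R hn hR.le
  have hFR : F.card * (n : ℝ) ^ d ≤ w * R ^ d := hF.trans (by nlinarith)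
  have hvoid : ENNReal.ofReal (Real.exp (-A * R ^ d)) ≤ voidProb P Λ lam (n - 2 * β) ^ F.card := by
    rw [neg_mul]
    refine ofReal_exp_le_voidProb_pow hlam hΛ hmean hcore ?_
    calc F.card * voidCost P Λ lam (n - 2 * β) ≤ F.card * ((I + ε) * n ^ d) := by gcongr
      _ = (I + ε) * (F.card * n ^ d) := by ring
      _ ≤ (I + ε) * (w * R ^ d) := by gcongr
      _ = A * R ^ d := by rw [hA]; ring
  have hGR : c * G.card ≤ c * K + R ^ d :=
    mul_card_le_of_corridor hc (pow_pos hn0 d) (Nat.cast_nonneg _) (by positivity)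
      (by exact_mod_cast hG) hFR hcorridor
  refine hvoid.trans ((voidProb_pow_card_le hlam hΛ hmean hdep hn0 hβ hα
    (τ := δ * R ^ d) (by positivity) measurableSet_ball hcube hball).trans ?_)
  gcongr
  refine (mul_le_mul_right (hmoment G) _).trans ?_
  rw [← ENNReal.ofReal_mul (Real.exp_pos _).le, mul_left_comm, ← Real.exp_add, mul_assoc D,
    ← Real.exp_add]
  have := mul_le_mul_of_nonneg_right hαδ (pow_nonneg hR.le d)
  exact ENNReal.ofReal_le_ofReal
    (mul_le_mul_of_nonneg_left (Real.exp_le_exp.2 (by linarith)) hD)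

lemma eventually_ofReal_exp_le_lintegral_expNeg_ball [NeZero d] (hlam : 0 < lam)
    (hΛ : IsStationaryRandomMeasure P Λ) (hmean : ∫⁻ ω, Λ ω (unitCube d) ∂P = 1)
    (hdep : IsDependent P Λ b) (hexp : HasAllExpMoments P (fun ω => Λ ω (cube d 1))) {I : ℝ}
    (hI0 : 0 ≤ I) (hI : Tendsto (fun R : ℝ => voidCost P Λ lam R / R ^ d) atTop (𝓝 I)) {η : ℝ}
    (hη : 0 < η) :
    ∀ᶠ R : ℝ in atTop, ENNReal.ofReal (Real.exp (-(ballVolume d * I + η) * R ^ d))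
      ≤ ∫⁻ ω, Λ ω (cube d 1) * expNeg lam (Metric.ball 0 R) (Λ ω) ∂P := by
  obtain ⟨ε, hεη, hε⟩ : ∃ ε : ℝ,
      (I + ε) * ((1 + ε) * ballVolume d) + 2 * ε < ballVolume d * I + η ∧ 0 < ε := by
    have hcont : Continuous fun ε : ℝ => (I + ε) * ((1 + ε) * ballVolume d) + 2 * ε := by fun_prop
    have hlim := hcont.tendsto 0
    simp only [add_zero, one_mul, mul_zero] at hlim
    exact (((hlim.mono_left nhdsWithin_le_nhds).eventually
      (gt_mem_nhds (by linarith))).and self_mem_nhdsWithin : ∀ᶠ ε in 𝓝[>] (0 : ℝ), _).exists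
  obtain ⟨D, hD, h⟩ := exists_eventually_exp_le_add hlam.le hΛ hmean hdep hexp hI0 hI hε
    (div_pos hε hlam) rfl
  have hcancel : ∀ R : ℝ, lam * (ε / lam * R ^ d) = ε * R ^ d := fun R => by field_simp
  simp only [hcancel] at h
  filter_upwards [eventually_exp_le_of_le_add hε hD h, eventually_ge_atTop 0] with R hR hR0
  refine le_trans ?_ hR
  gcongr

lemma eventually_le_one_sub_percolationProbability [NeZero d] (hlam : 0 < lam)
    (hΛ : IsStationaryRandomMeasure P Λ) (hmean : ∫⁻ ω, Λ ω (unitCube d) ∂P = 1)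
    (hX : IsCoxProcess P (fun ω => ENNReal.ofReal lam • Λ ω) X)
    (hdep : IsDependent P Λ b) (hexp : HasAllExpMoments P (fun ω => Λ ω (cube d 1))) {I : ℝ}
    (hI0 : 0 ≤ I) (hI : Tendsto (fun R : ℝ => voidCost P Λ lam R / R ^ d) atTop (𝓝 I)) {ε : ℝ}
    (hε : 0 < ε) :
    ∀ᶠ r : ℝ in atTop, ENNReal.ofReal (Real.exp (-(ballVolume d * I + ε) * r ^ d))
      ≤ 1 - percolationProbability P X lam r := by
  set a := ballVolume d * I
  have ha0 : 0 ≤ a := mul_nonneg ballVolume_nonneg hI0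
  have hvoid := eventually_ofReal_exp_le_lintegral_expNeg_ball hlam hΛ hmean hdep hexp hI0 hI
    (half_pos hε)
  have hgrow : ∀ᶠ r : ℝ in atTop, (r + √d) ^ d / r ^ d < (a + ε) / (a + ε / 2) :=
    (tendsto_add_pow_div_pow d (√d)).eventually (gt_mem_nhds (by
      rw [lt_div_iff₀ (by positivity)]; linarith))
  filter_upwards [(tendsto_atTop_add_const_right atTop (√d) tendsto_id).eventually hvoid, hgrow,
    eventually_gt_atTop 0] with r hvoidr hgrowr hr
  simp only [id_eq] at hvoidr
  refine le_trans ?_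
    (hvoidr.trans (lintegral_le_one_sub_percolationProbability hlam hΛ hmean hX hr))
  refine ENNReal.ofReal_le_ofReal (Real.exp_le_exp.2 ?_)
  rw [div_lt_div_iff₀ (by positivity) (by positivity)] at hgrowr
  linarith

end IsolationLowerBound

/-! ### Topology of the star-lattice -/

section LatticeTopology

variable {d : ℕ} {A : Type*} [AddCommGroup A]

/-- Two lattice points are star-adjacent if all their coordinates differ by at most one; in
particular every point is star-adjacent to itself. -/
def StarAdj (x y : Fin d → ℤ) : Prop := ∀ i, |x i - y i| ≤ 1

lemma StarAdj.refl (x : Fin d → ℤ) : StarAdj x x := fun i => by simp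

lemma StarAdj.symm {x y : Fin d → ℤ} (h : StarAdj x y) : StarAdj y x := fun i => by
  rw [abs_sub_comm]; exact h i

/-- The map that moves every nonzero coordinate by one towards zero; its iterates contract the
star-lattice to the origin. -/
def shrink (x : Fin d → ℤ) : Fin d → ℤ := fun i => x i - (x i).sign

lemma shrink_apply_eq (x : Fin d → ℤ) (i : Fin d) :
    (0 < x i ∧ shrink x i = x i - 1) ∨ (x i = 0 ∧ shrink x i = 0) ∨
      (x i < 0 ∧ shrink x i = x i + 1) := by
  unfold shrink
  rcases lt_trichotomy (x i) 0 with h | h | h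
  · right; right; rw [Int.sign_eq_neg_one_of_neg h]; omega
  · right; left; simp [h]
  · left; rw [Int.sign_eq_one_of_pos h]; omega

lemma starAdj_shrink (x : Fin d → ℤ) : StarAdj x (shrink x) := fun i => by
  rw [abs_le]
  rcases shrink_apply_eq x i with h | h | h <;> omega

lemma StarAdj.shrink {x y : Fin d → ℤ} (h : StarAdj x y) : StarAdj (shrink x) (shrink y) :=
  fun i => by
    have hi := abs_le.1 (h i)
    rw [abs_le]
    rcases shrink_apply_eq x i with hx | hx | hx <;>
      rcases shrink_apply_eq y i with hy | hy | hy <;> omega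

lemma StarAdj.iterate_shrink {x y : Fin d → ℤ} (h : StarAdj x y) (n : ℕ) :
    StarAdj (CoxPercolation.shrink^[n] x) (CoxPercolation.shrink^[n] y) := by
  induction n with
  | zero => exact h
  | succ n ih => rw [Function.iterate_succ_apply', Function.iterate_succ_apply']; exact ih.shrink

lemma natAbs_iterate_shrink (x : Fin d → ℤ) (n : ℕ) (i : Fin d) :
    (shrink^[n] x i).natAbs = (x i).natAbs - n := by
  induction n with
  | zero => simp
  | succ n ih =>
    rw [Function.iterate_succ_apply']
    rcases shrink_apply_eq (shrink^[n] x) i with h | h | h <;> omega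

/-- A number of iterations of `shrink` that suffices to reach the origin. -/
def shrinkTime (x : Fin d → ℤ) : ℕ := ∑ i, (x i).natAbs

lemma iterate_shrink_eq_zero {x : Fin d → ℤ} {n : ℕ} (h : shrinkTime x ≤ n) : shrink^[n] x = 0 := by
  funext i
  have habs := natAbs_iterate_shrink x n i
  have hle : (x i).natAbs ≤ shrinkTime x :=
    Finset.single_le_sum (f := fun i => (x i).natAbs) (fun _ _ => Nat.zero_le _) (Finset.mem_univ i)
  rw [Pi.zero_apply]
  omega

lemma exists_starAdj_cone {x y : Fin d → ℤ} (h : StarAdj x y) :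
    ∃ w, StarAdj x w ∧ StarAdj y w ∧ StarAdj (shrink x) w ∧ StarAdj (shrink y) w := by
  refine ⟨fun i => if (x i).natAbs ≤ (y i).natAbs then x i else y i, ?_, ?_, ?_, ?_⟩ <;> intro i <;>
    have hi := abs_le.1 (h i) <;> simp only <;> rw [abs_le] <;> split_ifs with hxy <;>
    rcases shrink_apply_eq x i with hx | hx | hx <;>
    rcases shrink_apply_eq y i with hy | hy | hy <;> omega

/-- A `1`-cocycle of the star-lattice: a function on the edges that is closed on triangles. -/
def IsStarCocycle (f : (Fin d → ℤ) → (Fin d → ℤ) → A) : Prop :=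
  ∀ x y z, StarAdj x y → StarAdj y z → StarAdj x z → f x y + f y z = f x z

namespace IsStarCocycle

variable {f : (Fin d → ℤ) → (Fin d → ℤ) → A} {x y : Fin d → ℤ}

lemma self (hf : IsStarCocycle f) (x : Fin d → ℤ) : f x x = 0 := by
  simpa using hf x x x (.refl x) (.refl x) (.refl x)

lemma swap (hf : IsStarCocycle f) (h : StarAdj x y) : f y x = -f x y := by
  refine eq_neg_of_add_eq_zero_right ?_
  rw [hf x y x h h.symm (.refl x), hf.self]

lemma eq_sub_add_shrink (hf : IsStarCocycle f) (h : StarAdj x y) :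
    f x y = f x (shrink x) - f y (shrink y) + f (shrink x) (shrink y) := by
  obtain ⟨w, hxw, hyw, hxw', hyw'⟩ := exists_starAdj_cone h
  rw [← hf x w y hxw hyw.symm h, ← hf x w _ hxw hxw'.symm (starAdj_shrink x),
    ← hf y w _ hyw hyw'.symm (starAdj_shrink y), ← hf _ w _ hxw' hyw'.symm h.shrink,
    hf.swap hyw, hf.swap hxw']
  abel

lemma eq_sub_add_iterate_shrink (hf : IsStarCocycle f) (h : StarAdj x y) (n : ℕ) :
    f x y = ∑ k ∈ Finset.range n, f (shrink^[k] x) (shrink^[k + 1] x)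
      - ∑ k ∈ Finset.range n, f (shrink^[k] y) (shrink^[k + 1] y)
      + f (shrink^[n] x) (shrink^[n] y) := by
  induction n with
  | zero => simp
  | succ n ih =>
    rw [ih, hf.eq_sub_add_shrink (h.iterate_shrink n)]
    simp only [Finset.sum_range_succ, Function.iterate_succ_apply']
    abel

lemma sum_range_shrink (hf : IsStarCocycle f) {n : ℕ} (hn : shrinkTime x ≤ n) :
    ∑ k ∈ Finset.range n, f (shrink^[k] x) (shrink^[k + 1] x)
      = ∑ k ∈ Finset.range (shrinkTime x), f (shrink^[k] x) (shrink^[k + 1] x) := by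
  induction n, hn using Nat.le_induction with
  | base => rfl
  | succ n hn ih =>
    rw [Finset.sum_range_succ, ih, iterate_shrink_eq_zero hn,
      iterate_shrink_eq_zero (hn.trans n.le_succ), hf.self, add_zero]

lemma exists_potential (hf : IsStarCocycle f) :
    ∃ g : (Fin d → ℤ) → A, ∀ x y, StarAdj x y → f x y = g x - g y := by
  refine ⟨fun x => ∑ k ∈ Finset.range (shrinkTime x), f (shrink^[k] x) (shrink^[k + 1] x),
    fun x y h => ?_⟩
  rw [hf.eq_sub_add_iterate_shrink h (max (shrinkTime x) (shrinkTime y)),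
    iterate_shrink_eq_zero (le_max_left _ _), iterate_shrink_eq_zero (le_max_right _ _), hf.self,
    add_zero, hf.sum_range_shrink (le_max_left _ _), hf.sum_range_shrink (le_max_right _ _)]

end IsStarCocycle

end LatticeTopology

section StarConnected

variable {d : ℕ} {S S' T D Z : Set (Fin d → ℤ)} {x y : Fin d → ℤ}

/-- Star-adjacency within a set. -/
def StepIn (S : Set (Fin d → ℤ)) (x y : Fin d → ℤ) : Prop := x ∈ S ∧ y ∈ S ∧ StarAdj x y

/-- A set of lattice points is star-connected if any two of its points are joined by a path of
star-adjacent points within the set; the empty set is star-connected. -/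
def StarConnected (S : Set (Fin d → ℤ)) : Prop :=
  ∀ x ∈ S, ∀ y ∈ S, Relation.ReflTransGen (StepIn S) x y

lemma StepIn.symm (h : StepIn S x y) : StepIn S y x := ⟨h.2.1, h.1, h.2.2.symm⟩

lemma StepIn.mono (h : S ⊆ S') (hxy : StepIn S x y) : StepIn S' x y :=
  ⟨h hxy.1, h hxy.2.1, hxy.2.2⟩

lemma reflTransGen_stepIn_symm (h : Relation.ReflTransGen (StepIn S) x y) :
    Relation.ReflTransGen (StepIn S) y x := by
  induction h with
  | refl => exact .refl
  | tail _ hbc ih => exact Relation.ReflTransGen.head hbc.symm ih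

lemma reflTransGen_stepIn_mono (h : S ⊆ S') (hxy : Relation.ReflTransGen (StepIn S) x y) :
    Relation.ReflTransGen (StepIn S') x y :=
  Relation.ReflTransGen.mono (r := StepIn S) (fun _ _ => StepIn.mono h) x y hxy

lemma starConnected_of_forall_reflTransGen {x : Fin d → ℤ}
    (h : ∀ y ∈ S, Relation.ReflTransGen (StepIn S) x y) : StarConnected S :=
  fun y hy z hz => (reflTransGen_stepIn_symm (h y hy)).trans (h z hz)

lemma StarConnected.apply_eq {A : Type*} (hS : StarConnected S) {g : (Fin d → ℤ) → A}
    (hg : ∀ x y, StepIn S x y → g x = g y) (hx : x ∈ S) (hy : y ∈ S) : g x = g y := by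
  induction hS x hx y hy with
  | refl => rfl
  | tail _ hbc ih => exact (ih hbc.1).trans (hg _ _ hbc)

open Classical in
/-- The indicator modulo two of the edges between two sets of lattice points. -/
def edgeIndicator (T Z : Set (Fin d → ℤ)) (a b : Fin d → ℤ) : ZMod 2 :=
  if (a ∈ T ∧ b ∈ Z) ∨ (b ∈ T ∧ a ∈ Z) then 1 else 0

lemma edgeIndicator_eq_add (hdisj : Disjoint T Z) {a b : Fin d → ℤ} (ha : a ∈ T ∪ Z)
    (hb : b ∈ T ∪ Z) :
    edgeIndicator T Z a b = T.indicator 1 a + T.indicator 1 b := by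
  have hTZ : ∀ c ∈ T, c ∉ Z := fun _ h => Set.disjoint_left.1 hdisj h
  have hZT : ∀ c ∈ Z, c ∉ T := fun _ h => Set.disjoint_right.1 hdisj h
  rcases ha with ha | ha <;> rcases hb with hb | hb
  · simp [edgeIndicator, ha, hb, hTZ, CharTwo.add_self_eq_zero]
  · simp [edgeIndicator, ha, hb, hZT]
  · simp [edgeIndicator, ha, hb, hZT]
  · simp [edgeIndicator, hZT, ha, hb]

lemma isStarCocycle_edgeIndicator (hdisj : Disjoint T Z)
    (hfill : ∀ t ∈ T, ∀ z ∈ Z, ∀ c, StarAdj t c → StarAdj z c → c ∈ T ∪ Z) :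
    IsStarCocycle (edgeIndicator T Z) := by
  intro a b c hab hbc hac
  by_cases h : (∃ t ∈ T, StarAdj t a ∧ StarAdj t b ∧ StarAdj t c) ∧
      ∃ z ∈ Z, StarAdj z a ∧ StarAdj z b ∧ StarAdj z c
  · obtain ⟨⟨t, ht, hta, htb, htc⟩, z, hz, hza, hzb, hzc⟩ := h
    have ha := hfill t ht z hz a hta hza
    have hb := hfill t ht z hz b htb hzb
    have hc := hfill t ht z hz c htc hzc
    rw [edgeIndicator_eq_add hdisj ha hb, edgeIndicator_eq_add hdisj hb hc,
      edgeIndicator_eq_add hdisj ha hc, add_assoc, ← add_assoc (T.indicator 1 b),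
      CharTwo.add_self_eq_zero, zero_add]
  · have hadj : ∀ u, (u = a ∨ u = b ∨ u = c) → StarAdj u a ∧ StarAdj u b ∧ StarAdj u c := by
      rintro u (rfl | rfl | rfl)
      · exact ⟨.refl _, hab, hac⟩
      · exact ⟨hab.symm, .refl _, hbc⟩
      · exact ⟨hac.symm, hbc.symm, .refl _⟩
    have hzero : ∀ u v, (u = a ∨ u = b ∨ u = c) → (v = a ∨ v = b ∨ v = c) →
        edgeIndicator T Z u v = 0 := by
      refine fun u v hu hv => if_neg ?_
      rintro (⟨huT, hvZ⟩ | ⟨hvT, huZ⟩)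
      · exact h ⟨⟨u, huT, hadj u hu⟩, v, hvZ, hadj v hv⟩
      · exact h ⟨⟨v, hvT, hadj v hv⟩, u, huZ, hadj u hu⟩
    rw [hzero a b (by simp) (by simp), hzero b c (by simp) (by simp),
      hzero a c (by simp) (by simp), add_zero]

/-- A potential of the edge indicator is constant on `T` and on `D`, so the indicator takes the same
value on all edges between `T` and `D`. -/
lemma mem_of_isStarCocycle_edgeIndicator (hT : StarConnected T) (hD : StarConnected D)
    (hdisj : Disjoint T D) (hZD : Z ⊆ D) (hcocycle : IsStarCocycle (edgeIndicator T Z))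
    {t₀ y₀ t₁ y₁ : Fin d → ℤ} (ht₀ : t₀ ∈ T) (hy₀ : y₀ ∈ Z) (hadj₀ : StarAdj t₀ y₀)
    (ht₁ : t₁ ∈ T) (hy₁ : y₁ ∈ D) (hadj₁ : StarAdj t₁ y₁) : y₁ ∈ Z := by
  have hTD : ∀ c ∈ T, c ∉ D := fun _ h => Set.disjoint_left.1 hdisj h
  obtain ⟨g, hg⟩ := hcocycle.exists_potential
  have hgT : ∀ x y, StepIn T x y → g x = g y := by
    refine fun x y h => sub_eq_zero.1 ((hg x y h.2.2).symm.trans (if_neg ?_))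
    rintro (⟨-, hyZ⟩ | ⟨-, hxZ⟩)
    · exact hTD y h.2.1 (hZD hyZ)
    · exact hTD x h.1 (hZD hxZ)
  have hgD : ∀ x y, StepIn D x y → g x = g y := by
    refine fun x y h => sub_eq_zero.1 ((hg x y h.2.2).symm.trans (if_neg ?_))
    rintro (⟨hxT, -⟩ | ⟨hyT, -⟩)
    · exact hTD x hxT h.1
    · exact hTD y hyT h.2.1
  have hone : edgeIndicator T Z t₁ y₁ = 1 := by
    rw [hg _ _ hadj₁, hT.apply_eq hgT ht₁ ht₀, hD.apply_eq hgD hy₁ (hZD hy₀), ← hg _ _ hadj₀]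
    exact if_pos (Or.inl ⟨ht₀, hy₀⟩)
  by_contra hy₁Z
  refine zero_ne_one ((if_neg ?_).symm.trans hone)
  rintro (⟨-, h⟩ | ⟨h, -⟩)
  · exact hy₁Z h
  · exact hTD y₁ h hy₁

/-- The points of `D` that are star-adjacent to `T`. -/
def boundaryTowards (T D : Set (Fin d → ℤ)) : Set (Fin d → ℤ) := {y ∈ D | ∃ t ∈ T, StarAdj t y}

lemma starConnected_boundaryTowards (hT : StarConnected T) (hD : StarConnected D)
    (hdisj : Disjoint T D) (hclosed : ∀ x ∈ D, ∀ y, y ∉ T → StarAdj x y → y ∈ D) :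
    StarConnected (boundaryTowards T D) := by
  rintro y₀ hy₀ y₁ ⟨hy₁D, t₁, ht₁, hadj₁⟩
  set B := boundaryTowards T D
  set Z : Set (Fin d → ℤ) := {y ∈ B | Relation.ReflTransGen (StepIn B) y₀ y}
  have hZD : Z ⊆ D := fun z hz => hz.1.1
  have hfill : ∀ t ∈ T, ∀ z ∈ Z, ∀ c, StarAdj t c → StarAdj z c → c ∈ T ∪ Z := by
    refine fun t ht z hz c htc hzc => or_iff_not_imp_left.2 fun hc => ?_
    have hcB : c ∈ B := ⟨hclosed z (hZD hz) c hc hzc, t, ht, htc⟩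
    exact ⟨hcB, hz.2.tail ⟨hz.1, hcB, hzc⟩⟩
  obtain ⟨t₀, ht₀, hadj₀⟩ := hy₀.2
  exact (mem_of_isStarCocycle_edgeIndicator hT hD hdisj hZD
    (isStarCocycle_edgeIndicator (hdisj.mono_right hZD) hfill) ht₀ (y₀ := y₀) ⟨hy₀, .refl⟩ hadj₀
    ht₁ hy₁D hadj₁).2

end StarConnected

section OuterBoundary

variable {d N : ℕ} {T : Set (Fin d → ℤ)}

lemma reflTransGen_of_apply_eq {a b : Fin d → ℤ} {i : Fin d} (h : a i = b i) :
    Relation.ReflTransGen (StepIn {y | y i = b i}) a b := by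
  have hmem : ∀ n, (b + shrink^[n] (a - b)) ∈ {y : Fin d → ℤ | y i = b i} := fun n => by
    have habs := natAbs_iterate_shrink (a - b) n i
    simp only [Pi.sub_apply, h, sub_self, Int.natAbs_zero, Nat.zero_sub,
      Int.natAbs_eq_zero] at habs
    change b i + shrink^[n] (a - b) i = b i
    rw [habs, add_zero]
  have hpath : ∀ n, Relation.ReflTransGen (StepIn {y | y i = b i}) a (b + shrink^[n] (a - b)) := by
    intro n
    induction n with
    | zero => simpa using Relation.ReflTransGen.refl
    | succ n ih =>
      refine ih.tail ⟨hmem n, hmem (n + 1), fun j => ?_⟩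
      have hj := starAdj_shrink (shrink^[n] (a - b)) j
      rw [Function.iterate_succ_apply']
      simpa using hj
  have hend := hpath (shrinkTime (a - b))
  rwa [iterate_shrink_eq_zero le_rfl, add_zero] at hend

/-- The complement of the lattice cube `{-N, …, N}^d`. -/
def outside (d N : ℕ) : Set (Fin d → ℤ) := {y | ∃ i, (N : ℤ) < |y i|}

lemma starConnected_outside (hd : 2 ≤ d) (N : ℕ) : StarConnected (outside d N) := by
  have hN : (N : ℤ) < |(N + 1 : ℤ)| := by rw [abs_of_nonneg (by positivity)]; omega
  refine starConnected_of_forall_reflTransGen (x := fun _ => (N : ℤ) + 1) ?_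
  rintro x ⟨i, hi⟩
  refine reflTransGen_stepIn_symm ?_
  have : Nontrivial (Fin d) := Fin.nontrivial_iff_two_le.2 hd
  obtain ⟨j, hj⟩ := exists_ne i
  set corner := Function.update x j ((N : ℤ) + 1)
  have hcorner_i : corner i = x i := Function.update_of_ne hj.symm _ _
  have hcorner_j : corner j = N + 1 := Function.update_self _ _ _
  refine (reflTransGen_stepIn_mono ?_ (reflTransGen_of_apply_eq (i := i) hcorner_i.symm)).trans
    (reflTransGen_stepIn_mono ?_ (reflTransGen_of_apply_eq (i := j) hcorner_j))
  · intro y hy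
    exact ⟨i, by rw [show y i = corner i from hy, hcorner_i]; exact hi⟩
  · intro y hy
    exact ⟨j, by rw [show y j = (N : ℤ) + 1 from hy]; exact hN⟩

/-- The points that can be reached from outside the lattice cube `{-N, …, N}^d` without entering
`T`. -/
def exterior (T : Set (Fin d → ℤ)) (N : ℕ) : Set (Fin d → ℤ) :=
  {y | ∃ o ∈ outside d N, Relation.ReflTransGen (StepIn Tᶜ) o y}

lemma outside_subset_exterior : outside d N ⊆ exterior T N := fun o ho => ⟨o, ho, .refl⟩

lemma disjoint_exterior (hout : outside d N ⊆ Tᶜ) : Disjoint T (exterior T N) := by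
  refine Set.disjoint_right.2 ?_
  rintro y ⟨o, ho, h⟩
  rcases Relation.ReflTransGen.cases_tail h with rfl | ⟨c, -, hstep⟩
  · exact hout ho
  · exact hstep.2.1

lemma mem_exterior_of_starAdj (hout : outside d N ⊆ Tᶜ) {x y : Fin d → ℤ} (hx : x ∈ exterior T N)
    (hy : y ∉ T) (hxy : StarAdj x y) : y ∈ exterior T N := by
  have hxT : x ∉ T := Set.disjoint_right.1 (disjoint_exterior hout) hx
  obtain ⟨o, ho, h⟩ := hx
  exact ⟨o, ho, h.tail ⟨hxT, hy, hxy⟩⟩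

lemma starConnected_exterior (hd : 2 ≤ d) : StarConnected (exterior T N) := by
  have hlift : ∀ o ∈ outside d N, ∀ y, Relation.ReflTransGen (StepIn Tᶜ) o y →
      Relation.ReflTransGen (StepIn (exterior T N)) o y := by
    intro o ho y h
    induction h with
    | refl => exact .refl
    | tail hb hbc ih => exact ih.tail ⟨⟨o, ho, hb⟩, ⟨o, ho, hb.tail hbc⟩, hbc.2.2⟩
  rintro x ⟨o, ho, hx⟩ y ⟨o', ho', hy⟩
  exact (reflTransGen_stepIn_symm (hlift o ho x hx)).trans
    ((reflTransGen_stepIn_mono outside_subset_exterior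
      (starConnected_outside hd N o ho o' ho')).trans (hlift o' ho' y hy))

lemma exists_exit_mem_exterior (hout : outside d N ⊆ Tᶜ) {u : ℕ → (Fin d → ℤ)}
    (hu : ∀ k, StarAdj (u k) (u (k + 1))) (hstart : u 0 ∈ T) {K : ℕ}
    (hend : ∀ k, K < k → u k ∈ outside d N) : ∃ m, u m ∈ T ∧ u (m + 1) ∈ exterior T N := by
  classical
  set m := Nat.findGreatest (fun k => u k ∈ T) K
  have hafter : ∀ l, m < l → u l ∉ T := by
    intro l hl
    rcases le_or_gt l K with hlK | hlK
    · exact Nat.findGreatest_is_greatest hl hlK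
    · exact hout (hend l hlK)
  refine ⟨m, Nat.findGreatest_spec (P := fun k => u k ∈ T) (Nat.zero_le K) hstart,
    u (m + 1 + K), hend _ (by omega), ?_⟩
  generalize K = n
  induction n with
  | zero => exact .refl
  | succ n ih =>
    exact Relation.ReflTransGen.head
      ⟨hafter _ (by omega), hafter _ (by omega), (hu (m + 1 + n)).symm⟩ ih

lemma abs_apply_sub_le_length {G : SimpleGraph (Fin d → ℤ)} (hG : ∀ x y, G.Adj x y → StarAdj x y)
    {x y : Fin d → ℤ} (w : G.Walk x y) (i : Fin d) : |x i - y i| ≤ w.length := by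
  induction w with
  | nil => simp
  | @cons x v y h p ih =>
    have hstep := hG _ _ h i
    have htri := abs_sub_le (x i) (v i) (y i)
    rw [SimpleGraph.Walk.length_cons]
    push_cast
    linarith

lemma exists_injOn_path {B : Set (Fin d → ℤ)} {x y : Fin d → ℤ} (hx : x ∈ B)
    (h : Relation.ReflTransGen (StepIn B) x y) {i : Fin d} (hN : (N : ℤ) ≤ |x i - y i|) :
    ∃ p : ℕ → (Fin d → ℤ), p 0 = x ∧ (∀ k ≤ N, p k ∈ B) ∧
      (∀ k < N, StarAdj (p k) (p (k + 1))) ∧ Set.InjOn p {k | k ≤ N} := by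
  classical
  let G : SimpleGraph (Fin d → ℤ) :=
    { Adj := fun a b => a ≠ b ∧ StepIn B a b
      symm := ⟨fun _ _ h => ⟨h.1.symm, h.2.symm⟩⟩
      loopless := ⟨fun _ h => h.1 rfl⟩ }
  have hreach : G.Reachable x y := by
    clear hN
    induction h with
    | refl => exact .refl _
    | @tail b c _ hbc ih =>
      by_cases heq : b = c
      · exact heq ▸ ih
      · exact ih.trans (SimpleGraph.Adj.reachable ⟨heq, hbc⟩)
  obtain ⟨w, hw⟩ := hreach.exists_isPath
  have hlen : N ≤ w.length := by
    exact_mod_cast hN.trans (abs_apply_sub_le_length (G := G) (fun _ _ h => h.2.2.2) w i)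
  have hadj : ∀ k < N, G.Adj (w.getVert k) (w.getVert (k + 1)) := fun k hk =>
    w.adj_getVert_succ (hk.trans_le hlen)
  refine ⟨w.getVert, w.getVert_zero, fun k hk => ?_, fun k hk => (hadj k hk).2.2.2, ?_⟩
  · cases k with
    | zero => simpa using hx
    | succ k => exact (hadj k hk).2.2.1
  · exact hw.getVert_injOn.mono fun k hk => le_trans hk hlen

lemma exists_boundary_pair (hout : outside d N ⊆ Tᶜ) (h0 : 0 ∈ T) {z : Fin d → ℤ} (hz : z ∈ T)
    {i : Fin d} (hzi : |z i| = N) :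
    ∃ y₀ ∈ boundaryTowards T (exterior T N), ∃ y₁ ∈ boundaryTowards T (exterior T N),
      StarAdj z y₀ ∧ (N : ℤ) ≤ |y₀ i - y₁ i| := by
  obtain ⟨e, he, hze⟩ : ∃ e : ℤ, (e = 1 ∨ e = -1) ∧ z i = e * N := by
    rcases abs_choice (z i) with h | h
    · exact ⟨1, Or.inl rfl, by omega⟩
    · exact ⟨-1, Or.inr rfl, by omega⟩
  set y₀ : Fin d → ℤ := Function.update z i (e * (N + 1)) with hy₀
  have hy₀i : y₀ i = e * (N + 1) := Function.update_self _ _ _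
  have hy₀out : y₀ ∈ outside d N := ⟨i, by
    rw [hy₀i]; rcases he with rfl | rfl <;> rw [lt_abs] <;> omega⟩
  have hadj₀ : StarAdj z y₀ := fun j => by
    rcases eq_or_ne j i with rfl | hj
    · rw [hy₀i, hze, abs_le]; rcases he with rfl | rfl <;> omega
    · rw [hy₀, Function.update_of_ne hj]; simp
  let ray : ℕ → (Fin d → ℤ) := fun k => Pi.single i (-e * k)
  have hray : ∀ k, ray k i = -e * k := fun k => Pi.single_eq_same _ _
  have hray_adj : ∀ k, StarAdj (ray k) (ray (k + 1)) := fun k j => by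
    rcases eq_or_ne j i with rfl | hj
    · rw [hray, hray, abs_le]; push_cast; rcases he with rfl | rfl <;> omega
    · simp [ray, Pi.single_eq_of_ne hj]
  have hray_out : ∀ k, N < k → ray k ∈ outside d N := fun k hk => ⟨i, by
    rw [hray]; rcases he with rfl | rfl <;> rw [lt_abs] <;> omega⟩
  obtain ⟨m, hm, hm'⟩ :=
    exists_exit_mem_exterior hout hray_adj (by simpa [ray] using h0) hray_out
  refine ⟨y₀, ⟨outside_subset_exterior hy₀out, z, hz, hadj₀⟩, ray (m + 1),
    ⟨hm', ray m, hm, hray_adj m⟩, hadj₀, ?_⟩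
  rw [hy₀i, hray, le_abs]
  push_cast
  rcases he with rfl | rfl <;> omega

lemma exists_path_outer_boundary (hd : 2 ≤ d) (hT : StarConnected T) (h0 : 0 ∈ T)
    (hN : ∀ z ∈ T, ∀ i, |z i| ≤ N) {z : Fin d → ℤ} (hz : z ∈ T) {i : Fin d} (hzi : |z i| = N) :
    ∃ p : ℕ → (Fin d → ℤ), (∀ j, |p 0 j| ≤ N + 1) ∧ (∀ k ≤ N, p k ∉ T ∧ ∃ t ∈ T, StarAdj t (p k)) ∧
      (∀ k < N, StarAdj (p k) (p (k + 1))) ∧ Set.InjOn p {k | k ≤ N} := by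
  have hout : outside d N ⊆ Tᶜ := fun y ⟨j, hj⟩ hy => absurd (hN y hy j) (not_le.2 hj)
  have hdisj := disjoint_exterior hout
  have hconn := starConnected_boundaryTowards hT (starConnected_exterior hd) hdisj
    fun x hx y hy hxy => mem_exterior_of_starAdj hout hx hy hxy
  obtain ⟨y₀, hy₀, y₁, hy₁, hadj, hdist⟩ := exists_boundary_pair hout h0 hz hzi
  obtain ⟨p, rfl, hpB, hp_adj, hp_inj⟩ := exists_injOn_path hy₀ (hconn y₀ hy₀ y₁ hy₁) hdist
  refine ⟨p, fun j => ?_,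
    fun k hk => ⟨Set.disjoint_right.1 hdisj (hpB k hk).1, (hpB k hk).2⟩, hp_adj, hp_inj⟩
  have hstep := abs_le.1 (hadj j)
  have hzj := abs_le.1 (hN z hz j)
  rw [abs_le]
  constructor <;> linarith

end OuterBoundary

/-! ### Contours and neighbourhoods of finite clusters -/

section VacantFamilies

open scoped Pointwise

variable {d : ℕ}

/-- The lattice cube `{-N, …, N}^d`. -/
def latticeCube (d N : ℕ) : Finset (Fin d → ℤ) :=
  Fintype.piFinset fun _ => Finset.Icc (-(N : ℤ)) N

lemma mem_latticeCube {N : ℕ} {z : Fin d → ℤ} : z ∈ latticeCube d N ↔ ∀ i, |z i| ≤ N := by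
  simp [latticeCube, abs_le]

lemma card_latticeCube (N : ℕ) : (latticeCube d N).card = (2 * N + 1) ^ d := by
  simp only [latticeCube, Fintype.card_piFinset, Int.card_Icc, Finset.prod_const, Finset.card_univ,
    Fintype.card_fin]
  congr 1
  omega

/-- The star-neighbours of a lattice point, including the point itself. -/
def starNeighbors (y : Fin d → ℤ) : Finset (Fin d → ℤ) :=
  Fintype.piFinset fun i => Finset.Icc (y i - 1) (y i + 1)

lemma mem_starNeighbors {y z : Fin d → ℤ} : z ∈ starNeighbors y ↔ StarAdj y z := by
  simp only [starNeighbors, Fintype.mem_piFinset, Finset.mem_Icc, StarAdj, abs_le]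
  refine forall_congr' fun i => ?_
  constructor <;> rintro ⟨hl, hu⟩ <;> constructor <;> linarith

lemma card_starNeighbors (y : Fin d → ℤ) : (starNeighbors y).card = 3 ^ d := by
  simp only [starNeighbors, Fintype.card_piFinset, Int.card_Icc]
  rw [Finset.prod_congr rfl (g := fun _ => 3) fun i _ => by omega]
  simp

/-- The vertex sets of star-paths with `n` steps starting at `y`. -/
def pathSets : ℕ → (Fin d → ℤ) → Finset (Finset (Fin d → ℤ))
  | 0, y => {{y}}
  | n + 1, y => (starNeighbors y).biUnion fun y' => (pathSets n y').image (insert y)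

lemma card_pathSets_le (n : ℕ) (y : Fin d → ℤ) : (pathSets n y).card ≤ (3 ^ d) ^ n := by
  induction n generalizing y with
  | zero => simp [pathSets]
  | succ n ih =>
    rw [pathSets, pow_succ, mul_comm, ← card_starNeighbors y]
    refine Finset.card_biUnion_le_card_mul _ _ _ fun y' _ => ?_
    rw [card_starNeighbors]
    exact Finset.card_image_le.trans (ih y')

lemma image_mem_pathSets (n : ℕ) (p : ℕ → (Fin d → ℤ))
    (h : ∀ k < n, StarAdj (p k) (p (k + 1))) :
    (Finset.range (n + 1)).image p ∈ pathSets n (p 0) := by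
  induction n generalizing p with
  | zero => simp [pathSets]
  | succ n ih =>
    rw [pathSets, Finset.mem_biUnion]
    refine ⟨p 1, mem_starNeighbors.2 (h 0 (by omega)), Finset.mem_image.2
      ⟨_, ih (fun k => p (k + 1)) fun k hk => h (k + 1) (by omega), ?_⟩⟩
    rw [Finset.range_add_one' (n + 1), Finset.image_insert, Finset.map_eq_image, Finset.image_image]
    rfl

/-- The vertex sets of star-paths with `N` steps and without repetitions that start close to the
cube `{-N, …, N}^d`. -/
def contours (d N : ℕ) : Finset (Finset (Fin d → ℤ)) :=
  ((latticeCube d (N + 1)).biUnion (pathSets N)).filter fun F => F.card = N + 1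

lemma card_contours_le (N : ℕ) : (contours d N).card ≤ (2 * N + 3) ^ d * (3 ^ d) ^ N := by
  refine (Finset.card_filter_le _ _).trans ?_
  refine (Finset.card_biUnion_le_card_mul _ _ _ fun y _ => card_pathSets_le N y).trans_eq ?_
  rw [card_latticeCube]
  congr 2

lemma card_of_mem_contours {N : ℕ} {F : Finset (Fin d → ℤ)} (h : F ∈ contours d N) :
    F.card = N + 1 := (Finset.mem_filter.1 h).2

/-- The Euclidean vector of a lattice point. -/
def latticeVec (z : Fin d → ℤ) : E d := WithLp.toLp 2 fun i => (z i : ℝ)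

open Classical in
/-- The lattice points `z` with `|z| + √d < ρ`: any two points of the unit cells of `0` and of `z`
have distance less than `ρ`. -/
def discreteBall (d : ℕ) (ρ : ℝ) : Finset (Fin d → ℤ) :=
  (latticeCube d ⌈ρ⌉₊).filter fun z => ‖latticeVec z‖ + √d < ρ

lemma mem_discreteBall {ρ : ℝ} {z : Fin d → ℤ} :
    z ∈ discreteBall d ρ ↔ ‖latticeVec z‖ + √d < ρ := by
  simp only [discreteBall, Finset.mem_filter, mem_latticeCube, and_iff_right_iff_imp]
  intro h i
  have hnorm : |(z i : ℝ)| ≤ ‖latticeVec z‖ := PiLp.norm_apply_le (latticeVec z) i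
  have hceil : |(z i : ℝ)| ≤ (⌈ρ⌉₊ : ℝ) := by
    linarith [Nat.le_ceil ρ, Real.sqrt_nonneg d]
  exact_mod_cast hceil

lemma volume_le_card_discreteBall [NeZero d] {ρ : ℝ} (hρ : 2 * √d ≤ ρ) :
    ballVolume d * (ρ - 2 * √d) ^ d ≤ (discreteBall d ρ).card := by
  have hsub : Metric.ball (0 : E d) (ρ - 2 * √d) ⊆ ⋃ z ∈ discreteBall d ρ, cell 1 z := by
    intro y hy
    refine Set.mem_biUnion (x := cellIndex 1 y) ?_ (mem_cell_cellIndex one_pos y)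
    change cellIndex 1 y ∈ discreteBall d ρ
    rw [mem_discreteBall]
    have hdist : dist (latticeVec (cellIndex 1 y)) y ≤ 1 * √d := by
      refine dist_le_of_mem_cell zero_le_one (z := cellIndex 1 y) (fun i => ?_)
        (mem_cell_cellIndex one_pos y)
      simp [latticeVec]
    have htri := dist_triangle (latticeVec (cellIndex 1 y)) y 0
    rw [Metric.mem_ball] at hy
    rw [dist_zero_right] at htri
    linarith
  have hvol := volume_le_card_mul_pow _ hsub
  rwa [volume_ball_eq (by linarith), ENNReal.ofReal_one, one_pow, mul_one,
    ← ENNReal.ofReal_natCast, ENNReal.ofReal_le_ofReal_iff (by positivity)] at hvol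

/-- Families of sets of cells, one of which has to be vacant if the cluster of a point close to the
origin is finite: the family with index `0` consists of the neighbourhoods of the small clusters,
and the one with index `k + 1` of the contours around the clusters of extent `M + k`. -/
def vacantFamily (d : ℕ) (ρ : ℝ) (M : ℕ) : ℕ → Finset (Finset (Fin d → ℤ))
  | 0 => ((latticeCube d M).powerset.filter Finset.Nonempty).image
      fun S => (S + discreteBall d ρ) \ S
  | k + 1 => contours d (M + k)

lemma card_le_card_add_sdiff {S D : Finset (Fin d → ℤ)} (hS : S.Nonempty) :
    D.card - 1 ≤ ((S + D) \ S).card := by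
  rcases D.eq_empty_or_nonempty with rfl | hD
  · simp
  · have hsum := cauchy_davenport_of_isAddTorsionFree hS hD
    have hsdiff := Finset.le_card_sdiff S (S + D)
    have hpos := hS.card_pos
    omega

end VacantFamilies

section ClusterGeometry

open scoped Pointwise

variable {d : ℕ} {V : Set (E d)} {r s ρ : ℝ} {x : E d}

lemma starAdj_cellIndex (hs : 0 < s) {p q : E d} (h : dist p q < s) :
    StarAdj (cellIndex s p) (cellIndex s q) := by
  intro i
  have hi := abs_lt.1 ((abs_apply_sub_le_dist p q i).trans_lt h)
  have hp := mem_cell_cellIndex hs p i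
  have hq := mem_cell_cellIndex hs q i
  have hpq : (cellIndex s p i : ℝ) < cellIndex s q i + 2 := by nlinarith
  have hqp : (cellIndex s q i : ℝ) < cellIndex s p i + 2 := by nlinarith
  have hpq' : cellIndex s p i < cellIndex s q i + 2 := by exact_mod_cast hpq
  have hqp' : cellIndex s q i < cellIndex s p i + 2 := by exact_mod_cast hqp
  rw [abs_le]
  constructor <;> omega

lemma reflTransGen_cellIndex_segment (hs : 0 < s) {U : Set (E d)} {p q : E d}
    (h : segment ℝ p q ⊆ U) :
    Relation.ReflTransGen (StepIn (cellsMeeting s U)) (cellIndex s p) (cellIndex s q) := by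
  obtain ⟨n, hn⟩ := exists_nat_gt (dist p q / s)
  have hn0 : (0 : ℝ) < n := lt_of_le_of_lt (by positivity) hn
  rw [div_lt_iff₀ hs] at hn
  let u : ℕ → E d := fun k => AffineMap.lineMap p q ((k : ℝ) / n)
  have hmem : ∀ k ≤ n, cellIndex s (u k) ∈ cellsMeeting s U := fun k hk =>
    ⟨u k, mem_cell_cellIndex hs _, h (by
      rw [segment_eq_image_lineMap]
      exact ⟨_, ⟨by positivity, by rw [div_le_one hn0]; exact_mod_cast hk⟩, rfl⟩)⟩
  have hdist : ∀ k, dist (u k) (u (k + 1)) < s := by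
    intro k
    simp only [u]
    rw [dist_lineMap_lineMap, Real.dist_eq]
    push_cast
    rw [show (k : ℝ) / n - (k + 1) / n = -(1 / n) by ring, abs_neg, abs_of_pos (by positivity),
      div_mul_eq_mul_div, one_mul, div_lt_iff₀ hn0]
    linarith
  have hpath : ∀ k ≤ n, Relation.ReflTransGen (StepIn (cellsMeeting s U))
      (cellIndex s (u 0)) (cellIndex s (u k)) := by
    intro k hk
    induction k with
    | zero => exact .refl
    | succ k ih =>
      exact (ih (by omega)).tail ⟨hmem k (by omega), hmem _ hk, starAdj_cellIndex hs (hdist k)⟩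
  simpa [u, div_self hn0.ne'] using hpath n le_rfl

lemma reflTransGen_cellIndex_thickening (hs : 0 < s) {C : Set (E d)} {c p : E d} (hc : c ∈ C)
    (hp : dist p c < ρ) :
    Relation.ReflTransGen (StepIn (cellsMeeting s (Metric.thickening ρ C)))
      (cellIndex s c) (cellIndex s p) :=
  reflTransGen_cellIndex_segment hs <|
    ((convex_ball c ρ).segment_subset (Metric.mem_ball_self (dist_nonneg.trans_lt hp)) hp).trans
      (Metric.ball_subset_thickening hc ρ)

lemma starConnected_cellsMeeting_thickening_cluster (hs : 0 < s) :
    StarConnected (cellsMeeting s (Metric.thickening (r / 2) (cluster r V x))) := by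
  set C := cluster r V x
  set T := cellsMeeting s (Metric.thickening (r / 2) C)
  have hstep : ∀ a ∈ C, ∀ c ∈ C, dist a c < r →
      Relation.ReflTransGen (StepIn T) (cellIndex s a) (cellIndex s c) := by
    intro a ha c hc hac
    have hleft : dist (midpoint ℝ a c) a < r / 2 := by
      rw [dist_midpoint_left]; norm_num; linarith
    have hright : dist (midpoint ℝ a c) c < r / 2 := by
      rw [dist_midpoint_right]; norm_num; linarith
    exact (reflTransGen_cellIndex_thickening hs ha hleft).trans
      (reflTransGen_stepIn_symm (reflTransGen_cellIndex_thickening hs hc hright))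
  have hcluster : ∀ c ∈ C, Relation.ReflTransGen (StepIn T) (cellIndex s x) (cellIndex s c) :=
    fun c hc => cluster_induction
      (p := fun c => Relation.ReflTransGen (StepIn T) (cellIndex s x) (cellIndex s c)) .refl
      (fun a ha c hc hac h => h.trans (hstep a ha c hc hac)) hc
  refine starConnected_of_forall_reflTransGen (x := cellIndex s x) ?_
  rintro z ⟨p, hpz, hp⟩
  obtain ⟨c, hc, hpc⟩ := Metric.mem_thickening_iff.1 hp
  rw [mem_cell_iff hs] at hpz
  exact hpz ▸ (hcluster c hc).trans (reflTransGen_cellIndex_thickening hs hc hpc)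

lemma disjoint_cell_of_starAdj_thickening_cluster (hr : 0 < r) (hs : 0 ≤ s)
    (hsr : 4 * (s * √d) ≤ r) {t y : Fin d → ℤ}
    (ht : t ∈ cellsMeeting s (Metric.thickening (r / 2) (cluster r V x))) (hty : StarAdj t y)
    (hy : y ∉ cellsMeeting s (Metric.thickening (r / 2) (cluster r V x))) :
    Disjoint (cell s y) V := by
  refine Set.disjoint_left.2 fun q hq hqV => hy ?_
  obtain ⟨p, hpt, hp⟩ := ht
  obtain ⟨c, hc, hpc⟩ := Metric.mem_thickening_iff.1 hp
  have hpq : dist p q ≤ (2 * s) * √d := by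
    refine dist_le_of_forall_abs_le (by positivity) fun i => ?_
    have hpi := hpt i
    have hqi := hq i
    have hle : (t i : ℝ) - y i ≤ 1 := by exact_mod_cast (abs_le.1 (hty i)).2
    have hge : (-1 : ℝ) ≤ t i - y i := by exact_mod_cast (abs_le.1 (hty i)).1
    rw [abs_le]
    constructor <;> nlinarith
  have hcq : dist c q < r := by linarith [dist_triangle_left c q p]
  exact ⟨q, hq, Metric.self_subset_thickening (half_pos hr) _ (mem_cluster_of_dist_lt hc hqV hcq)⟩

lemma dist_lt_of_mem_discreteBall (hs : 0 < s) (hρ : s * ρ = r) {z w : Fin d → ℤ}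
    (hw : w ∈ discreteBall d ρ) {c y : E d} (hc : c ∈ cell s z) (hy : y ∈ cell s (z + w)) :
    dist c y < r := by
  rw [mem_discreteBall] at hw
  have hyw : dist y (c + s • latticeVec w) ≤ s * √d := by
    refine dist_le_of_forall_abs_le hs.le fun i => ?_
    have hci := hc i
    have hyi := hy i
    simp only [latticeVec, PiLp.add_apply, PiLp.smul_apply, smul_eq_mul, Pi.add_apply,
      Int.cast_add] at hyi ⊢
    rw [abs_le]
    constructor <;> linarith
  have hcw : dist c (c + s • latticeVec w) = s * ‖latticeVec w‖ := by
    rw [dist_self_add_right, norm_smul, Real.norm_of_nonneg hs.le]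
  have htri := dist_triangle_right c y (c + s • latticeVec w)
  nlinarith

lemma exists_vacant_neighborhood (hρ : s * ρ = r) (hs : 0 < s) (hx : x ∈ V)
    (hb : Bornology.IsBounded (cluster r V x)) {M : ℕ}
    (hM : ∀ z ∈ cellsMeeting s (cluster r V x), ∀ i, |z i| ≤ M) :
    ∃ F ∈ vacantFamily d ρ M 0, ∀ z ∈ F, Disjoint (cell s z) V := by
  obtain ⟨S, hS, -⟩ := exists_finset_cell_inter_nonempty hs hb
  refine ⟨(S + discreteBall d ρ) \ S, Finset.mem_image.2 ⟨S, Finset.mem_filter.2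
    ⟨Finset.mem_powerset.2 fun z hz => mem_latticeCube.2 (hM z ((hS z).1 hz)), cellIndex s x,
      (hS _).2 ⟨x, mem_cell_cellIndex hs x, self_mem_cluster hx⟩⟩, rfl⟩, fun u hu => ?_⟩
  rw [Finset.mem_sdiff, Finset.mem_add] at hu
  obtain ⟨⟨z, hz, w, hw, rfl⟩, hnot⟩ := hu
  refine Set.disjoint_left.2 fun y hy hyV => hnot ((hS _).2 ⟨y, hy, ?_⟩)
  obtain ⟨c, hcz, hc⟩ := (hS z).1 hz
  exact mem_cluster_of_dist_lt hc hyV (dist_lt_of_mem_discreteBall hs hρ hw hcz hy)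

lemma exists_max_abs_apply [NeZero d] {T : Set (Fin d → ℤ)} (hfin : T.Finite)
    (hne : T.Nonempty) :
    ∃ N : ℕ, (∃ z ∈ T, ∃ i, |z i| = N) ∧ ∀ w ∈ T, ∀ j, |w j| ≤ N := by
  obtain ⟨w, hw⟩ := hne
  obtain ⟨⟨z, i⟩, hzi, hmax⟩ := Finset.exists_max_image
    (hfin.toFinset ×ˢ (Finset.univ : Finset (Fin d))) (fun q => (q.1 q.2).natAbs)
    ⟨(w, 0), by simpa using hw⟩
  refine ⟨(z i).natAbs, ⟨z, by simpa using hzi, i, Int.abs_eq_natAbs _⟩, fun w hw j => ?_⟩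
  rw [Int.abs_eq_natAbs]
  exact_mod_cast hmax (w, j) (by simpa using hw)

lemma exists_vacant_contour (hd : 2 ≤ d) (hs : 0 < s) (hsr : 4 * (s * √d) ≤ r)
    (hb : Bornology.IsBounded (cluster r V x)) {M : ℕ}
    (h0 : 0 ∈ cellsMeeting s (Metric.thickening (r / 2) (cluster r V x)))
    (hM : ¬∀ z ∈ cellsMeeting s (Metric.thickening (r / 2) (cluster r V x)), ∀ i, |z i| ≤ M) :
    ∃ k, ∃ F ∈ vacantFamily d ρ M k, ∀ z ∈ F, Disjoint (cell s z) V := by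
  have : NeZero d := ⟨by omega⟩
  have hr : 0 < r := by
    have : 0 < √(d : ℝ) := by positivity
    exact lt_of_lt_of_le (by positivity) hsr
  set T := cellsMeeting s (Metric.thickening (r / 2) (cluster r V x))
  obtain ⟨N, ⟨z, hz, i, hzi⟩, hN⟩ :=
    exists_max_abs_apply (finite_cellsMeeting hs hb.thickening) ⟨0, h0⟩
  have hMN : M ≤ N := by
    by_contra hlt
    exact hM fun w hw j => (hN w hw j).trans (by omega)
  obtain ⟨p, hp0, hpT, hp_adj, hp_inj⟩ := exists_path_outer_boundary hd
    (starConnected_cellsMeeting_thickening_cluster hs) h0 hN hz hzi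
  refine ⟨N - M + 1, (Finset.range (N + 1)).image p, ?_, fun w hw => ?_⟩
  · rw [vacantFamily, Nat.add_sub_cancel' hMN, contours, Finset.mem_filter, Finset.mem_biUnion]
    refine ⟨⟨p 0, mem_latticeCube.2 (by exact_mod_cast hp0), image_mem_pathSets N p hp_adj⟩, ?_⟩
    rw [Finset.card_image_of_injOn (hp_inj.mono fun k hk => by
      simpa [Nat.lt_succ_iff] using hk), Finset.card_range]
  · obtain ⟨k, hk, rfl⟩ := Finset.mem_image.1 hw
    obtain ⟨hnot, t, ht, hadj⟩ := hpT k (Nat.lt_succ_iff.1 (Finset.mem_range.1 hk))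
    exact disjoint_cell_of_starAdj_thickening_cluster hr hs.le hsr ht hadj hnot

lemma exists_vacant_of_isBounded_cluster (hd : 2 ≤ d) (hρ : s * ρ = r) (hs : 0 < s)
    (hsr : 4 * (s * √d) ≤ r) (hr : 2 * √d < r) (M : ℕ)
    (hb : Bornology.IsBounded (cluster r V x)) (hx : x ∈ V) (hx1 : x ∈ cube d 1) :
    ∃ k, ∃ F ∈ vacantFamily d ρ M k, ∀ z ∈ F, Disjoint (cell s z) V := by
  have hr0 : 0 < r := lt_of_le_of_lt (by positivity) hr
  by_cases hM : ∀ z ∈ cellsMeeting s (Metric.thickening (r / 2) (cluster r V x)), ∀ i, |z i| ≤ M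
  · exact ⟨0, exists_vacant_neighborhood hρ hs hx hb fun z ⟨c, hcz, hc⟩ =>
      hM z ⟨c, hcz, Metric.self_subset_thickening (half_pos hr0) _ hc⟩⟩
  · refine exists_vacant_contour hd hs hsr hb ⟨0, fun i => by simpa using hs,
      Metric.mem_thickening_iff.2 ⟨x, self_mem_cluster hx, ?_⟩⟩ hM
    rw [dist_comm]
    linarith [dist_le_of_mem_cube_one hx1]

end ClusterGeometry

/-! ### The union bound over vacant families -/

section VacancyBound

variable {Ω : Type*} [MeasurableSpace Ω] {d : ℕ} {P : Measure Ω} [IsProbabilityMeasure P]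
  {Λ X : Ω → Measure (E d)} {lam : ℝ} {b : ℝ≥0}

lemma one_sub_percolationProbability_le_tsum_vacantFamily (hd : 2 ≤ d) (hlam : 0 < lam)
    (hΛ : IsStationaryRandomMeasure P Λ) (hmean : ∫⁻ ω, Λ ω (unitCube d) ∂P = 1)
    (hX : IsCoxProcess P (fun ω => ENNReal.ofReal lam • Λ ω) X) (hdep : IsDependent P Λ b)
    {β : ℝ} (hβ : (b : ℝ) + 1 / 2 < β) {r s ρ : ℝ} (hρ : s * ρ = r) (hs : 0 < s)
    (hsr : 4 * (s * √d) ≤ r) (hr : 2 * √d < r) (M : ℕ) :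
    1 - percolationProbability P X lam r
      ≤ ∑' k, ∑ F ∈ vacantFamily d ρ M k, voidProb P Λ lam (s - 2 * β) ^ F.card := by
  have : NeZero d := ⟨by omega⟩
  have hβ_half : 1 / 2 < β := by linarith [b.2]
  let ι := Σ k : ℕ, {F // F ∈ vacantFamily d ρ M k}
  refine (one_sub_percolationProbability_le_tsum hlam hΛ hmean hX (ι := ι)
    (fun i => ⋃ z ∈ i.2.1, core s β z)
    (fun i => Finset.measurableSet_biUnion _ fun z _ => measurableSet_core s β z)
    (fun i => (Bornology.isBounded_biUnion_finset _).2 fun z _ => isBounded_box _ _)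
    (fun i => Set.disjoint_iUnion₂_right.2 fun z _ => disjoint_cube_core hs.le hβ_half z)
    ?_).trans_eq ?_
  · intro ν hν hcharged x hx hxν
    rw [shift_mem_originPercolates_iff]
    intro hfin
    obtain ⟨k, F, hF, hvac⟩ :=
      exists_vacant_of_isBounded_cluster hd hρ hs hsr hr M hfin.isBounded hxν hx
    refine hcharged ⟨k, F, hF⟩ (hν.apply_eq_zero fun y hy => ?_)
    obtain ⟨z, hz, hyz⟩ := Set.mem_iUnion₂.1 hy
    by_contra hyν
    exact Set.disjoint_left.1 (hvac z hz) (core_subset_cell (by linarith) z hyz) hyν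
  · rw [ENNReal.tsum_sigma']
    refine tsum_congr fun k => ?_
    rw [tsum_fintype, ← Finset.sum_coe_sort (vacantFamily d ρ M k)
      fun F => voidProb P Λ lam (s - 2 * β) ^ F.card]
    exact Finset.sum_congr rfl fun F _ =>
      lintegral_mul_expNeg_biUnion_core hΛ hmean hdep hs hβ F.1

lemma sum_vacantFamily_zero_le {q : ℝ≥0∞} (hq : q ≤ 1) (ρ : ℝ) (M : ℕ) :
    ∑ F ∈ vacantFamily d ρ M 0, q ^ F.card
      ≤ (2 ^ (2 * M + 1) ^ d : ℕ) * q ^ ((discreteBall d ρ).card - 1) := by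
  rw [← nsmul_eq_mul]
  refine (Finset.sum_le_card_nsmul _ _ (q ^ ((discreteBall d ρ).card - 1)) ?_).trans ?_
  · intro F hF
    obtain ⟨S, hS, rfl⟩ := Finset.mem_image.1 hF
    exact pow_le_pow_right_of_le_one' hq (card_le_card_add_sdiff (Finset.mem_filter.1 hS).2)
  · refine nsmul_le_nsmul_left zero_le ?_
    refine Finset.card_image_le.trans ((Finset.card_filter_le _ _).trans ?_)
    rw [Finset.card_powerset, card_latticeCube]

lemma two_mul_add_three_le_five_pow {n : ℕ} (hn : 1 ≤ n) : 2 * n + 3 ≤ 5 ^ n := by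
  induction n, hn using Nat.le_induction with
  | base => norm_num
  | succ n hn ih => rw [pow_succ]; omega

lemma card_vacantFamily_succ_le (ρ : ℝ) {M : ℕ} (hM : 1 ≤ M) (k : ℕ) :
    (vacantFamily d ρ M (k + 1)).card ≤ (15 ^ d) ^ (M + k) :=
  calc (vacantFamily d ρ M (k + 1)).card
      ≤ (2 * (M + k) + 3) ^ d * (3 ^ d) ^ (M + k) := card_contours_le (M + k)
    _ ≤ (5 ^ (M + k)) ^ d * (3 ^ d) ^ (M + k) :=
        Nat.mul_le_mul_right _ (Nat.pow_le_pow_left (two_mul_add_three_le_five_pow (by omega)) d)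
    _ = (15 ^ d) ^ (M + k) := by
        rw [← pow_mul, mul_comm (M + k) d, pow_mul, ← mul_pow, ← mul_pow]
        norm_num

lemma sum_vacantFamily_succ_le {q : ℝ≥0∞} (hq : q ≤ 1) (ρ : ℝ) {M : ℕ} (hM : 1 ≤ M) (k : ℕ) :
    ∑ F ∈ vacantFamily d ρ M (k + 1), q ^ F.card ≤ ((15 ^ d : ℕ) * q) ^ (M + k) := by
  have hterm : ∀ F ∈ vacantFamily d ρ M (k + 1), q ^ F.card ≤ q ^ (M + k) := fun F hF => by
    rw [card_of_mem_contours hF]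
    exact pow_le_pow_right_of_le_one' hq (Nat.le_succ _)
  refine (Finset.sum_le_card_nsmul _ _ _ hterm).trans ?_
  rw [nsmul_eq_mul, mul_pow]
  exact mul_le_mul_left (by exact_mod_cast card_vacantFamily_succ_le ρ hM k) _

/-- Neighbourhoods of clusters near the origin have at least `n - 1` cells, where `n` is the number
of points of the discrete ball, so the long contours only have to match this exponent. -/
lemma tsum_vacantFamily_le {q : ℝ≥0∞} (hq : (15 ^ d : ℕ) * q ≤ 2⁻¹) (ρ : ℝ) {M : ℕ}
    (hM : (discreteBall d ρ).card < M) :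
    ∑' k, ∑ F ∈ vacantFamily d ρ M k, q ^ F.card
      ≤ (2 ^ (2 * M + 1) ^ d + 2 * (15 ^ d) ^ M : ℕ) * q ^ ((discreteBall d ρ).card - 1) := by
  have hone : (1 : ℝ≥0∞) ≤ (15 ^ d : ℕ) := by exact_mod_cast Nat.one_le_pow _ _ (by norm_num)
  have hq_one : q ≤ 1 := by
    calc q = 1 * q := (one_mul q).symm
      _ ≤ (15 ^ d : ℕ) * q := mul_le_mul_left hone _
      _ ≤ 2⁻¹ := hq
      _ ≤ 1 := by simp
  rw [tsum_eq_zero_add' ENNReal.summable, Nat.cast_add, add_mul]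
  refine add_le_add (sum_vacantFamily_zero_le hq_one ρ M) ?_
  calc ∑' k, ∑ F ∈ vacantFamily d ρ M (k + 1), q ^ F.card
      ≤ ∑' k, ((15 ^ d : ℕ) * q) ^ M * 2⁻¹ ^ k := by
        refine ENNReal.tsum_le_tsum fun k =>
          (sum_vacantFamily_succ_le hq_one ρ (by omega) k).trans ?_
        rw [pow_add]
        exact mul_le_mul_right (pow_le_pow_left' hq k) _
    _ = ((15 ^ d : ℕ) * q) ^ M * 2 := by
        rw [ENNReal.tsum_mul_left, ENNReal.tsum_geometric, ENNReal.one_sub_inv_two, inv_inv]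
    _ = (2 * (15 ^ d) ^ M : ℕ) * q ^ M := by push_cast; rw [mul_pow]; ring
    _ ≤ (2 * (15 ^ d) ^ M : ℕ) * q ^ ((discreteBall d ρ).card - 1) :=
        mul_le_mul_right (pow_le_pow_right_of_le_one' hq_one (by omega)) _

lemma eventually_voidProb_sub_le (hlam : 0 ≤ lam) (hΛ : IsStationaryRandomMeasure P Λ)
    (hmean : ∫⁻ ω, Λ ω (unitCube d) ∂P = 1)
    {I : ℝ} (hI : Tendsto (fun R : ℝ => voidCost P Λ lam R / R ^ d) atTop (𝓝 I)) {J : ℝ}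
    (hJI : J < I) (k : ℝ) :
    ∀ᶠ s : ℝ in atTop,
      voidProb P Λ lam (s - k) ≤ ENNReal.ofReal (Real.exp (-(J * s ^ d))) := by
  have hshift : Tendsto (fun s : ℝ => s - k) atTop atTop :=
    tendsto_atTop_add_const_right atTop _ tendsto_id
  have hratio := (hI.comp hshift).mul (tendsto_add_pow_div_pow d (-k))
  rw [mul_one] at hratio
  filter_upwards [hratio.eventually (lt_mem_nhds hJI), eventually_gt_atTop k,
    eventually_gt_atTop 0] with s hJs hks hs
  have hne : (s - k) ^ d ≠ 0 := pow_ne_zero _ (sub_pos.2 hks).ne'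
  rw [Function.comp_apply, ← sub_eq_add_neg, div_mul_div_cancel₀ hne,
    lt_div_iff₀ (by positivity)] at hJs
  rw [voidProb_eq_ofReal_exp hlam hΛ hmean (sub_pos.2 hks).le]
  exact ENNReal.ofReal_le_ofReal (Real.exp_le_exp.2 (neg_le_neg hJs.le))

end VacancyBound

section PercolationUpperBound

variable {Ω : Type*} [MeasurableSpace Ω] {d : ℕ} [NeZero d] {P : Measure Ω}
  [IsProbabilityMeasure P] {Λ X : Ω → Measure (E d)} {lam : ℝ} {b : ℝ≥0} {I J : ℝ}

lemma tendsto_mul_ofReal_exp_neg_mul_pow (d : ℕ) [NeZero d] (hJ : 0 < J) {C : ℝ≥0∞} (hC : C ≠ ∞) :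
    Tendsto (fun s : ℝ => C * ENNReal.ofReal (Real.exp (-(J * s ^ d)))) atTop (𝓝 0) := by
  have hpow : Tendsto (fun s : ℝ => J * s ^ d) atTop atTop :=
    (tendsto_pow_atTop (NeZero.ne d)).const_mul_atTop hJ
  have hexp := ENNReal.tendsto_ofReal (Real.tendsto_exp_neg_atTop_nhds_zero.comp hpow)
  simpa using ENNReal.Tendsto.const_mul hexp (Or.inr hC)

lemma exists_eventually_one_sub_percolationProbability_le (hd : 2 ≤ d) (hlam : 0 < lam)
    (hΛ : IsStationaryRandomMeasure P Λ) (hmean : ∫⁻ ω, Λ ω (unitCube d) ∂P = 1)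
    (hX : IsCoxProcess P (fun ω => ENNReal.ofReal lam • Λ ω) X) (hdep : IsDependent P Λ b)
    (hI : Tendsto (fun R : ℝ => voidCost P Λ lam R / R ^ d) atTop (𝓝 I)) (hJ : 0 < J)
    (hJI : J < I) {ρ : ℝ} (hρ0 : 0 < ρ) (hρ : 4 * √d ≤ ρ) :
    ∃ K : ℕ, ∀ᶠ r : ℝ in atTop, 1 - percolationProbability P X lam r
      ≤ K * ENNReal.ofReal (Real.exp (-(J * (r / ρ) ^ d))) ^ ((discreteBall d ρ).card - 1) := by
  obtain ⟨β, hβ⟩ := exists_gt ((b : ℝ) + 1 / 2)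
  have hmesh : Tendsto (fun r : ℝ => r / ρ) atTop atTop := tendsto_id.atTop_div_const hρ0
  have hvanish := tendsto_mul_ofReal_exp_neg_mul_pow d hJ (ENNReal.natCast_ne_top (15 ^ d))
  set n := (discreteBall d ρ).card
  refine ⟨2 ^ (2 * (n + 1) + 1) ^ d + 2 * (15 ^ d) ^ (n + 1), ?_⟩
  filter_upwards [hmesh.eventually (eventually_voidProb_sub_le hlam.le hΛ hmean hI hJI (2 * β)),
    hmesh.eventually (hvanish.eventually_le_const (ENNReal.inv_pos.2 (by simp : (2 : ℝ≥0∞) ≠ ∞))),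
    eventually_gt_atTop (2 * √d)] with r hvoid hsmall hr
  have hr0 : 0 < r := lt_of_le_of_lt (by positivity) hr
  have hsρ : r / ρ * ρ = r := div_mul_cancel₀ _ hρ0.ne'
  have hsr : 4 * (r / ρ * √d) ≤ r := by
    calc 4 * (r / ρ * √d) = r / ρ * (4 * √d) := by ring
      _ ≤ r / ρ * ρ := mul_le_mul_of_nonneg_left hρ (by positivity)
      _ = r := hsρ
  calc 1 - percolationProbability P X lam r
      ≤ ∑' k, ∑ F ∈ vacantFamily d ρ (n + 1) k,
          voidProb P Λ lam (r / ρ - 2 * β) ^ F.card :=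
        one_sub_percolationProbability_le_tsum_vacantFamily hd hlam hΛ hmean hX hdep hβ hsρ
          (by positivity) hsr hr _
    _ ≤ _ := tsum_vacantFamily_le ((mul_le_mul_right hvoid _).trans hsmall) ρ (Nat.lt_succ_self _)
    _ ≤ _ := mul_le_mul_right (pow_le_pow_left' hvoid _) _

lemma tendsto_ballVolume_fraction (d : ℕ) [NeZero d] :
    Tendsto (fun ρ : ℝ => (ballVolume d * (ρ - 2 * √d) ^ d - 1) / ρ ^ d) atTop
      (𝓝 (ballVolume d)) := by
  have hball := (tendsto_add_pow_div_pow d (-(2 * √d))).const_mul (ballVolume d)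
  have hone : Tendsto (fun ρ : ℝ => (1 : ℝ) / ρ ^ d) atTop (𝓝 0) :=
    tendsto_const_nhds.div_atTop (tendsto_pow_atTop (NeZero.ne d))
  have hsub := hball.sub hone
  rw [mul_one, sub_zero] at hsub
  refine hsub.congr fun ρ => ?_
  rw [← sub_eq_add_neg]
  ring

lemma exists_lt_mul_card_discreteBall_div_pow (hI : 0 < I) {l : ℝ} (hl : l < ballVolume d * I) :
    ∃ ρ J : ℝ, 0 < ρ ∧ 4 * √d ≤ ρ ∧ 0 < J ∧ J < I ∧
      l < J * (((discreteBall d ρ).card - 1 : ℕ) / ρ ^ d) := by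
  obtain ⟨ρ, hlρ, hρ, hρ0⟩ := ((((tendsto_ballVolume_fraction d).mul_const I).eventually
    (lt_mem_nhds hl)).and ((eventually_ge_atTop (4 * √d)).and (eventually_gt_atTop 0))).exists
  set n := (discreteBall d ρ).card
  have hcard : ballVolume d * (ρ - 2 * √d) ^ d - 1 ≤ (n - 1 : ℕ) := by
    have hvol : ballVolume d * (ρ - 2 * √d) ^ d ≤ n :=
      volume_le_card_discreteBall (by linarith [Real.sqrt_nonneg d])
    have hpred : (n : ℝ) ≤ (n - 1 : ℕ) + 1 := by exact_mod_cast (by omega : n ≤ n - 1 + 1)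
    linarith
  have hlI : l < I * ((n - 1 : ℕ) / ρ ^ d) := by
    rw [mul_comm]
    exact hlρ.trans_le (by gcongr)
  have hJ : ∀ᶠ J in 𝓝[<] I, l < J * ((n - 1 : ℕ) / ρ ^ d) :=
    ((continuous_mul_const _).tendsto I).mono_left nhdsWithin_le_nhds |>.eventually
      (lt_mem_nhds hlI)
  obtain ⟨J, hlJ, hJ0, hJI⟩ := (hJ.and (Ioo_mem_nhdsLT hI)).exists
  exact ⟨ρ, J, hρ0, hρ, hJ0, hJI, hlJ⟩

lemma eventually_one_sub_percolationProbability_le (hd : 2 ≤ d) (hlam : 0 < lam)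
    (hΛ : IsStationaryRandomMeasure P Λ) (hmean : ∫⁻ ω, Λ ω (unitCube d) ∂P = 1)
    (hX : IsCoxProcess P (fun ω => ENNReal.ofReal lam • Λ ω) X) (hdep : IsDependent P Λ b)
    (hI0 : 0 ≤ I) (hI : Tendsto (fun R : ℝ => voidCost P Λ lam R / R ^ d) atTop (𝓝 I)) {ε : ℝ}
    (hε : 0 < ε) :
    ∀ᶠ r : ℝ in atTop, 1 - percolationProbability P X lam r
      ≤ ENNReal.ofReal (Real.exp (-(ballVolume d * I - ε) * r ^ d)) := by
  rcases hI0.eq_or_lt with rfl | hI_pos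
  · filter_upwards [eventually_ge_atTop 0] with r hr
    refine tsub_le_self.trans (ENNReal.one_le_ofReal.2 (Real.one_le_exp ?_))
    rw [mul_zero, zero_sub, neg_neg]
    positivity
  obtain ⟨ρ, J, hρ0, hρ, hJ, hJI, hrate⟩ :=
    exists_lt_mul_card_discreteBall_div_pow hI_pos (sub_lt_self (ballVolume d * I) (half_pos hε))
  obtain ⟨K, hK⟩ := exists_eventually_one_sub_percolationProbability_le hd hlam hΛ hmean hX hdep
    hI hJ hJI hρ0 hρ
  filter_upwards [hK, (tendsto_mul_ofReal_exp_neg_mul_pow d (half_pos hε)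
    (ENNReal.natCast_ne_top K)).eventually_le_const zero_lt_one, eventually_ge_atTop 0]
    with r hKr hprefactor hr
  set n := (discreteBall d ρ).card
  have hexponent : (n - 1 : ℕ) * -(J * (r / ρ) ^ d)
      ≤ -(ε / 2 * r ^ d) + -(ballVolume d * I - ε) * r ^ d := by
    calc (n - 1 : ℕ) * -(J * (r / ρ) ^ d) = -(J * ((n - 1 : ℕ) / ρ ^ d)) * r ^ d := by
          rw [div_pow]; ring
      _ ≤ -(ballVolume d * I - ε / 2) * r ^ d :=
          mul_le_mul_of_nonneg_right (neg_le_neg hrate.le) (pow_nonneg hr d)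
      _ = _ := by ring
  calc 1 - percolationProbability P X lam r
      ≤ K * ENNReal.ofReal (Real.exp (-(J * (r / ρ) ^ d))) ^ (n - 1) := hKr
    _ ≤ K * (ENNReal.ofReal (Real.exp (-(ε / 2 * r ^ d)))
          * ENNReal.ofReal (Real.exp (-(ballVolume d * I - ε) * r ^ d))) := by
        rw [← ENNReal.ofReal_pow (Real.exp_pos _).le, ← Real.exp_nat_mul,
          ← ENNReal.ofReal_mul (Real.exp_pos _).le, ← Real.exp_add]
        exact mul_le_mul_right (ENNReal.ofReal_le_ofReal (Real.exp_le_exp.2 hexponent)) _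
    _ ≤ ENNReal.ofReal (Real.exp (-(ballVolume d * I - ε) * r ^ d)) := by
        rw [← mul_assoc]
        exact mul_le_of_le_one_left zero_le hprefactor

end PercolationUpperBound

end CoxPercolation

end

open CoxPercolation in
theorem theorem2p3 {Ω : Type*} [MeasurableSpace Ω] (P : Measure Ω) [IsProbabilityMeasure P]
    (d : ℕ) (hd : 1 ≤ d) (Λ X : Ω → Measure (E d)) (lam : ℝ) (hlam : 0 < lam)
    (hΛ : IsStationaryRandomMeasure P Λ)
    (hmean : ∫⁻ ω, Λ ω (unitCube d) ∂P = 1)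
    (hX : IsCoxProcess P (fun ω => ENNReal.ofReal lam • Λ ω) X) :
    liminf (fun r : ℝ =>
        logRate d r (palmExpectation P Λ 1 (expNeg lam (Metric.ball 0 r)))) atTop
      ≤ liminf (fun r : ℝ => logRate d r (1 - percolationProbability P X lam r)) atTop
    ∧ (2 ≤ d → ∀ b : ℝ≥0, IsDependent P Λ b →
        HasAllExpMoments P (fun ω => Λ ω (cube d 1)) →
        ∃ I : ℝ,
          Tendsto (fun r : ℝ => logRate d r (∫⁻ ω, expNeg lam (cube d r) (Λ ω) ∂P)) atTop
            (𝓝 ((-I : ℝ) : EReal)) ∧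
          Tendsto (fun r : ℝ => logRate d r (1 - percolationProbability P X lam r)) atTop
            (𝓝 ((-((volume (Metric.ball (0 : E d) 1)).toReal * I) : ℝ) : EReal))) := by
  refine ⟨liminf_logRate_palm_le hlam hΛ hmean hX, fun hd2 b hdep hexp => ?_⟩
  have : NeZero d := ⟨by omega⟩
  obtain ⟨I, hI0, hI⟩ := exists_tendsto_voidCost hlam.le hΛ hmean hdep
  exact ⟨I, tendsto_logRate_voidProb hlam.le hΛ hmean hI, tendsto_logRate
    (fun ε hε => eventually_le_one_sub_percolationProbability hlam hΛ hmean hX hdep hexp hI0 hI hε)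
    (fun ε hε => eventually_one_sub_percolationProbability_le hd2 hlam hΛ hmean hX hdep hI0 hI hε)⟩
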